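/- Let $L,\alpha,\beta,c>0$ and $\sigma>2\pi^2/L^2$. On $L$-periodic functions let $D=\mathcal H\,\frac{d}{dx}$ be the Fourier multiplier with symbol $|2\pi n/L|$, $n\in\mathbb Z$, and for $\gamma\le 0$ let $\mathcal K_\gamma^{-1}$ be the inverse of $\mathcal K_\gamma=-\gamma D+c$, i.e. the multiplier with symbol $(-\gamma|2\pi n/L|+c)^{-1}$. Let $$\phi_0(\xi)=\eta_1\,\mathrm{dn}(\ell\xi;k),\qquad \psi_0=-\tfrac{\beta}{c}\phi_0^2$$ be the dnoidal wave of fundamental period $L$, where $0<\eta_2<\eta_1$, $\eta_1^2+\eta_2^2=\frac{2c\sigma}{\alpha\beta}$, $k^2=\frac{\eta_1^2-\eta_2^2}{\eta_1^2}$, $\ell=\eta_1\sqrt{\frac{\alpha\beta}{2c}}$ and $2K(k)/\ell=L$. For $\gamma_1>0$ consider branches $\gamma\mapsto(\phi_\gamma,\psi_\gamma)$, $\gamma\in(-\gamma_1,0]$, of real even functions in $H^2_{per}([0,L])\times H^1_{per}([0,L])$, continuous on $(-\gamma_1,0]$ and smooth on $(-\gamma_1,0)$ with values in this space, which start at the dnoidal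 wave $(\phi_0,\psi_0)$ for $\gamma=0$ and solve $$\phi_\gamma''-\sigma\phi_\gamma=\alpha\,\psi_\gamma\phi_\gamma,\qquad \gamma\mathcal H\psi_\gamma'-c\,\psi_\gamma=\beta\,\phi_\gamma^2 .$$ Such a branch exists for some $\gamma_1>0$. For every $\gamma_1>0$ and every such branch there is $\gamma_2\in(0,\gamma_1]$ such that for all $\gamma\in(-\gamma_2,0)$ the operators $$\mathcal L_\gamma=-\frac{d^2}{dx^2}+\sigma+\alpha\psi_\gamma-2\alpha\beta\,\phi_\gamma\circ\mathcal K_\gamma^{-1}\circ\phi_\gamma,\qquad \mathcal L_\gamma^+=-\frac{d^2}{dx^2}+\sigma+\alpha\psi_\gamma$$ on the complex space $L^2_{per}([0,L])$ with domain $H^2_{per}([0,L])$ are self-adjoint and have the following properties. 1. $\mathcal L_\gamma$ has a simple negative eigenvalue $\lambda_\gamma$, with an eigenfunction $\varphi_\gamma$ such that $\int_0^L\phi_\gamma\varphi_\gamma\,dx\ne0$. 2. $0$ is a simple eigenvalue of $\mathcal L_\gamma$ with eigenfunction $\phi_\gamma'$. 3. There is $\eta_\gamma>0$ such that every point of the spectrum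 of $\mathcal L_\gamma$ other than $\lambda_\gamma$ and $0$ is real and larger than $\eta_\gamma$. 4. $\mathcal L_\gamma^+$ is non-negative; $0$ is its first eigenvalue and is simple, with eigenspace spanned by $\phi_\gamma$; the remainder of its spectrum is a discrete set (finitely many points in each bounded set) of positive eigenvalues. -/

import Mathlib

open MeasureTheory AddCircle Set
open scoped ContDiff ENNReal

noncomputable section

/-! ### Jacobi's elliptic function `dn` -/

/-- Incomplete elliptic integral of the first kind `F(x; k)`. -/
def ellipticF (k x : ℝ) : ℝ := ∫ t in (0 : ℝ)..x, 1 / √(1 - k ^ 2 * Real.sin t ^ 2)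

/-- Complete elliptic integral of the first kind `K(k) = F(π/2; k)`. -/
def ellipticK (k : ℝ) : ℝ := ellipticF k (Real.pi / 2)

/-- Jacobi's amplitude: the inverse function of the bijection `F(·; k)` of `ℝ` (`0 ≤ k < 1`). -/
def jacobiAm (k u : ℝ) : ℝ := Function.invFun (ellipticF k) u

/-- `dn(u; k)`, defined by `dn² = 1 - k² sn²`, `sn = sin ∘ am`. -/
def jacobiDn (k u : ℝ) : ℝ := √(1 - k ^ 2 * Real.sin (jacobiAm k u) ^ 2)

/-! ### Unbounded operators on a complex Hilbert space -/

section Operators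

variable {H : Type*} [NormedAddCommGroup H] [InnerProductSpace ℂ H]

/-- The spectrum of an unbounded operator `T`: the complement of the set of those `z` for which
`T - z : dom T → H` has a bounded two-sided inverse `R`. -/
def opSpectrum (T : H →ₗ.[ℂ] H) : Set ℂ :=
  {z | ¬ ∃ R : H →L[ℂ] H,
    (∀ y : H, ∃ h : R y ∈ T.domain, T ⟨R y, h⟩ - z • R y = y) ∧
    (∀ x : T.domain, R (T x - z • (x : H)) = x)}

/-- The eigenspace `{f ∈ dom T : T f = z f}`. -/
def opEigenspace (T : H →ₗ.[ℂ] H) (z : ℂ) : Submodule ℂ H where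
  carrier := {f | ∃ h : f ∈ T.domain, T ⟨f, h⟩ = z • f}
  zero_mem' := ⟨T.domain.zero_mem, by
    rw [smul_zero]; exact T.map_zero⟩
  add_mem' := by
    rintro f g ⟨hf, ef⟩ ⟨hg, eg⟩
    refine ⟨T.domain.add_mem hf hg, ?_⟩
    rw [smul_add, ← ef, ← eg, ← T.map_add]
    rfl
  smul_mem' := by
    rintro a f ⟨hf, ef⟩
    refine ⟨T.domain.smul_mem a hf, ?_⟩
    rw [smul_comm, ← ef, ← T.map_smul]
    rfl

/-- `z` is a simple eigenvalue of `T` whose eigenspace is spanned by the eigenfunction `f`. -/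
def IsSimpleEigenpair (T : H →ₗ.[ℂ] H) (z : ℂ) (f : H) : Prop :=
  f ≠ 0 ∧ opEigenspace T z = Submodule.span ℂ {f}

end Operators

/-! ### Fourier multipliers on the circle of length `L` -/

/-- The wave number `2πn/L`. -/
def waveNumber (L : ℝ) (n : ℤ) : ℝ := 2 * Real.pi * n / L

/-- The symbol of the inverse of `-γ D + c`. -/
def kInvSymbol (L γ c : ℝ) (n : ℤ) : ℂ := (((-γ * |waveNumber L n| + c)⁻¹ : ℝ) : ℂ)

theorem norm_kInvSymbol_le (L : ℝ) {γ c : ℝ} (hγ : γ ≤ 0) (hc : 0 < c) (n : ℤ) :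
    ‖kInvSymbol L γ c n‖ ≤ c⁻¹ := by
  have h : c ≤ -γ * |waveNumber L n| + c := by
    have := mul_nonneg (neg_nonneg.2 hγ) (abs_nonneg (waveNumber L n))
    linarith
  rw [kInvSymbol, Complex.norm_real, Real.norm_of_nonneg (inv_nonneg.2 (hc.le.trans h))]
  exact inv_anti₀ hc h

section Circle

variable (L : ℝ) [Fact (0 < L)]

/-- Complex `L`-periodic square integrable functions. The measure is normalized to total mass one,
so that the inner product is `L⁻¹ ∫₀ᴸ f ḡ dx` up to the order of the arguments. -/
abbrev L2per : Type := Lp ℂ 2 (@haarAddCircle L _)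

variable {L}

/-- The domain `{f ∈ L² : ∑ |m n|² |f̂ n|² < ∞}` of the Fourier multiplier with symbol `m`;
`fourierBasis.repr f n` is the `n`-th Fourier coefficient of `f`. -/
def fourierMulDomain (m : ℤ → ℂ) : Submodule ℂ (L2per L) where
  carrier := {f | Memℓp (fun n => m n * fourierBasis.repr f n) 2}
  zero_mem' := by
    have e : (fun n => m n * fourierBasis.repr (0 : L2per L) n) = 0 := by
      funext n; simp
    change Memℓp (fun n => m n * fourierBasis.repr (0 : L2per L) n) 2
    rw [e]; exact zero_memℓp
  add_mem' {f g} hf hg := by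
    have e : (fun n => m n * fourierBasis.repr (f + g) n) =
        (fun n => m n * fourierBasis.repr f n) + fun n => m n * fourierBasis.repr g n := by
      funext n; simp [mul_add]
    change Memℓp (fun n => m n * fourierBasis.repr (f + g) n) 2
    rw [e]; exact Memℓp.add hf hg
  smul_mem' a f hf := by
    have e : (fun n => m n * fourierBasis.repr (a • f) n) =
        a • (fun n => m n * fourierBasis.repr f n) := by
      funext n; simp [mul_left_comm]
    change Memℓp (fun n => m n * fourierBasis.repr (a • f) n) 2
    rw [e]; exact Memℓp.const_smul hf a

/-- The sequence `n ↦ m n * f̂ n`, an element of `ℓ²(ℤ)`. -/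
def fourierMulSeq (m : ℤ → ℂ) : fourierMulDomain (L := L) m →ₗ[ℂ] lp (fun _ : ℤ => ℂ) 2 where
  toFun f := ⟨fun n => m n * fourierBasis.repr (f : L2per L) n, f.2⟩
  map_add' f g := by
    apply lp.ext; funext n
    change m n * fourierBasis.repr ((f : L2per L) + (g : L2per L)) n =
      m n * fourierBasis.repr (f : L2per L) n + m n * fourierBasis.repr (g : L2per L) n
    rw [map_add, lp.coeFn_add, Pi.add_apply, mul_add]
  map_smul' a f := by
    apply lp.ext; funext n
    change m n * fourierBasis.repr (a • (f : L2per L)) n =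
      a * (m n * fourierBasis.repr (f : L2per L) n)
    rw [map_smul, lp.coeFn_smul, Pi.smul_apply, smul_eq_mul, mul_left_comm]

/-- The Fourier multiplier with symbol `m`, on its maximal domain. -/
def fourierMul (m : ℤ → ℂ) : L2per L →ₗ.[ℂ] L2per L where
  domain := fourierMulDomain m
  toFun := fourierBasis.repr.symm.toLinearEquiv.toLinearMap ∘ₗ
    fourierMulSeq m

variable (L)

/-- `d/dx` on `H¹_per`. -/
def ddx : L2per L →ₗ.[ℂ] L2per L := fourierMul fun n => Complex.I * (waveNumber L n : ℂ)

/-- `-d²/dx²` on `H²_per`. -/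
def negLaplacian : L2per L →ₗ.[ℂ] L2per L := fourierMul fun n => ((waveNumber L n ^ 2 : ℝ) : ℂ)

/-- `D = 𝓗 d/dx` on `H¹_per`; its symbol is
`(-i sgn(n)) (2πi n / L) = |2πn/L|`. -/
def absD : L2per L →ₗ.[ℂ] L2per L := fourierMul fun n => ((|waveNumber L n| : ℝ) : ℂ)

variable {L}

theorem mem_domain_kInv {γ c : ℝ} (hγ : γ ≤ 0) (hc : 0 < c) (f : L2per L) :
    f ∈ (fourierMul (L := L) (kInvSymbol L γ c)).domain := by
  have h1 : Memℓp (((c⁻¹ : ℝ) : ℂ) • fun n => fourierBasis.repr f n) 2 :=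
    Memℓp.const_smul (lp.memℓp (fourierBasis.repr f)) _
  refine Memℓp.mono' (E := fun _ : ℤ => ℂ) (F := fun _ : ℤ => ℂ) h1 ?_
  intro n
  change ‖kInvSymbol L γ c n * fourierBasis.repr f n‖ ≤
    ‖((c⁻¹ : ℝ) : ℂ) * fourierBasis.repr f n‖
  rw [norm_mul, norm_mul]
  refine mul_le_mul_of_nonneg_right ?_ (norm_nonneg _)
  rw [Complex.norm_real, Real.norm_of_nonneg (inv_nonneg.2 hc.le)]
  exact norm_kInvSymbol_le L hγ hc n

/-- `𝓚_γ⁻¹`, the inverse of `𝓚_γ = -γ D + c`, for `γ ≤ 0 < c`; it is defined on all of `L²`. -/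
def kInv {γ c : ℝ} (hγ : γ ≤ 0) (hc : 0 < c) : L2per L →ₗ[ℂ] L2per L :=
  (fourierMul (kInvSymbol L γ c)).toFun ∘ₗ
    LinearMap.id.codRestrict _ (mem_domain_kInv hγ hc)

/-! ### Periodic profiles -/

/-- A real continuous `L`-periodic function regarded as a complex valued one. -/
def cplx (g : C(AddCircle L, ℝ)) : C(AddCircle L, ℂ) := ⟨fun x => (g x : ℂ), by fun_prop⟩

/-- A real continuous `L`-periodic function regarded as an element of `L²`. -/
def toL2 (g : C(AddCircle L, ℝ)) : L2per L := ContinuousMap.toLp 2 haarAddCircle ℂ (cplx g)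

/-- Multiplication by `g` on `L²`. -/
def mulOp (g : C(AddCircle L, ℝ)) : L2per L →L[ℂ] L2per L :=
  (ContinuousLinearMap.mul ℂ ℂ).holderL haarAddCircle ∞ 2 2
    (ContinuousMap.toLp ∞ haarAddCircle ℂ (cplx g))

/-- The traveling wave system with zero integration constant,
`φ'' - σ φ = α ψ φ`, `γ 𝓗 ψ' - c ψ = β φ²`, for `φ ∈ H²_per` and `ψ ∈ H¹_per`. -/
def IsTravelingWave (α β γ c σ : ℝ) (φ ψ : C(AddCircle L, ℝ)) : Prop :=
  ∃ (hφ : toL2 φ ∈ (negLaplacian L).domain) (hψ : toL2 ψ ∈ (absD L).domain),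
    -(negLaplacian L ⟨toL2 φ, hφ⟩) - (σ : ℂ) • toL2 φ = (α : ℂ) • toL2 (ψ * φ) ∧
    (γ : ℂ) • absD L ⟨toL2 ψ, hψ⟩ - (c : ℂ) • toL2 ψ = (β : ℂ) • toL2 (φ * φ)

/-- The dnoidal wave of fundamental period `L` (the solution for `γ = 0`):
`φ₀(ξ) = η₁ dn(ℓ ξ; k)`, `ψ₀ = -(β/c) φ₀²`, where `0 < η₂ < η₁`, `η₁² + η₂² = 2cσ/(αβ)`,
`k² = (η₁² - η₂²)/η₁²`, `ℓ² = αβ η₁²/(2c)`, and the period `2K(k)/ℓ` of `φ₀` is `L`. -/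
def IsDnoidalWave (α β c σ : ℝ) (φ ψ : C(AddCircle L, ℝ)) : Prop :=
  ∃ η₁ η₂ k l : ℝ, 0 < η₂ ∧ η₂ < η₁ ∧ η₁ ^ 2 + η₂ ^ 2 = 2 * c * σ / (α * β) ∧
    k = √((η₁ ^ 2 - η₂ ^ 2) / η₁ ^ 2) ∧ l = η₁ * √(α * β / (2 * c)) ∧
    2 * ellipticK k / l = L ∧
    (∀ x : ℝ, φ (x : AddCircle L) = η₁ * jacobiDn k (l * x)) ∧
    (∀ x : AddCircle L, ψ x = -(β / c) * φ x ^ 2)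

/-- `γ ↦ f γ` is a curve in `H^s_per` that is continuous on `(-γ₁, 0]` and smooth on `(-γ₁, 0)`.
`H^s_per` is identified with `ℓ²(ℤ)` through `f ↦ ((1 + n²)^{s/2} f̂(n))ₙ`. -/
def IsCurveInHs (s γ₁ : ℝ) (f : ℝ → C(AddCircle L, ℝ)) : Prop :=
  ∃ F : ℝ → lp (fun _ : ℤ => ℂ) 2,
    (∀ γ ∈ Ioc (-γ₁) 0, ∀ n : ℤ,
      F γ n = (((1 + (n : ℝ) ^ 2) ^ (s / 2) : ℝ) : ℂ) * fourierCoeff (cplx (f γ)) n) ∧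
    ContinuousOn F (Ioc (-γ₁) 0) ∧ ContDiffOn ℝ ∞ F (Ioo (-γ₁) 0)

/-- A branch `γ ↦ (φ_γ, ψ_γ)`, `-γ₁ < γ ≤ 0`, in `H²_per,e × H¹_per,e` of even periodic traveling
waves that emanates from the dnoidal wave. -/
structure IsWaveBranch (α β c σ γ₁ : ℝ) (φ ψ : ℝ → C(AddCircle L, ℝ)) : Prop where
  even : ∀ γ ∈ Ioc (-γ₁) 0, ∀ x, φ γ (-x) = φ γ x ∧ ψ γ (-x) = ψ γ x
  wave : ∀ γ ∈ Ioc (-γ₁) 0, IsTravelingWave α β γ c σ (φ γ) (ψ γ)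
  curve_fst : IsCurveInHs 2 γ₁ φ
  curve_snd : IsCurveInHs 1 γ₁ ψ
  dnoidal : IsDnoidalWave α β c σ (φ 0) (ψ 0)

/-! ### The linearized operators -/

/-- `𝓛⁺ = -d²/dx² + σ + α ψ`, with domain `H²_per`. -/
def opLplus (α σ : ℝ) (ψ : C(AddCircle L, ℝ)) : L2per L →ₗ.[ℂ] L2per L :=
  ((σ : ℂ) • LinearMap.id + (α : ℂ) • (mulOp ψ : L2per L →ₗ[ℂ] L2per L)) +ᵥ negLaplacian L

/-- `𝓛 = -d²/dx² + σ + α ψ - 2αβ φ ∘ 𝓚_γ⁻¹ ∘ φ`, with domain `H²_per`. -/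
def opL (α β σ : ℝ) {γ c : ℝ} (hγ : γ ≤ 0) (hc : 0 < c) (φ ψ : C(AddCircle L, ℝ)) :
    L2per L →ₗ.[ℂ] L2per L :=
  (-((2 * α * β : ℝ) : ℂ) •
    ((mulOp φ : L2per L →ₗ[ℂ] L2per L) ∘ₗ kInv hγ hc ∘ₗ (mulOp φ : L2per L →ₗ[ℂ] L2per L)))
    +ᵥ opLplus α σ ψ

end Circle

end

noncomputable section

open Filter Topology
open scoped ComplexConjugate

/-! ### Wave numbers -/

section WaveNumber

variable {L : ℝ}

/-! At γ = 0 the multiplier 𝓚_γ⁻¹ is the constant 1/c, and 𝓛₀ is the local Lamé operator -d²/dx² +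
κ(η₁² + η₂²) - 6κφ₀² with κ = αβ/(2c). It has explicit eigenfunctions φ₀² - a, where a runs over the
two roots of 3a² - 2(η₁² + η₂²)a + η₁²η₂². The smaller root gives a positive function and a negative
eigenvalue; the larger one gives a function with two simple zeros per period and an eigenvalue μ >
0. Picone's identity on the two arcs between these zeros shows that the form of 𝓛₀ is at least μ‖f‖²
whenever f vanishes at both zeros (`IsDnProfile.exists_form_bound`), that is, in codimension two
(`FormBound`). So at most two eigenvalues, counted with multiplicity, lie below μ.

For γ < 0 norm perturbation theory is not available: the symbol of 𝓚_γ⁻¹ decays at infinity, so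
𝓚_γ⁻¹ tends to 1/c only strongly. But that symbol never exceeds 1/c, and the nonlocal term enters
𝓛_γ with a minus sign. Hence the form of 𝓛_γ dominates that of the local operator with potential σ +
αψ_γ - (2αβ/c)φ_γ² (`re_inner_linOp_ge`), which is uniformly close to the potential at γ = 0, and
the codimension-two bound survives with half the constant (`FormBound.mono`). Since φ_γ' lies in the
kernel and ⟨φ_γ, 𝓛_γφ_γ⟩ = -2αβ⟨φ_γ², 𝓚_γ⁻¹φ_γ²⟩ < 0, the two available places are taken by one
negative eigenvalue and by 0, both simple, with a gap above (`FormBound.spectrum`). Compactness of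
(1 - d²/dx²)⁻¹ makes every spectral point an eigenvalue, so that statements on forms become
statements on spectra. The negative eigenfunction is not orthogonal to φ_γ because the positive
ground state of 𝓛₀ is an approximate eigenvector of 𝓛_γ; for this strong convergence is enough
(`inner_groundState_ne_zero`).

For 𝓛_γ⁺ the positive function φ_γ is itself a null solution, so the form equals ∫ |g' - (φ_γ'/φ_γ)
g|², which is non-negative and vanishes only on multiples of φ_γ.

The branch comes from the implicit function theorem for u = φ - φ'' in L². Because φ² has one
derivative to spare, only 𝓚_γ⁻¹(1 + d/dx)⁻¹ has to depend continuously on γ in norm, which holds up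
to γ = 0 (`lipschitz_kResolventSymbol`). This multiplier is taken as the parameter, in which the
equation is smooth. The linearization is the identity minus a compact operator and is injective,
since the kernel of 𝓛₀ contains no nonzero even function (`IsDnoidalWave.eq_zero_of_even`). The
dnoidal wave itself is found by the intermediate value theorem in the modulus k, the condition σ >
2π²/L² being what is needed at the end k = 0. -/

theorem waveNumber_deriv_fourier (n : ℤ) (x : ℝ) :
    HasDerivAt (fun y : ℝ => fourier n (y : AddCircle L))
      (Complex.I * waveNumber L n * fourier n (x : AddCircle L)) x := by
  have h := hasDerivAt_fourier L n x
  have e : 2 * Real.pi * Complex.I * n / L * fourier n (x : AddCircle L) =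
      Complex.I * waveNumber L n * fourier n (x : AddCircle L) := by
    unfold waveNumber; push_cast; ring
  rwa [e] at h

theorem waveNumber_add (m n : ℤ) : waveNumber L (m + n) = waveNumber L m + waveNumber L n := by
  unfold waveNumber; push_cast; ring

theorem waveNumber_neg (n : ℤ) : waveNumber L (-n) = -waveNumber L n := by
  unfold waveNumber; push_cast; ring

end WaveNumber

/-! ### Fourier coefficients, bounded multipliers and absolutely convergent Fourier series -/

section SequenceSpaces

theorem memℓp_two_of_sq_mul_le {s : ℤ → ℂ} (C : ℝ) (h : ∀ n : ℤ, ‖s n‖ ^ 2 * (n : ℝ) ^ 2 ≤ C) :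
    Memℓp s 2 := by
  refine memℓp_gen ?_
  have h1 : Summable fun n : ℤ => C * (1 / (n : ℝ) ^ 2) :=
    (Real.summable_one_div_int_pow.2 one_lt_two).mul_left C
  -- The hypothesis carries no information at n = 0, where also 1/n² is 0 by convention, so the
  -- comparison is made off that index.
  refine Summable.of_norm_bounded_eventually h1 ?_
  filter_upwards [(Set.finite_singleton (0 : ℤ)).compl_mem_cofinite] with n hn
  have hn' : (n : ℝ) ≠ 0 := by simpa using hn
  rw [ENNReal.toReal_ofNat, Real.rpow_two, Real.norm_of_nonneg (by positivity), mul_one_div,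
    le_div_iff₀ (by positivity)]
  exact h n

variable {L : ℝ} [Fact (0 < L)]

theorem coeff_ext {f g : L2per L} (h : ∀ n, fourierBasis.repr f n = fourierBasis.repr g n) :
    f = g :=
  fourierBasis.repr.injective (lp.ext (funext h))

theorem coeff_toLp (g : C(AddCircle L, ℂ)) (n : ℤ) :
    fourierBasis.repr (ContinuousMap.toLp 2 haarAddCircle ℂ g : L2per L) n = fourierCoeff g n := by
  rw [fourierBasis_repr, fourierCoeff_toLp]

theorem toLp_injective {g h : C(AddCircle L, ℂ)}
    (e : (ContinuousMap.toLp 2 haarAddCircle ℂ g : L2per L) =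
      ContinuousMap.toLp 2 haarAddCircle ℂ h) : g = h :=
  ContinuousMap.toLp_injective (𝕜 := ℂ) haarAddCircle e

theorem fourierCoeff_injective {g h : C(AddCircle L, ℂ)}
    (e : ∀ n, fourierCoeff g n = fourierCoeff h n) : g = h :=
  toLp_injective (coeff_ext fun n => by rw [coeff_toLp, coeff_toLp, e])

/-- The bounded Fourier multiplier with bounded symbol `m`. -/
def fmul : lp (fun _ : ℤ => ℂ) ∞ →L[ℂ] L2per L →L[ℂ] L2per L :=
  ((fourierBasis (T := L)).repr.symm.toContinuousLinearEquiv.toContinuousLinearMap.postcomp _) ∘L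
    (((fourierBasis (T := L)).repr.toContinuousLinearEquiv.toContinuousLinearMap.precomp _) ∘L
    lp.holderL (p := ∞) (q := 2) 2 (fun _ : ℤ => ContinuousLinearMap.mul ℂ ℂ) (K := 1)
      (fun _ => ContinuousLinearMap.opNorm_mul_le ℂ ℂ))

theorem coeff_fmul (m : lp (fun _ : ℤ => ℂ) ∞) (f : L2per L) (n : ℤ) :
    fourierBasis.repr (fmul m f) n = m n * fourierBasis.repr f n := by
  have : fourierBasis.repr (fmul m f) = lp.holderL (p := ∞) (q := 2) 2
      (fun _ : ℤ => ContinuousLinearMap.mul ℂ ℂ) (K := 1)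
      (fun _ => ContinuousLinearMap.opNorm_mul_le ℂ ℂ) m (fourierBasis.repr f) :=
    fourierBasis.repr.apply_symm_apply _
  rw [this]; rfl

theorem norm_fmul_le (m : lp (fun _ : ℤ => ℂ) ∞) : ‖fmul (L := L) m‖ ≤ ‖m‖ := by
  refine ContinuousLinearMap.opNorm_le_bound _ (norm_nonneg _) fun f => ?_
  have : ‖fmul m f‖ = ‖lp.holderL (p := ∞) (q := 2) 2
      (fun _ : ℤ => ContinuousLinearMap.mul ℂ ℂ) (K := 1)
      (fun _ => ContinuousLinearMap.opNorm_mul_le ℂ ℂ) m (fourierBasis.repr f)‖ :=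
    fourierBasis.repr.symm.norm_map _
  rw [this]
  refine (ContinuousLinearMap.le_opNorm₂ _ _ _).trans ?_
  rw [fourierBasis.repr.norm_map]
  have := lp.norm_holderL_le (p := ∞) (q := 2) 2
      (fun _ : ℤ => ContinuousLinearMap.mul ℂ ℂ) (K := 1)
      (fun _ => ContinuousLinearMap.opNorm_mul_le ℂ ℂ)
  have h1 := mul_le_mul_of_nonneg_right (mul_le_mul_of_nonneg_right this (norm_nonneg m))
    (norm_nonneg f)
  simpa using h1

/-- A bounded symbol. -/
def bddSymbol (m : ℤ → ℂ) (C : ℝ) (h : ∀ n, ‖m n‖ ≤ C) : lp (fun _ : ℤ => ℂ) ∞ :=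
  ⟨m, memℓp_infty ⟨C, by rintro _ ⟨n, rfl⟩; exact h n⟩⟩

theorem norm_bddSymbol_le {m : ℤ → ℂ} {C : ℝ} (h : ∀ n, ‖m n‖ ≤ C) : ‖bddSymbol m C h‖ ≤ C :=
  lp.norm_le_of_forall_le ((norm_nonneg _).trans (h 0)) h

/-- By Cauchy–Schwarz the product of two square summable sequences is summable, so it is the
coefficient sequence of a uniformly convergent Fourier series. This is the source of all continuous
representatives below. -/
def synthPair : lp (fun _ : ℤ => ℂ) 2 →L[ℂ] lp (fun _ : ℤ => ℂ) 2 →L[ℂ] C(AddCircle L, ℂ) :=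
  lp.dualPairing 2 2 (fun n : ℤ => ((ContinuousLinearMap.lsmul ℂ ℂ).flip
    (fourier n : C(AddCircle L, ℂ))).postcomp ℂ ∘L ContinuousLinearMap.mul ℂ ℂ) (K := 1) (by
      intro n
      refine ContinuousLinearMap.opNorm_le_bound _ zero_le_one fun a => ?_
      refine ContinuousLinearMap.opNorm_le_bound _ (by positivity) fun b => ?_
      simp [norm_smul, fourier_norm])

/-- `f ↦ ∑ s n f̂ n e_n`, a continuous function if `s` is square summable. -/
def synth (s : lp (fun _ : ℤ => ℂ) 2) : L2per L →L[ℂ] C(AddCircle L, ℂ) :=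
  synthPair s ∘L (fourierBasis (T := L)).repr.toContinuousLinearEquiv.toContinuousLinearMap

theorem hasSum_synth (s : lp (fun _ : ℤ => ℂ) 2) (f : L2per L) :
    HasSum (fun n : ℤ => (s n * fourierBasis.repr f n) • (fourier n : C(AddCircle L, ℂ)))
      (synth s f) := by
  have h1 : synth s f = ∑' n, (s n * fourierBasis.repr f n) • (fourier n : C(AddCircle L, ℂ)) := rfl
  rw [h1]
  refine Summable.hasSum (.of_norm ?_)
  simp_rw [norm_smul, fourier_norm, mul_one, norm_mul]
  simpa using (lp.summable_mul (p := 2) (q := 2) (by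
    constructor <;> norm_num) s (fourierBasis.repr f))

theorem coeff_hasSum {ι : Type*} {F : ι → L2per L} {f : L2per L} (h : HasSum F f) (n : ℤ) :
    HasSum (fun i => fourierBasis.repr (F i) n) (fourierBasis.repr f n) := by
  simp_rw [HilbertBasis.repr_apply_apply]
  exact (innerSL ℂ (fourierBasis n : L2per L)).hasSum h

theorem fourierCoeff_hasSum {ι : Type*} {F : ι → C(AddCircle L, ℂ)} {f : C(AddCircle L, ℂ)}
    (h : HasSum F f) (n : ℤ) :
    HasSum (fun i => fourierCoeff (F i) n) (fourierCoeff f n) := by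
  simp_rw [← coeff_toLp]
  exact coeff_hasSum ((ContinuousMap.toLp 2 haarAddCircle ℂ).hasSum h) n

theorem fourierCoeff_synth (s : lp (fun _ : ℤ => ℂ) 2) (f : L2per L) (n : ℤ) :
    fourierCoeff (synth s f) n = s n * fourierBasis.repr f n := by
  have h := fourierCoeff_hasSum (hasSum_synth s f) n
  refine h.unique ?_
  have e : (fun m : ℤ => fourierCoeff ((s m * fourierBasis.repr f m) •
      (fourier m : C(AddCircle L, ℂ))) n) =
      fun m => if m = n then s n * fourierBasis.repr f n else 0 := by
    funext m
    rw [ContinuousMap.coe_smul, fourierCoeff.const_smul, fourierCoeff_fourier]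
    by_cases hm : m = n
    · subst hm; simp
    · simp [hm, Ne.symm hm]
  rw [e]
  exact hasSum_ite_eq n _

theorem hasSum_synth_apply (s : lp (fun _ : ℤ => ℂ) 2) (f : L2per L) (x : AddCircle L) :
    HasSum (fun n : ℤ => s n * fourierBasis.repr f n * fourier n x) (synth s f x) :=
  (ContinuousMap.evalCLM ℂ x).hasSum (hasSum_synth s f)

/-- Termwise differentiation is allowed because the differentiated series is dominated, uniformly in
the point, by the summable sequence ‖s' n‖‖f̂ n‖. -/
theorem hasDerivAt_synth {s s' : lp (fun _ : ℤ => ℂ) 2}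
    (h : ∀ n, s' n = Complex.I * waveNumber L n * s n) (f : L2per L) (x : ℝ) :
    HasDerivAt (fun y : ℝ => synth s f (y : AddCircle L)) (synth s' f (x : AddCircle L)) x := by
  have hs : Summable fun n : ℤ => ‖s' n‖ * ‖fourierBasis.repr f n‖ := by
    simpa using (lp.summable_mul (p := 2) (q := 2) (by
      constructor <;> norm_num) s' (fourierBasis.repr f))
  have key := hasDerivAt_tsum (𝕜 := ℝ) (u := fun n : ℤ => ‖s' n‖ * ‖fourierBasis.repr f n‖)
    (g := fun (n : ℤ) (y : ℝ) => s n * fourierBasis.repr f n * fourier n (y : AddCircle L))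
    (g' := fun (n : ℤ) (y : ℝ) => s' n * fourierBasis.repr f n * fourier n (y : AddCircle L))
    (y₀ := 0) hs (fun n y => by
      have := (waveNumber_deriv_fourier (L := L) n y).const_mul (s n * fourierBasis.repr f n)
      refine this.congr_deriv ?_
      rw [h]; ring) (fun n y => by
      rw [norm_mul, norm_mul, fourier_apply, Circle.norm_coe, mul_one]) (hasSum_synth_apply s f _).summable x
  simpa only [(hasSum_synth_apply _ f _).tsum_eq] using key

end SequenceSpaces

/-! ### Unbounded multipliers, products and the Leibniz rule -/

section Multipliers

variable {L : ℝ} [Fact (0 < L)]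

theorem coeff_fourierMul {m : ℤ → ℂ} (f : (fourierMul (L := L) m).domain) (n : ℤ) :
    fourierBasis.repr (fourierMul m f) n = m n * fourierBasis.repr (f : L2per L) n := by
  have : fourierBasis.repr (fourierMul m f) = fourierMulSeq m f :=
    fourierBasis.repr.apply_symm_apply _
  rw [this]; rfl

theorem coeff_negLaplacian (f : (negLaplacian L).domain) (n : ℤ) :
    fourierBasis.repr (negLaplacian L f) n =
      ((waveNumber L n ^ 2 : ℝ) : ℂ) * fourierBasis.repr (f : L2per L) n :=
  coeff_fourierMul f n

theorem coeff_ddx (f : (ddx L).domain) (n : ℤ) :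
    fourierBasis.repr (ddx L f) n =
      Complex.I * waveNumber L n * fourierBasis.repr (f : L2per L) n :=
  coeff_fourierMul f n

theorem coeff_absD (f : (absD L).domain) (n : ℤ) :
    fourierBasis.repr (absD L f) n =
      ((|waveNumber L n| : ℝ) : ℂ) * fourierBasis.repr (f : L2per L) n :=
  coeff_fourierMul f n

/-- The domain is maximal, so exhibiting the image in L² already proves membership. Regularity in H¹
and H² is mostly obtained this way. -/
theorem exists_fourierMul_eq {m : ℤ → ℂ} {f w : L2per L}
    (h : ∀ n, fourierBasis.repr w n = m n * fourierBasis.repr f n) :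
    ∃ hf : f ∈ (fourierMul (L := L) m).domain, fourierMul m ⟨f, hf⟩ = w := by
  have hf : f ∈ (fourierMul (L := L) m).domain := by
    change Memℓp _ 2
    have e : (fun n => m n * fourierBasis.repr f n) = fourierBasis.repr w := by
      funext n; rw [h]
    rw [e]
    exact lp.memℓp _
  exact ⟨hf, coeff_ext fun n => by rw [coeff_fourierMul, h]⟩

/-- Multiplication by a continuous function. -/
def mulC : C(AddCircle L, ℂ) →L[ℂ] L2per L →L[ℂ] L2per L :=
  (ContinuousLinearMap.mul ℂ ℂ).holderL haarAddCircle ∞ 2 2 ∘L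
    ContinuousMap.toLp ∞ haarAddCircle ℂ

theorem mulOp_eq (g : C(AddCircle L, ℝ)) : mulOp g = mulC (cplx g) := rfl

theorem coeFn_mulC (g : C(AddCircle L, ℂ)) (f : L2per L) :
    mulC g f =ᵐ[haarAddCircle] fun x => g x * f x := by
  have h1 := (ContinuousLinearMap.mul ℂ ℂ).coeFn_holder (r := 2)
    (ContinuousMap.toLp ∞ haarAddCircle ℂ g) f
  have h2 := ContinuousMap.coeFn_toLp (p := ∞) (𝕜 := ℂ) haarAddCircle g
  filter_upwards [h1, h2] with x hx1 hx2
  change ((ContinuousLinearMap.mul ℂ ℂ).holder 2 (ContinuousMap.toLp ∞ haarAddCircle ℂ g) f) x = _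
  rw [hx1, hx2]; rfl

theorem mulC_toLp (g h : C(AddCircle L, ℂ)) :
    mulC g (ContinuousMap.toLp 2 haarAddCircle ℂ h) =
      ContinuousMap.toLp 2 haarAddCircle ℂ (g * h) := by
  refine Lp.ext ?_
  filter_upwards [coeFn_mulC g (ContinuousMap.toLp 2 haarAddCircle ℂ h),
    ContinuousMap.coeFn_toLp (p := 2) (𝕜 := ℂ) haarAddCircle h,
    ContinuousMap.coeFn_toLp (p := 2) (𝕜 := ℂ) haarAddCircle (g * h)] with x h1 h2 h3
  rw [h1, h2, h3]; rfl

theorem norm_mulC_le (g : C(AddCircle L, ℂ)) : ‖mulC g‖ ≤ ‖g‖ := by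
  refine ContinuousLinearMap.opNorm_le_bound _ (norm_nonneg _) fun f => ?_
  refine Lp.norm_le_mul_norm_of_ae_le_mul ?_
  filter_upwards [coeFn_mulC g f] with x hx
  rw [hx, norm_mul]
  exact mul_le_mul_of_nonneg_right (g.norm_coe_le_norm x) (norm_nonneg _)

theorem fourierCoeff_mul_fourier (g : C(AddCircle L, ℂ)) (m n : ℤ) :
    fourierCoeff (g * fourier m : C(AddCircle L, ℂ)) n = fourierCoeff g (n - m) := by
  unfold fourierCoeff
  congr 1; funext x
  rw [show -(n - m) = -n + m by ring, fourier_add]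
  simp only [ContinuousMap.mul_apply, smul_eq_mul]; ring

/-- Fourier coefficients of a product. -/
theorem hasSum_coeff_mulC (g : C(AddCircle L, ℂ)) (f : L2per L) (n : ℤ) :
    HasSum (fun m => fourierBasis.repr f m * fourierCoeff g (n - m))
      (fourierBasis.repr (mulC g f) n) := by
  have h := coeff_hasSum ((mulC g).hasSum (fourierBasis.hasSum_repr f)) n
  convert h using 2 with m
  rw [map_smul, map_smul, lp.coeFn_smul, Pi.smul_apply, smul_eq_mul, coe_fourierBasis, fourierLp,
    mulC_toLp, coeff_toLp, fourierCoeff_mul_fourier]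

/-- The product rule in `H¹`. -/
theorem ddx_mul {f g : C(AddCircle L, ℂ)} {f' g' : L2per L}
    (hf : ∀ n, fourierBasis.repr f' n = Complex.I * waveNumber L n * fourierCoeff f n)
    (hg : ∀ n, fourierBasis.repr g' n = Complex.I * waveNumber L n * fourierCoeff g n) (n : ℤ) :
    fourierBasis.repr (mulC g f' + mulC f g') n =
      Complex.I * waveNumber L n * fourierCoeff (f * g) n := by
  have h1 := hasSum_coeff_mulC g f' n
  have h2 := hasSum_coeff_mulC f g' n
  have h3 := (hasSum_coeff_mulC g (ContinuousMap.toLp 2 haarAddCircle ℂ f) n).mul_left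
    (Complex.I * waveNumber L n)
  rw [mulC_toLp, coeff_toLp, mul_comm g f] at h3
  -- Substituting m ↦ n - m in one of the two convolutions makes their terms comparable; the Leibniz
  -- rule is then the additivity ω(n) = ω(n - m) + ω(m).
  rw [← (Equiv.subLeft n).hasSum_iff] at h2
  refine (HasSum.unique h3 ?_).symm
  rw [map_add, lp.coeFn_add, Pi.add_apply]
  have h4 := h1.add h2
  refine (congrArg (HasSum · _) (funext fun m => ?_)).mpr h4
  simp only [Function.comp_apply, Equiv.subLeft_apply, sub_sub_cancel, hf, hg, coeff_toLp]
  have : waveNumber L n = waveNumber L (n - m) + waveNumber L m := by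
    rw [← waveNumber_add, sub_add_cancel]
  rw [this]; push_cast; ring

end Multipliers

/-! ### Compact multipliers -/

section Compactness

variable {L : ℝ} [Fact (0 < L)]

/-- Cutting the symbol off to finitely many frequencies gives finite rank operators, and the error
in operator norm is at most the supremum of the discarded values. -/
theorem isCompactOperator_fmul (m : lp (fun _ : ℤ => ℂ) ∞)
    (hm : Tendsto (fun n => m n) cofinite (𝓝 0)) : IsCompactOperator (fmul (L := L) m) := by
  classical
  let R : Finset ℤ → L2per L →L[ℂ] L2per L := fun s => ∑ n ∈ s,
    ((ContinuousLinearMap.toSpanSingleton ℂ (m n • (fourierBasis n : L2per L))) ∘L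
      innerSL ℂ (fourierBasis n : L2per L))
  have hR : ∀ s, IsCompactOperator (R s) := by
    intro s
    have h1 : R s ∈ compactOperator (RingHom.id ℂ) (L2per L) (L2per L) := by
      refine Submodule.sum_mem _ fun n _ => ?_
      change IsCompactOperator _
      rw [ContinuousLinearMap.coe_comp]
      exact (isCompactOperator_of_locallyCompactSpace_rng
        (ContinuousLinearMap.toSpanSingleton ℂ (m n • (fourierBasis n : L2per L)))).comp_clm _
    exact h1
  have hc : ∀ (s : Finset ℤ) (f : L2per L) (k : ℤ), fourierBasis.repr (R s f) k =
      if k ∈ s then m k * fourierBasis.repr f k else 0 := by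
    intro s f k
    have : R s f = ∑ n ∈ s, (fourierBasis.repr f n * m n) • (fourierBasis n : L2per L) := by
      simp [R, HilbertBasis.repr_apply_apply, smul_smul]
    rw [this, map_sum, lp.coeFn_sum, Finset.sum_apply]
    simp only [map_smul, HilbertBasis.repr_self, lp.coeFn_smul, Pi.smul_apply, smul_eq_mul,
      lp.single_apply]
    simp [Pi.single_apply, mul_comm]
  refine isCompactOperator_of_tendsto (l := atTop) (F := R) ?_ (Eventually.of_forall hR)
  rw [Metric.tendsto_atTop]
  intro ε hε
  have hfin : {n | ¬ ‖m n‖ < ε / 2}.Finite := by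
    have := (tendsto_zero_iff_norm_tendsto_zero.1 hm).eventually (gt_mem_nhds (half_pos hε))
    exact this
  refine ⟨hfin.toFinset, fun s hs => ?_⟩
  let m' : lp (fun _ : ℤ => ℂ) ∞ := bddSymbol (fun n => if n ∈ s then 0 else m n) (ε / 2) (by
    intro n
    by_cases hn : n ∈ s
    · simpa [hn] using (half_pos hε).le
    · have : n ∉ hfin.toFinset := fun h => hn (hs h)
      have : ‖m n‖ < ε / 2 := by simpa using this
      simpa [hn] using this.le)
  have e : fmul m - R s = fmul (L := L) m' := by
    ext1 f
    refine coeff_ext fun k => ?_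
    have e2 : m' k = if k ∈ s then 0 else m k := rfl
    rw [sub_apply, map_sub, lp.coeFn_sub, Pi.sub_apply, coeff_fmul, coeff_fmul,
      hc, e2]
    by_cases hk : k ∈ s <;> simp [hk]
  rw [dist_comm, dist_eq_norm, e]
  refine lt_of_le_of_lt ((norm_fmul_le m').trans ?_) (half_lt_self hε)
  exact norm_bddSymbol_le _

end Compactness

/-! ### The resolvent (1 - d²/dx²)⁻¹ and its regularity -/

section Green

variable (L : ℝ) [hL : Fact (0 < L)]

theorem norm_inv_one_add_sq_le (x : ℝ) : ‖(((1 + x ^ 2)⁻¹ : ℝ) : ℂ)‖ ≤ 1 := by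
  rw [Complex.norm_real, Real.norm_of_nonneg (by positivity)]
  exact inv_le_one_of_one_le₀ (by nlinarith [sq_nonneg x])

theorem sq_eq_waveNumber (n : ℤ) :
    (n : ℝ) ^ 2 = (L / (2 * Real.pi)) ^ 2 * waveNumber L n ^ 2 := by
  have := hL.out.ne'
  have := Real.pi_ne_zero
  unfold waveNumber; field_simp

/-- The symbol `(1 + ω²)⁻¹` as a square summable sequence. -/
def greenSeq : lp (fun _ : ℤ => ℂ) 2 :=
  ⟨fun n => (((1 + waveNumber L n ^ 2)⁻¹ : ℝ) : ℂ),
    memℓp_two_of_sq_mul_le ((L / (2 * Real.pi)) ^ 2) fun n => by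
      rw [sq_eq_waveNumber L n, Complex.norm_real, Real.norm_of_nonneg (by positivity),
        mul_left_comm]
      refine mul_le_of_le_one_right (by positivity) ?_
      rw [inv_pow, inv_mul_le_iff₀ (by positivity)]
      nlinarith [sq_nonneg (waveNumber L n), sq_nonneg (waveNumber L n ^ 2)]⟩

/-- The symbol `iω(1 + ω²)⁻¹` as a square summable sequence. -/
def greenSeq' : lp (fun _ : ℤ => ℂ) 2 :=
  ⟨fun n => Complex.I * waveNumber L n * (((1 + waveNumber L n ^ 2)⁻¹ : ℝ) : ℂ),
    memℓp_two_of_sq_mul_le ((L / (2 * Real.pi)) ^ 2) fun n => by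
      rw [sq_eq_waveNumber L n, norm_mul, norm_mul, Complex.norm_I, Complex.norm_real,
        Complex.norm_real, one_mul, mul_left_comm, mul_pow, Real.norm_eq_abs, sq_abs,
        Real.norm_of_nonneg (by positivity : 0 ≤ (1 + waveNumber L n ^ 2)⁻¹)]
      refine mul_le_of_le_one_right (by positivity) ?_
      rw [inv_pow, mul_right_comm, ← div_eq_mul_inv, div_le_iff₀ (by positivity)]
      nlinarith [sq_nonneg (waveNumber L n), sq_nonneg (waveNumber L n ^ 2)]⟩

def greenSymbol : lp (fun _ : ℤ => ℂ) ∞ :=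
  bddSymbol (fun n => (((1 + waveNumber L n ^ 2)⁻¹ : ℝ) : ℂ)) 1 fun _ => norm_inv_one_add_sq_le _

/-- `(1 - d²/dx²)⁻¹` on `L²`. -/
def green : L2per L →L[ℂ] L2per L := fmul (greenSymbol L)

variable {L}

theorem coeff_green (f : L2per L) (n : ℤ) : fourierBasis.repr (green L f) n =
    (((1 + waveNumber L n ^ 2)⁻¹ : ℝ) : ℂ) * fourierBasis.repr f n := coeff_fmul _ _ _

theorem isCompactOperator_green : IsCompactOperator (green L) := by
  refine isCompactOperator_fmul _ ?_
  have h : Summable fun n : ℤ => ‖greenSeq L n‖ ^ (2 : ℝ≥0∞).toReal :=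
    (lp.memℓp (greenSeq L)).summable (by norm_num)
  have h2 := h.tendsto_cofinite_zero
  have h3 : Tendsto (fun n : ℤ => ‖greenSeq L n‖ ^ 2) cofinite (𝓝 0) := by simpa using h2
  have h4 := h3.sqrt
  simp only [Real.sqrt_sq (norm_nonneg _), Real.sqrt_zero] at h4
  exact tendsto_zero_iff_norm_tendsto_zero.2 h4

theorem one_add_sq_ne_zero (x : ℝ) : (1 + (x : ℂ) ^ 2) ≠ 0 := by
  have : ((1 + x ^ 2 : ℝ) : ℂ) ≠ 0 := Complex.ofReal_ne_zero.2 (by positivity)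
  simpa using this

theorem green_mem (f : L2per L) : ∃ h : green L f ∈ (negLaplacian L).domain,
    negLaplacian L ⟨green L f, h⟩ = f - green L f := by
  refine exists_fourierMul_eq fun n => ?_
  rw [map_sub, lp.coeFn_sub, Pi.sub_apply, coeff_green]
  have := one_add_sq_ne_zero (waveNumber L n)
  push_cast; field_simp; ring

theorem green_apply (f : (negLaplacian L).domain) : green L (negLaplacian L f + f) = f := by
  refine coeff_ext fun n => ?_
  rw [coeff_green, map_add, lp.coeFn_add, Pi.add_apply]
  rw [coeff_negLaplacian]
  have := one_add_sq_ne_zero (waveNumber L n)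
  push_cast; field_simp; ring

theorem green_injective {f : L2per L} (h : green L f = 0) : f = 0 := by
  refine coeff_ext fun n => ?_
  have h1 := coeff_green f n
  have := one_add_sq_ne_zero (waveNumber L n)
  rw [h] at h1
  simp only [map_zero, lp.coeFn_zero, Pi.zero_apply] at h1 ⊢
  have := mul_eq_zero.1 h1.symm
  refine this.resolve_left ?_
  push_cast
  exact inv_ne_zero ‹_›

variable (L) in
/-- The continuous representative of `green f`. -/
def greenC : L2per L →L[ℂ] C(AddCircle L, ℂ) := synth (greenSeq L)

variable (L) in
/-- The continuous representative of the derivative of `green f`. -/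
def greenC' : L2per L →L[ℂ] C(AddCircle L, ℂ) := synth (greenSeq' L)

theorem fourierCoeff_greenC (f : L2per L) (n : ℤ) : fourierCoeff (greenC L f) n =
    (((1 + waveNumber L n ^ 2)⁻¹ : ℝ) : ℂ) * fourierBasis.repr f n := fourierCoeff_synth _ _ _

theorem fourierCoeff_greenC' (f : L2per L) (n : ℤ) : fourierCoeff (greenC' L f) n =
    Complex.I * waveNumber L n * fourierCoeff (greenC L f) n := by
  rw [fourierCoeff_greenC, ← mul_assoc]; exact fourierCoeff_synth _ _ _

theorem toLp_greenC (f : L2per L) : ContinuousMap.toLp 2 haarAddCircle ℂ (greenC L f) = green L f :=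
  coeff_ext fun n => by rw [coeff_toLp, fourierCoeff_greenC, coeff_green]

theorem hasDerivAt_greenC (f : L2per L) (x : ℝ) :
    HasDerivAt (fun y : ℝ => greenC L f (y : AddCircle L)) (greenC' L f (x : AddCircle L)) x :=
  hasDerivAt_synth (fun _ => rfl) f x

end Green

/-! ### Self-adjointness and spectrum of -d²/dx² + B -/

section BoundedPerturbation

variable {L : ℝ} [hL : Fact (0 < L)]

theorem inner_eq_tsum_coeff (f g : L2per L) : inner ℂ f g =
    ∑' n, fourierBasis.repr g n * conj (fourierBasis.repr f n) := by
  rw [← fourierBasis.repr.inner_map_map, lp.inner_eq_tsum]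
  rfl

theorem inner_symm_of_coeff {m : ℤ → ℝ} {f g f' g' : L2per L}
    (hf : ∀ n, fourierBasis.repr f' n = (m n : ℂ) * fourierBasis.repr f n)
    (hg : ∀ n, fourierBasis.repr g' n = (m n : ℂ) * fourierBasis.repr g n) :
    inner ℂ f' g = inner ℂ f g' := by
  rw [inner_eq_tsum_coeff, inner_eq_tsum_coeff]
  refine tsum_congr fun n => ?_
  rw [hf, hg, map_mul, Complex.conj_ofReal]; ring

theorem inner_negLaplacian (x y : (negLaplacian L).domain) :
    inner ℂ (negLaplacian L x) (y : L2per L) = inner ℂ (x : L2per L) (negLaplacian L y) :=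
  inner_symm_of_coeff (coeff_negLaplacian x) (coeff_negLaplacian y)

theorem fourierBasis_mem_domain (m : ℤ → ℂ) (n : ℤ) :
    ∃ h : (fourierBasis n : L2per L) ∈ (fourierMul m).domain,
      fourierMul m ⟨fourierBasis n, h⟩ = m n • (fourierBasis n : L2per L) := by
  refine exists_fourierMul_eq fun k => ?_
  rw [map_smul, lp.coeFn_smul, Pi.smul_apply, smul_eq_mul, HilbertBasis.repr_self]
  by_cases h : k = n
  · subst h; rfl
  · rw [lp.single_apply_ne _ _ _ h]; simp

theorem dense_negLaplacian_domain : Dense ((negLaplacian L).domain : Set (L2per L)) := by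
  have h := (fourierBasis (T := L)).dense_span
  refine (Submodule.dense_iff_topologicalClosure_eq_top).2 (top_unique ?_)
  rw [← h]
  refine Submodule.topologicalClosure_mono (Submodule.span_le.2 ?_)
  rintro _ ⟨n, rfl⟩
  exact (fourierBasis_mem_domain _ n).1

/-- The operator `-d²/dx² + B` for a bounded operator `B`. -/
def perturbed (B : L2per L →L[ℂ] L2per L) : L2per L →ₗ.[ℂ] L2per L :=
  (B : L2per L →ₗ[ℂ] L2per L) +ᵥ negLaplacian L

variable {B : L2per L →L[ℂ] L2per L}

theorem mem_perturbed_domain {f : L2per L} (h : f ∈ (negLaplacian L).domain) :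
    f ∈ (perturbed B).domain := h

theorem mem_negLaplacian_domain {f : L2per L} (h : f ∈ (perturbed B).domain) :
    f ∈ (negLaplacian L).domain := h

theorem perturbed_apply (x : (perturbed B).domain) :
    perturbed B x = B x + negLaplacian L ⟨x, mem_negLaplacian_domain x.2⟩ := rfl

theorem inner_perturbed (hB : ∀ x y, inner ℂ (B x) y = inner ℂ x (B y))
    (x y : (perturbed B).domain) :
    inner ℂ (perturbed B x) (y : L2per L) = inner ℂ (x : L2per L) (perturbed B y) := by
  obtain ⟨x, hx⟩ := x
  obtain ⟨y, hy⟩ := y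
  have h := inner_negLaplacian ⟨x, mem_negLaplacian_domain hx⟩ ⟨y, mem_negLaplacian_domain hy⟩
  rw [perturbed_apply, perturbed_apply, inner_add_left, inner_add_right, hB]
  exact congrArg (inner ℂ x (B y) + ·) h

/-- Testing the adjoint T* of T = -d²/dx² + B against e_n shows that the coefficients of T*y - By
are ω(n)² ŷ(n). Hence every y in the adjoint domain lies in H², and symmetry gives the other
inclusion. -/
theorem isSelfAdjoint_perturbed (hB : ∀ x y, inner ℂ (B x) y = inner ℂ x (B y)) :
    IsSelfAdjoint (perturbed B) := by
  have hd : Dense ((perturbed B).domain : Set (L2per L)) := dense_negLaplacian_domain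
  rw [LinearPMap.isSelfAdjoint_def]
  refine le_antisymm ?_ ?_
  · have key : ∀ y : (perturbed B).adjoint.domain,
        ∃ h : (y : L2per L) ∈ (perturbed B).domain,
          perturbed B ⟨y, h⟩ = (perturbed B).adjoint y := by
      intro y
      have h1 := LinearPMap.adjoint_isFormalAdjoint hd y
      have h2 : ∀ n, fourierBasis.repr ((perturbed B).adjoint y - B y) n =
          ((waveNumber L n ^ 2 : ℝ) : ℂ) * fourierBasis.repr (y : L2per L) n := by
        intro n
        obtain ⟨hm, he⟩ := fourierBasis_mem_domain (L := L)
          (fun n => ((waveNumber L n ^ 2 : ℝ) : ℂ)) n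
        have h3 := h1 ⟨fourierBasis n, hm⟩
        have h4 : perturbed B ⟨fourierBasis n, hm⟩ = B (fourierBasis n) +
          ((waveNumber L n ^ 2 : ℝ) : ℂ) • (fourierBasis n : L2per L) := by
            rw [← he]; rfl
        rw [h4, inner_add_right, ← hB, inner_smul_right] at h3
        rw [HilbertBasis.repr_apply_apply, HilbertBasis.repr_apply_apply, ← inner_conj_symm,
          inner_sub_left]
        have h5 : inner ℂ ((perturbed B).adjoint y) (fourierBasis n : L2per L) -
            inner ℂ (B y) (fourierBasis n : L2per L) = ((waveNumber L n ^ 2 : ℝ) : ℂ) *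
              inner ℂ (y : L2per L) (fourierBasis n : L2per L) := by
          rw [sub_eq_iff_eq_add']; exact h3
        rw [h5, map_mul, Complex.conj_ofReal, inner_conj_symm]
      obtain ⟨h, e⟩ := exists_fourierMul_eq h2
      refine ⟨mem_perturbed_domain h, ?_⟩
      rw [perturbed_apply]
      change B y + negLaplacian L ⟨y, h⟩ = _
      rw [show negLaplacian L ⟨y, h⟩ = _ from e]; abel
    refine ⟨fun y hy => (key ⟨y, hy⟩).1, ?_⟩
    rintro y ⟨z, hz⟩ hyz
    obtain ⟨h, e⟩ := key y
    rw [← e]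
    congr 1
    exact Subtype.ext hyz
  · refine LinearPMap.IsFormalAdjoint.le_adjoint hd ?_
    intro x y
    exact inner_perturbed hB x y

/-- With G = (1 - d²/dx²)⁻¹ one has (T - z)G = 1 + C, where C = (B - (1 + z))G is compact. By the
Fredholm alternative either -1 is an eigenvalue of C, and G maps its eigenvector to one of T, or 1 +
C is invertible and G(1 + C)⁻¹ is the resolvent. -/
theorem exists_eigenvector_of_mem_opSpectrum {z : ℂ} (hz : z ∈ opSpectrum (perturbed B)) :
    opEigenspace (perturbed B) z ≠ ⊥ := by
  intro hbot
  apply hz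
  let C : L2per L →L[ℂ] L2per L := (B - (1 + z) • ContinuousLinearMap.id ℂ (L2per L)) ∘L green L
  have hCa : ∀ v, C v = B (green L v) - (1 + z) • green L v := fun v => rfl
  have hC : IsCompactOperator C :=
    isCompactOperator_green.clm_comp (B - (1 + z) • ContinuousLinearMap.id ℂ (L2per L))
  have h1 := hC.hasEigenvalue_or_mem_resolventSet (μ := -1) (by norm_num)
  have hT : ∀ v, ∃ h : green L v ∈ (perturbed B).domain,
      perturbed B ⟨green L v, h⟩ - z • green L v = v + C v := by
    intro v
    obtain ⟨h, e⟩ := green_mem v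
    refine ⟨mem_perturbed_domain h, ?_⟩
    rw [perturbed_apply, e, hCa, add_smul, one_smul]
    abel
  rcases h1 with h1 | h1
  · exfalso
    obtain ⟨v, hv⟩ := h1.exists_hasEigenvector
    have hv1 : C v = (-1 : ℂ) • v := hv.apply_eq_smul
    obtain ⟨h, e⟩ := hT v
    rw [hv1, neg_one_smul, add_neg_cancel, sub_eq_zero] at e
    have hm : green L v ∈ opEigenspace (perturbed B) z := ⟨h, e⟩
    rw [hbot, Submodule.mem_bot] at hm
    exact hv.2 (green_injective hm)
  · rw [spectrum.mem_resolventSet_iff] at h1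
    obtain ⟨u, hu⟩ := h1
    let S : L2per L →L[ℂ] L2per L := ↑u⁻¹
    have hS1 : ∀ y, -S y - C (S y) = y := by
      intro y
      have := congrArg (fun T : L2per L →L[ℂ] L2per L => T y) u.mul_inv
      simpa [hu, S] using this
    have hS2 : ∀ y, S (-y - C y) = y := by
      intro y
      have := congrArg (fun T : L2per L →L[ℂ] L2per L => T y) u.inv_mul
      simpa [hu, S] using this
    refine ⟨-(green L ∘L S), fun y => ?_, fun x => ?_⟩
    · obtain ⟨h, e⟩ := hT (-S y)
      have e1 : (-(green L ∘L S)) y = green L (-S y) := by simp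
      have e2 : -S y + C (-S y) = y := by rw [map_neg, ← sub_eq_add_neg]; exact hS1 y
      rw [e2] at e
      have e3 : ∀ w, w = green L (-S y) → ∃ h : w ∈ (perturbed B).domain,
          perturbed B ⟨w, h⟩ - z • w = y := by
        rintro w rfl
        exact ⟨h, e⟩
      exact e3 _ e1
    · let x' : (negLaplacian L).domain := ⟨x, mem_negLaplacian_domain x.2⟩
      have e1 : green L (negLaplacian L x' + x') = x := green_apply x'
      obtain ⟨h, e⟩ := hT (negLaplacian L x' + x')
      have e2 : perturbed B x - z • (x : L2per L) = (negLaplacian L x' + x') +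
        C (negLaplacian L x' + x') := by
        rw [← e]; congr 2
        · exact Subtype.ext e1.symm
        · exact e1.symm
      rw [e2]
      have h3 := hS2 (-(negLaplacian L x' + x'))
      rw [neg_neg, map_neg, sub_neg_eq_add] at h3
      change -(green L (S _)) = _
      rw [h3, map_neg, neg_neg, e1]

theorem eigenvalue_eq_conj (hB : ∀ x y, inner ℂ (B x) y = inner ℂ x (B y)) {z : ℂ} {f : L2per L}
    (hf : f ∈ opEigenspace (perturbed B) z) (h0 : f ≠ 0) : conj z = z := by
  obtain ⟨h, e⟩ := hf
  have h1 := inner_perturbed hB ⟨f, h⟩ ⟨f, h⟩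
  simp only [e, inner_smul_left, inner_smul_right] at h1
  exact mul_right_cancel₀ (inner_self_ne_zero.2 h0) h1

theorem exists_real_of_eigenvalue (hB : ∀ x y, inner ℂ (B x) y = inner ℂ x (B y)) {z : ℂ}
    {f : L2per L} (hf : f ∈ opEigenspace (perturbed B) z) (h0 : f ≠ 0) : ∃ r : ℝ, z = r :=
  Complex.conj_eq_iff_real.1 (eigenvalue_eq_conj hB hf h0)

theorem inner_eigenvectors_eq_zero (hB : ∀ x y, inner ℂ (B x) y = inner ℂ x (B y)) {z w : ℂ}
    {f g : L2per L} (hf : f ∈ opEigenspace (perturbed B) z) (hg : g ∈ opEigenspace (perturbed B) w)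
    (hzw : z ≠ w) : inner ℂ f g = 0 := by
  by_cases h0 : f = 0
  · rw [h0, inner_zero_left]
  have hz := eigenvalue_eq_conj hB hf h0
  obtain ⟨h, e⟩ := hf
  obtain ⟨h', e'⟩ := hg
  have h1 := inner_perturbed hB ⟨f, h⟩ ⟨g, h'⟩
  simp only [e, e', inner_smul_left, inner_smul_right, hz] at h1
  by_contra hne
  exact hzw (mul_right_cancel₀ hne h1)

/-- Writes an eigenvector as the image under a compact operator of a vector whose norm is controlled
by |z|, ‖B‖ and ‖f‖. -/
theorem green_of_eigenvector {z : ℂ} {f : L2per L} (hf : f ∈ opEigenspace (perturbed B) z) :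
    green L ((1 + z) • f - B f) = f := by
  obtain ⟨h, e⟩ := hf
  have h1 := green_apply ⟨f, mem_negLaplacian_domain h⟩
  rw [perturbed_apply] at e
  have e2 : (1 + z) • f - B f = negLaplacian L ⟨f, mem_negLaplacian_domain h⟩ + f := by
    rw [add_smul, ← e, one_smul]; simp only; abel
  rw [e2]; exact h1

/-- The spectrum of `-d²/dx² + B` is discrete. -/
theorem finite_opSpectrum_inter_closedBall (hB : ∀ x y, inner ℂ (B x) y = inner ℂ x (B y))
    (R : ℝ) : (opSpectrum (perturbed B) ∩ Metric.closedBall 0 R).Finite := by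
  by_contra hinf
  have hinf : (opSpectrum (perturbed B) ∩ Metric.closedBall 0 R).Infinite := hinf
  have hex : ∀ z : ℂ, z ∈ opSpectrum (perturbed B) →
      ∃ f, f ∈ opEigenspace (perturbed B) z ∧ ‖f‖ = 1 := by
    intro z hz
    obtain ⟨f, hf, h0⟩ := (Submodule.ne_bot_iff _).1 (exists_eigenvector_of_mem_opSpectrum hz)
    refine ⟨((‖f‖⁻¹ : ℝ) : ℂ) • f, Submodule.smul_mem _ _ hf, ?_⟩
    rw [norm_smul, Complex.norm_real, norm_inv, norm_norm, inv_mul_cancel₀ (norm_ne_zero_iff.2 h0)]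
  choose! F hF hF1 using hex
  let z : ℕ → ℂ := fun n => hinf.natEmbedding _ n
  have hz : ∀ n, z n ∈ opSpectrum (perturbed B) ∩ Metric.closedBall 0 R :=
    fun n => (hinf.natEmbedding _ n).2
  have hzinj : Function.Injective z := fun a b h =>
    (hinf.natEmbedding _).injective (Subtype.ext h)
  let v : ℕ → L2per L := fun n => (1 + z n) • F (z n) - B (F (z n))
  have hv : ∀ n, ‖v n‖ ≤ 1 + R + ‖B‖ := by
    intro n
    have h1 := hF1 _ (hz n).1
    have h2 : ‖z n‖ ≤ R := by simpa using (hz n).2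
    calc ‖v n‖ ≤ ‖(1 + z n) • F (z n)‖ + ‖B (F (z n))‖ := norm_sub_le _ _
      _ ≤ (1 + R) * 1 + ‖B‖ * 1 := by
          refine add_le_add ?_ ?_
          · rw [norm_smul, h1]
            refine mul_le_mul_of_nonneg_right ?_ zero_le_one
            exact (norm_add_le _ _).trans (by simpa using h2)
          · rw [← h1]; exact B.le_opNorm _
      _ = _ := by ring
  -- Normalized eigenvectors with eigenvalues in a bounded set all lie in one compact set.
  -- Eigenvectors for distinct eigenvalues are orthonormal, hence √2 apart, so no infinite sequence
  -- of them can have a convergent subsequence.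
  obtain ⟨K, hK, hKs⟩ := (isCompactOperator_green (L := L)).image_closedBall_subset_compact
    (f := (green L : L2per L →ₗ[ℂ] L2per L)) (1 + R + ‖B‖)
  have hin : ∀ n, F (z n) ∈ K := by
    intro n
    refine hKs ⟨v n, by simpa using hv n, ?_⟩
    exact green_of_eigenvector (hF _ (hz n).1)
  obtain ⟨y, _, ψ, hψ, hlim⟩ := hK.tendsto_subseq hin
  have hc := Metric.cauchySeq_iff'.1 hlim.cauchySeq 1 one_pos
  obtain ⟨N, hN⟩ := hc
  have h1 := hN (N + 1) (Nat.le_succ N)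
  have horth : inner ℂ (F (z (ψ (N + 1)))) (F (z (ψ N))) = 0 :=
    inner_eigenvectors_eq_zero hB (hF _ (hz _).1) (hF _ (hz _).1) (fun h => by
      have := hψ.injective (hzinj h)
      omega)
  have h2 : ‖F (z (ψ (N + 1))) - F (z (ψ N))‖ ^ 2 = 2 := by
    rw [@norm_sub_sq ℂ, horth, hF1 _ (hz _).1, hF1 _ (hz _).1]; norm_num
  rw [dist_eq_norm] at h1
  simp only [Function.comp_apply] at h1
  have := norm_nonneg (F (z (ψ (N + 1))) - F (z (ψ N)))
  nlinarith

/-- If the form of `-d²/dx² + B` is bounded below by `m` and `m` is not in the spectrum, then the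
bound can be improved. -/
theorem exists_form_gap (hB : ∀ x y, inner ℂ (B x) y = inner ℂ x (B y)) {m : ℝ}
    (hm : ∀ x : (perturbed B).domain,
      m * ‖(x : L2per L)‖ ^ 2 ≤ (inner ℂ (x : L2per L) (perturbed B x)).re)
    (hs : (m : ℂ) ∉ opSpectrum (perturbed B)) :
    ∃ δ > 0, ∀ x : (perturbed B).domain,
      (m + δ) * ‖(x : L2per L)‖ ^ 2 ≤ (inner ℂ (x : L2per L) (perturbed B x)).re := by
  have hs' := not_not.1 hs
  obtain ⟨R, hR1, -⟩ := hs'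
  -- The added 1 only ensures r > 0.
  set r := ‖R‖ + 1 with hr
  have hrpos : 0 < r := by positivity
  refine ⟨r⁻¹, by positivity, fun x => ?_⟩
  obtain ⟨hg, eg⟩ := hR1 (x : L2per L)
  let g : (perturbed B).domain := ⟨R x, hg⟩
  have eg' : perturbed B g = (x : L2per L) + (m : ℂ) • (g : L2per L) := by
    rw [← eg]; exact (sub_add_cancel _ _).symm
  have hgx : (inner ℂ (x : L2per L) (perturbed B g)).re = ‖(x : L2per L)‖ ^ 2 +
      m * (inner ℂ (x : L2per L) (g : L2per L)).re := by
    rw [eg', inner_add_right, inner_smul_right, Complex.add_re, Complex.re_ofReal_mul]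
    congr 1
    exact inner_self_eq_norm_sq (𝕜 := ℂ) _
  have hxg : (inner ℂ (g : L2per L) (perturbed B x)).re = ‖(x : L2per L)‖ ^ 2 +
      m * (inner ℂ (x : L2per L) (g : L2per L)).re := by
    rw [← inner_perturbed hB, ← hgx, ← inner_conj_symm, Complex.conj_re]
  have hgg : (inner ℂ (g : L2per L) (perturbed B g)).re =
      (inner ℂ (x : L2per L) (g : L2per L)).re + m * ‖(g : L2per L)‖ ^ 2 := by
    rw [eg', inner_add_right, inner_smul_right, Complex.add_re, Complex.re_ofReal_mul]
    congr 1
    · rw [← inner_conj_symm, Complex.conj_re]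
    · congr 1
      exact inner_self_eq_norm_sq (𝕜 := ℂ) _
  have hle : (inner ℂ (x : L2per L) (g : L2per L)).re ≤ r * ‖(x : L2per L)‖ ^ 2 := by
    refine (Complex.re_le_norm _).trans ((norm_inner_le_norm _ _).trans ?_)
    have : ‖(g : L2per L)‖ ≤ r * ‖(x : L2per L)‖ :=
      (R.le_opNorm _).trans (mul_le_mul_of_nonneg_right (by rw [hr]; linarith) (norm_nonneg _))
    nlinarith [norm_nonneg (x : L2per L)]
  -- With Q the form of T - m and g = (T - m)⁻¹x, the inequality 0 ≤ Q(x - tg) = Q(x) - 2t‖x‖² + t²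
  -- Re⟨x, g⟩ and the bound Re⟨x, g⟩ ≤ r‖x‖² give Q(x) ≥ (2t - t²r)‖x‖². The choice t = 1/r yields
  -- the gap 1/r.
  set t := r⁻¹ with ht
  have h1 := hm (x - (t : ℂ) • g)
  have e1 : ((x - (t : ℂ) • g : (perturbed B).domain) : L2per L) =
      (x : L2per L) - (t : ℂ) • (g : L2per L) := rfl
  have e2 : perturbed B (x - (t : ℂ) • g : (perturbed B).domain) =
      perturbed B x - (t : ℂ) • perturbed B g := by
    have := (perturbed B).map_sub (x : (perturbed B).domain) ((t : ℂ) • g)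
    rw [this, (perturbed B).map_smul]
  have h2 : (inner ℂ ((x : L2per L) - (t : ℂ) • (g : L2per L))
      (perturbed B x - (t : ℂ) • perturbed B g)).re =
      (inner ℂ (x : L2per L) (perturbed B x)).re -
        t * (inner ℂ (x : L2per L) (perturbed B g)).re -
        t * (inner ℂ (g : L2per L) (perturbed B x)).re +
        t ^ 2 * (inner ℂ (g : L2per L) (perturbed B g)).re := by
    simp only [inner_sub_left, inner_sub_right, inner_smul_left, inner_smul_right,
      Complex.sub_re, Complex.conj_ofReal, Complex.re_ofReal_mul]
    ring
  have h3 : ‖(x : L2per L) - (t : ℂ) • (g : L2per L)‖ ^ 2 = ‖(x : L2per L)‖ ^ 2 -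
      2 * t * (inner ℂ (x : L2per L) (g : L2per L)).re + t ^ 2 * ‖(g : L2per L)‖ ^ 2 := by
    rw [@norm_sub_sq ℂ, inner_smul_right, norm_smul, Complex.norm_real, mul_pow,
      Real.norm_eq_abs, sq_abs]
    change _ - 2 * (((t : ℂ) * inner ℂ (x : L2per L) (g : L2per L))).re + _ = _
    rw [Complex.re_ofReal_mul]; ring
  rw [e1, e2, h2, h3, hgx, hxg, hgg] at h1
  have htr : t * r = 1 := inv_mul_cancel₀ hrpos.ne'
  have ht0 : 0 < t := by positivity
  have h4 : t ^ 2 * (inner ℂ (x : L2per L) (g : L2per L)).re ≤ t * ‖(x : L2per L)‖ ^ 2 := by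
    have := mul_le_mul_of_nonneg_left hle (sq_nonneg t)
    have e : t ^ 2 * (r * ‖(x : L2per L)‖ ^ 2) = t * ‖(x : L2per L)‖ ^ 2 := by
      rw [sq, mul_assoc, ← mul_assoc t r, htr, one_mul]
    rwa [e] at this
  nlinarith

theorem form_lower_bound (x : (perturbed B).domain) :
    -‖B‖ * ‖(x : L2per L)‖ ^ 2 ≤ (inner ℂ (x : L2per L) (perturbed B x)).re := by
  rw [perturbed_apply, inner_add_right, Complex.add_re]
  have h1 : 0 ≤ (inner ℂ (x : L2per L) (negLaplacian L ⟨x, mem_negLaplacian_domain x.2⟩)).re := by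
    rw [inner_eq_tsum_coeff, Complex.re_tsum]
    · refine tsum_nonneg fun n => ?_
      rw [coeff_negLaplacian, mul_assoc, Complex.re_ofReal_mul, Complex.mul_conj, Complex.ofReal_re]
      exact mul_nonneg (sq_nonneg _) (Complex.normSq_nonneg _)
    · have := lp.summable_inner (𝕜 := ℂ) (G := fun _ : ℤ => ℂ) (fourierBasis.repr (x : L2per L))
        (fourierBasis.repr (negLaplacian L ⟨x, mem_negLaplacian_domain x.2⟩))
      exact this
  have h2 : ‖inner ℂ (x : L2per L) (B x)‖ ≤ ‖B‖ * ‖(x : L2per L)‖ ^ 2 := by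
    refine (norm_inner_le_norm _ _).trans ?_
    have := B.le_opNorm (x : L2per L)
    nlinarith [norm_nonneg (x : L2per L)]
  have h3 := (abs_le.1 ((Complex.abs_re_le_norm _).trans h2)).1
  linarith

/-- A negative direction of the form yields a negative eigenvalue. -/
theorem exists_negative_eigenvalue (hB : ∀ x y, inner ℂ (B x) y = inner ℂ x (B y))
    (x₀ : (perturbed B).domain) (h : (inner ℂ (x₀ : L2per L) (perturbed B x₀)).re < 0) :
    ∃ lam : ℝ, lam < 0 ∧ opEigenspace (perturbed B) lam ≠ ⊥ := by
  -- The supremum of the lower bounds of the form is itself a lower bound. Were it outside the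
  -- spectrum, it could be increased, so it is an eigenvalue, and the test vector makes it negative.
  let S : Set ℝ := {m | ∀ x : (perturbed B).domain,
      m * ‖(x : L2per L)‖ ^ 2 ≤ (inner ℂ (x : L2per L) (perturbed B x)).re}
  have hx0 : 0 < ‖(x₀ : L2per L)‖ ^ 2 := by
    have : (x₀ : L2per L) ≠ 0 := by
      intro h0
      rw [h0, inner_zero_left] at h
      simp at h
    have := norm_pos_iff.2 this
    positivity
  have hub : ∀ m ∈ S, m ≤ (inner ℂ (x₀ : L2per L) (perturbed B x₀)).re / ‖(x₀ : L2per L)‖ ^ 2 :=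
    fun m hm => (le_div_iff₀ hx0).2 (hm x₀)
  have hbdd : BddAbove S := ⟨_, hub⟩
  have hne : S.Nonempty := ⟨-‖B‖, form_lower_bound⟩
  have hmem : sSup S ∈ S := by
    intro x
    by_contra hlt
    push Not at hlt
    have hpos : 0 < ‖(x : L2per L)‖ ^ 2 := by
      have : (x : L2per L) ≠ 0 := by
        intro h0
        rw [h0, inner_zero_left] at hlt
        simp at hlt
      have := norm_pos_iff.2 this
      positivity
    rw [← div_lt_iff₀ hpos] at hlt
    obtain ⟨m, hm, hlt'⟩ := exists_lt_of_lt_csSup hne hlt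
    rw [div_lt_iff₀ hpos] at hlt'
    exact absurd (hm x) (not_le.2 hlt')
  refine ⟨sSup S, ?_, ?_⟩
  · exact (csSup_le hne hub).trans_lt (div_neg_of_neg_of_pos h hx0)
  · refine exists_eigenvector_of_mem_opSpectrum ?_
    by_contra hs
    obtain ⟨δ, hδ, hgap⟩ := exists_form_gap hB hmem hs
    have := le_csSup hbdd (show sSup S + δ ∈ S from hgap)
    linarith

end BoundedPerturbation

/-! ### Elliptic integrals, `dn`, and existence of the dnoidal wave -/

section Jacobi

variable {k : ℝ}

theorem one_sub_sq_mul_sin_sq_pos (hk : k ^ 2 < 1) (t : ℝ) : 0 < 1 - k ^ 2 * Real.sin t ^ 2 := by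
  nlinarith [Real.sin_sq_le_one t, sq_nonneg (Real.sin t), sq_nonneg k]

theorem one_sub_sq_mul_sin_sq_le_one (k t : ℝ) : 1 - k ^ 2 * Real.sin t ^ 2 ≤ 1 := by
  nlinarith [mul_nonneg (sq_nonneg k) (sq_nonneg (Real.sin t))]

theorem continuous_ellipticF_integrand (hk : k ^ 2 < 1) :
    Continuous fun t : ℝ => 1 / √(1 - k ^ 2 * Real.sin t ^ 2) := by
  refine continuous_const.div (by fun_prop) fun t => ?_
  exact (Real.sqrt_pos.2 (one_sub_sq_mul_sin_sq_pos hk t)).ne'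

theorem one_le_ellipticF_integrand (hk : k ^ 2 < 1) (t : ℝ) :
    1 ≤ 1 / √(1 - k ^ 2 * Real.sin t ^ 2) := by
  rw [one_le_div (Real.sqrt_pos.2 (one_sub_sq_mul_sin_sq_pos hk t))]
  exact Real.sqrt_le_one.2 (one_sub_sq_mul_sin_sq_le_one k t)

theorem hasDerivAt_ellipticF (hk : k ^ 2 < 1) (x : ℝ) :
    HasDerivAt (ellipticF k) (1 / √(1 - k ^ 2 * Real.sin x ^ 2)) x :=
  intervalIntegral.integral_hasDerivAt_right
    ((continuous_ellipticF_integrand hk).intervalIntegrable _ _)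
    (continuous_ellipticF_integrand hk).stronglyMeasurable.stronglyMeasurableAtFilter
    (continuous_ellipticF_integrand hk).continuousAt

theorem strictMono_ellipticF (hk : k ^ 2 < 1) : StrictMono (ellipticF k) :=
  strictMono_of_hasDerivAt_pos (hasDerivAt_ellipticF hk) fun t =>
    one_pos.trans_le (one_le_ellipticF_integrand hk t)

theorem ellipticF_zero (k : ℝ) : ellipticF k 0 = 0 := intervalIntegral.integral_same

theorem ellipticF_neg (k x : ℝ) : ellipticF k (-x) = -ellipticF k x := by
  have h := intervalIntegral.integral_comp_neg (a := 0) (b := x)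
    (fun t : ℝ => 1 / √(1 - k ^ 2 * Real.sin t ^ 2))
  simp only [Real.sin_neg, neg_sq, neg_zero] at h
  unfold ellipticF
  rw [h, ← intervalIntegral.integral_symm]

theorem self_le_ellipticF (hk : k ^ 2 < 1) {x : ℝ} (hx : 0 ≤ x) : x ≤ ellipticF k x := by
  have h := intervalIntegral.integral_mono_on hx (continuous_const.intervalIntegrable (μ := volume) 0 x)
    ((continuous_ellipticF_integrand hk).intervalIntegrable 0 x)
    fun t _ => one_le_ellipticF_integrand hk t
  simpa [ellipticF] using h

theorem surjective_ellipticF (hk : k ^ 2 < 1) : Function.Surjective (ellipticF k) := by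
  have hc : Continuous (ellipticF k) :=
    continuous_iff_continuousAt.2 fun x => (hasDerivAt_ellipticF hk x).continuousAt
  refine hc.surjective ?_ ?_
  · exact tendsto_atTop_mono' _ (by
      filter_upwards [eventually_ge_atTop 0] with x hx using self_le_ellipticF hk hx) tendsto_id
  · refine tendsto_atBot_mono' _ ?_ tendsto_id
    filter_upwards [eventually_le_atBot 0] with x hx
    have := self_le_ellipticF hk (neg_nonneg.2 hx)
    rw [ellipticF_neg] at this
    simp only [id_eq]; linarith

theorem jacobiAm_ellipticF (hk : k ^ 2 < 1) (x : ℝ) : jacobiAm k (ellipticF k x) = x :=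
  Function.leftInverse_invFun (strictMono_ellipticF hk).injective x

theorem ellipticF_jacobiAm (hk : k ^ 2 < 1) (u : ℝ) : ellipticF k (jacobiAm k u) = u :=
  Function.invFun_eq (surjective_ellipticF hk u)

theorem strictMono_jacobiAm (hk : k ^ 2 < 1) : StrictMono (jacobiAm k) := by
  intro u v huv
  rwa [← (strictMono_ellipticF hk).lt_iff_lt, ellipticF_jacobiAm hk, ellipticF_jacobiAm hk]

theorem hasDerivAt_jacobiAm (hk : k ^ 2 < 1) (u : ℝ) :
    HasDerivAt (jacobiAm k) (jacobiDn k u) u := by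
  have hsurj : Function.Surjective (jacobiAm k) := fun x => ⟨_, jacobiAm_ellipticF hk x⟩
  have hc : Continuous (jacobiAm k) := (strictMono_jacobiAm hk).monotone.continuous_of_surjective hsurj
  have h := HasDerivAt.of_local_left_inverse hc.continuousAt
    (hasDerivAt_ellipticF hk (jacobiAm k u))
    (one_pos.trans_le (one_le_ellipticF_integrand hk _)).ne'
    (Eventually.of_forall (ellipticF_jacobiAm hk))
  simpa [jacobiDn] using h

theorem jacobiDn_pos (hk : k ^ 2 < 1) (u : ℝ) : 0 < jacobiDn k u :=
  Real.sqrt_pos.2 (one_sub_sq_mul_sin_sq_pos hk _)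

theorem jacobiDn_sq (hk : k ^ 2 < 1) (u : ℝ) :
    jacobiDn k u ^ 2 = 1 - k ^ 2 * Real.sin (jacobiAm k u) ^ 2 :=
  Real.sq_sqrt (one_sub_sq_mul_sin_sq_pos hk _).le

theorem hasDerivAt_jacobiDn (hk : k ^ 2 < 1) (u : ℝ) : HasDerivAt (jacobiDn k)
    (-k ^ 2 * Real.sin (jacobiAm k u) * Real.cos (jacobiAm k u)) u := by
  have h1 : HasDerivAt (fun u => 1 - k ^ 2 * Real.sin (jacobiAm k u) ^ 2) _ u :=
    (((hasDerivAt_jacobiAm hk u).sin.pow 2).const_mul (k ^ 2)).const_sub 1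
  have h2 := h1.sqrt (one_sub_sq_mul_sin_sq_pos hk _).ne'
  refine h2.congr_deriv ?_
  have h3 := jacobiDn_pos hk u
  change _ / (2 * jacobiDn k u) = _
  field_simp
  simp
  ring

theorem jacobiAm_neg (hk : k ^ 2 < 1) (u : ℝ) : jacobiAm k (-u) = -jacobiAm k u := by
  apply (strictMono_ellipticF hk).injective
  rw [ellipticF_jacobiAm hk, ellipticF_neg, ellipticF_jacobiAm hk]

theorem jacobiDn_neg (hk : k ^ 2 < 1) (u : ℝ) : jacobiDn k (-u) = jacobiDn k u := by
  unfold jacobiDn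
  rw [jacobiAm_neg hk, Real.sin_neg, neg_sq]

theorem ellipticF_add_pi (hk : k ^ 2 < 1) (x : ℝ) :
    ellipticF k (x + Real.pi) = ellipticF k x + 2 * ellipticK k := by
  have hder : ∀ y, HasDerivAt (fun x => ellipticF k (x + Real.pi) - ellipticF k x) 0 y := by
    intro y
    have h1 := ((hasDerivAt_ellipticF hk (y + Real.pi)).comp_add_const y Real.pi).sub
      (hasDerivAt_ellipticF hk y)
    refine h1.congr_deriv ?_
    rw [Real.sin_add_pi, neg_sq, sub_self]
  -- The constant F(x + π) - F(x) is evaluated at x = -π/2, where oddness of F turns it into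
  -- 2F(π/2).
  have hconst := is_const_of_deriv_eq_zero (fun y => (hder y).differentiableAt)
    (fun y => (hder y).deriv) x (-(Real.pi / 2))
  simp only [ellipticF_neg] at hconst
  rw [show -(Real.pi / 2) + Real.pi = Real.pi / 2 by ring] at hconst
  unfold ellipticK
  linarith

theorem jacobiAm_add_two_mul_ellipticK (hk : k ^ 2 < 1) (u : ℝ) :
    jacobiAm k (u + 2 * ellipticK k) = jacobiAm k u + Real.pi := by
  apply (strictMono_ellipticF hk).injective
  rw [ellipticF_jacobiAm hk, ellipticF_add_pi hk, ellipticF_jacobiAm hk]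

theorem jacobiDn_add_two_mul_ellipticK (hk : k ^ 2 < 1) (u : ℝ) :
    jacobiDn k (u + 2 * ellipticK k) = jacobiDn k u := by
  unfold jacobiDn
  rw [jacobiAm_add_two_mul_ellipticK hk, Real.sin_add_pi, neg_sq]

theorem ellipticK_zero : ellipticK 0 = Real.pi / 2 := by
  simp [ellipticK, ellipticF]

theorem continuousOn_ellipticK {k₁ : ℝ} (h0 : 0 ≤ k₁) (h1 : k₁ < 1) :
    ContinuousOn ellipticK (Icc 0 k₁) := by
  have hδ : 0 < 1 - k₁ ^ 2 := by nlinarith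
  -- Truncating the radicand from below makes the integrand jointly continuous for all real k; for k
  -- in [0, k₁] the truncation is inactive.
  have hc : Continuous (fun k : ℝ => ∫ t in (0 : ℝ)..(Real.pi / 2),
      1 / √(max (1 - k ^ 2 * Real.sin t ^ 2) (1 - k₁ ^ 2))) := by
    refine intervalIntegral.continuous_parametric_intervalIntegral_of_continuous' ?_ _ _
    refine continuous_const.div (by fun_prop) fun p => ?_
    exact (Real.sqrt_pos.2 (lt_max_of_lt_right hδ)).ne'
  refine hc.continuousOn.congr fun k hk => ?_
  refine intervalIntegral.integral_congr fun t _ => ?_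
  have : 1 - k₁ ^ 2 ≤ 1 - k ^ 2 * Real.sin t ^ 2 := by
    nlinarith [Real.sin_sq_le_one t, sq_nonneg (Real.sin t), hk.1, hk.2, sq_nonneg k,
      mul_self_le_mul_self hk.1 hk.2]
  simp only [max_eq_left this]

/-- Forces K(k) → ∞ as k → 1. With ε² = 1 - k² the radicand is ε² + k² cos² t ≤ (ε + cos t)², and
cos t ≤ π/2 - t, so the integrand is at least 1/(ε + π/2 - t), whose integral is the logarithm. -/
theorem log_le_ellipticK (h0 : 0 ≤ k) (h1 : k < 1) :
    Real.log ((√(1 - k ^ 2) + Real.pi / 2) / √(1 - k ^ 2)) ≤ ellipticK k := by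
  have hk : k ^ 2 < 1 := by nlinarith
  set ε := √(1 - k ^ 2) with hε
  have hεpos : 0 < ε := Real.sqrt_pos.2 (by linarith)
  have hεsq : ε ^ 2 = 1 - k ^ 2 := Real.sq_sqrt (by linarith)
  have hpi := Real.pi_div_two_pos
  have hc : ContinuousOn (fun t : ℝ => 1 / (ε + Real.pi / 2 - t)) (uIcc 0 (Real.pi / 2)) := by
    refine continuousOn_const.div (by fun_prop) fun t ht => ?_
    rw [uIcc_of_le hpi.le] at ht
    have := ht.2
    exact (by linarith : (0 : ℝ) < ε + Real.pi / 2 - t).ne'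
  have hint : ∫ t in (0 : ℝ)..(Real.pi / 2), 1 / (ε + Real.pi / 2 - t) =
      Real.log ((ε + Real.pi / 2) / ε) := by
    rw [intervalIntegral.integral_eq_sub_of_hasDerivAt
      (f := fun t => -Real.log (ε + Real.pi / 2 - t)) ?_ hc.intervalIntegrable]
    · rw [Real.log_div (by positivity) hεpos.ne', add_sub_cancel_right, sub_zero]; ring
    · intro t ht
      rw [uIcc_of_le hpi.le] at ht
      have h2 : (0 : ℝ) < ε + Real.pi / 2 - t := by linarith [ht.2]
      have := (((hasDerivAt_id t).const_sub (ε + Real.pi / 2)).log h2.ne').neg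
      refine this.congr_deriv ?_
      simp only [id_eq]; field_simp
  rw [← hint]
  refine intervalIntegral.integral_mono_on hpi.le hc.intervalIntegrable
    ((continuous_ellipticF_integrand hk).intervalIntegrable _ _) fun t ht => ?_
  have hcos : 0 ≤ Real.cos t := Real.cos_nonneg_of_mem_Icc ⟨by linarith [ht.1], ht.2⟩
  have hcos2 : Real.cos t ≤ Real.pi / 2 - t := by
    rw [← Real.sin_pi_div_two_sub]
    exact Real.sin_le (by linarith [ht.2])
  refine one_div_le_one_div_of_le (Real.sqrt_pos.2 (one_sub_sq_mul_sin_sq_pos hk t)) ?_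
  refine Real.sqrt_le_iff.2 ⟨by linarith, ?_⟩
  have h3 : (ε + Real.cos t) ^ 2 ≤ (ε + Real.pi / 2 - t) ^ 2 := by
    refine pow_le_pow_left₀ (by positivity) (by linarith) 2
  refine le_trans ?_ h3
  have := Real.sin_sq_add_cos_sq t
  nlinarith [mul_nonneg hεpos.le hcos, sq_nonneg (Real.cos t), sq_nonneg k, mul_nonneg (sq_nonneg k) (sq_nonneg (Real.cos t)), sq_nonneg (Real.sin t)]

/-- The modulus of the dnoidal wave of period `L`. -/
theorem exists_modulus {L σ : ℝ} (hL : 0 < L) (hσ : 2 * Real.pi ^ 2 / L ^ 2 < σ) :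
    ∃ k, 0 < k ∧ k < 1 ∧ 2 * ellipticK k * √(2 - k ^ 2) = L * √σ := by
  have hpi := Real.pi_pos
  have hσ0 : 0 < σ := lt_trans (by positivity) hσ
  set M := L * √σ with hM
  have hMpos : 0 < M := by positivity
  -- Chosen so that e^M ε = 1/2 ≤ ε + π/2, which makes the logarithmic lower bound for K at least M.
  set ε := Real.exp (-M) / 2 with hε
  have hεpos : 0 < ε := by positivity
  have hε1 : ε < 1 := by
    have : Real.exp (-M) ≤ 1 := Real.exp_le_one_iff.2 (by linarith)
    rw [hε]; linarith
  set k₁ := √(1 - ε ^ 2) with hk₁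
  have hk₁sq : k₁ ^ 2 = 1 - ε ^ 2 := Real.sq_sqrt (by nlinarith)
  have hk₁0 : 0 ≤ k₁ := Real.sqrt_nonneg _
  have hk₁1 : k₁ < 1 := by nlinarith
  have hbig : M < 2 * ellipticK k₁ * √(2 - k₁ ^ 2) := by
    have h1 := log_le_ellipticK hk₁0 hk₁1
    have h2 : √(1 - k₁ ^ 2) = ε := by
      rw [hk₁sq, sub_sub_cancel, Real.sqrt_sq hεpos.le]
    rw [h2] at h1
    have h3 : M ≤ Real.log ((ε + Real.pi / 2) / ε) := by
      rw [Real.le_log_iff_exp_le (by positivity), le_div_iff₀ hεpos, hε, ← mul_div_assoc,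
        ← Real.exp_add, add_neg_cancel, Real.exp_zero]
      have : (3 : ℝ) < Real.pi := Real.pi_gt_three
      have := Real.exp_pos (-M)
      linarith
    have h4 : 1 ≤ √(2 - k₁ ^ 2) := Real.one_le_sqrt.2 (by nlinarith)
    have h5 := mul_le_mul_of_nonneg_left h4 (hMpos.le.trans (h3.trans h1))
    linarith
  -- At k = 0 the left side is π√2, and π√2 < L√σ is exactly the condition σ > 2π²/L².
  have hsmall : 2 * ellipticK 0 * √(2 - 0 ^ 2) < M := by
    rw [ellipticK_zero]
    have h1 : (Real.pi * √2) ^ 2 < M ^ 2 := by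
      rw [hM, mul_pow, mul_pow, Real.sq_sqrt (by norm_num), Real.sq_sqrt hσ0.le]
      rw [div_lt_iff₀ (by positivity)] at hσ
      linarith
    have h2 := lt_of_pow_lt_pow_left₀ 2 hMpos.le h1
    have e : 2 * (Real.pi / 2) * √(2 - 0 ^ 2) = Real.pi * √2 := by norm_num; ring
    rwa [e]
  have hcont : ContinuousOn (fun k => 2 * ellipticK k * √(2 - k ^ 2)) (Icc 0 k₁) :=
    (continuousOn_const.mul (continuousOn_ellipticK hk₁0 hk₁1)).mul (by fun_prop)
  obtain ⟨k, hk, hke⟩ := intermediate_value_Ioo hk₁0 hcont ⟨hsmall, hbig⟩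
  exact ⟨k, hk.1, hk.2.trans hk₁1, hke⟩

end Jacobi

/-- A profile solving `Φ'' = κ((η₁² + η₂²)Φ - 2Φ³)` with period `L`, even, oscillating between
`η₂` and `η₁`, whose square crosses each intermediate value exactly twice in a period. -/
structure IsDnProfile (L κ η₁ η₂ : ℝ) (Φ Φ' : ℝ → ℝ) : Prop where
  κ_pos : 0 < κ
  η₂_pos : 0 < η₂
  lt : η₂ < η₁
  deriv : ∀ x, HasDerivAt Φ (Φ' x) x
  deriv' : ∀ x, HasDerivAt Φ' (κ * ((η₁ ^ 2 + η₂ ^ 2) * Φ x - 2 * Φ x ^ 3)) x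
  energy : ∀ x, Φ' x ^ 2 = κ * (η₁ ^ 2 - Φ x ^ 2) * (Φ x ^ 2 - η₂ ^ 2)
  le : ∀ x, η₂ ≤ Φ x
  le' : ∀ x, Φ x ≤ η₁
  periodic : Function.Periodic Φ L
  even : ∀ x, Φ (-x) = Φ x
  crossing : ∀ a, η₂ ^ 2 < a → a < η₁ ^ 2 → ∃ x₀, 0 < x₀ ∧ x₀ < L / 2 ∧
    (∀ x ∈ Ioo (-x₀) x₀, a < Φ x ^ 2) ∧ (∀ x ∈ Ioo x₀ (L - x₀), Φ x ^ 2 < a)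

theorem isDnProfile_jacobiDn {L κ η₁ η₂ k l : ℝ} (hκ : 0 < κ) (hη₂ : 0 < η₂) (hlt : η₂ < η₁)
    (hk : k = √((η₁ ^ 2 - η₂ ^ 2) / η₁ ^ 2)) (hl : l = η₁ * √κ) (hL : 2 * ellipticK k / l = L) :
    IsDnProfile L κ η₁ η₂ (fun x => η₁ * jacobiDn k (l * x))
      (fun x => -(η₁ * l * k ^ 2) * (Real.sin (jacobiAm k (l * x)) *
        Real.cos (jacobiAm k (l * x)))) := by
  have hη₁ : 0 < η₁ := hη₂.trans hlt
  have hk2 : k ^ 2 = (η₁ ^ 2 - η₂ ^ 2) / η₁ ^ 2 := by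
    rw [hk, Real.sq_sqrt]
    exact div_nonneg (by nlinarith) (by positivity)
  have hk1 : k ^ 2 < 1 := by
    rw [hk2, div_lt_one (by positivity)]; nlinarith
  have hk0 : 0 < k ^ 2 := by
    rw [hk2]; exact div_pos (by nlinarith) (by positivity)
  have hl0 : 0 < l := by rw [hl]; positivity
  have hl2 : l ^ 2 = κ * η₁ ^ 2 := by rw [hl, mul_pow, Real.sq_sqrt hκ.le]; ring
  have hη₂2 : η₂ ^ 2 = η₁ ^ 2 * (1 - k ^ 2) := by rw [hk2]; field_simp; ring
  have hlL : l * L = 2 * ellipticK k := by rw [← hL]; field_simp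
  have hsq : ∀ x, (η₁ * jacobiDn k (l * x)) ^ 2 =
      η₁ ^ 2 * (1 - k ^ 2 * Real.sin (jacobiAm k (l * x)) ^ 2) := by
    intro x; rw [mul_pow, jacobiDn_sq hk1]
  have hlx : ∀ x, HasDerivAt (fun x : ℝ => l * x) l x := by
    intro x; simpa using (hasDerivAt_id x).const_mul l
  refine ⟨hκ, hη₂, hlt, ?_, ?_, ?_, ?_, ?_, ?_, ?_, ?_⟩
  · intro x
    have h1 := ((hasDerivAt_jacobiDn hk1 (l * x)).comp x (hlx x)).const_mul η₁
    refine h1.congr_deriv ?_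
    ring
  · intro x
    have h0 : HasDerivAt (fun x => jacobiAm k (l * x)) (jacobiDn k (l * x) * l) x :=
      (hasDerivAt_jacobiAm hk1 (l * x)).comp x (hlx x)
    have h1 := (h0.sin.mul h0.cos).const_mul (-(η₁ * l * k ^ 2))
    refine h1.congr_deriv ?_
    have hd := jacobiDn_sq hk1 (l * x)
    have hcs := Real.sin_sq_add_cos_sq (jacobiAm k (l * x))
    set D := jacobiDn k (l * x)
    set S := Real.sin (jacobiAm k (l * x))
    set C := Real.cos (jacobiAm k (l * x))
    have hC : C ^ 2 = 1 - S ^ 2 := by linarith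
    have e : κ * ((η₁ ^ 2 + η₂ ^ 2) * (η₁ * D) - 2 * (η₁ * D) ^ 3) =
        (κ * η₁ ^ 2) * (η₁ * D) * (2 - k ^ 2 - 2 * D ^ 2) := by rw [hη₂2]; ring
    rw [e, ← hl2, hd]
    have e2 : -(η₁ * l * k ^ 2) * (C * (D * l) * C + S * (-S * (D * l))) =
      l ^ 2 * (η₁ * D) * (-k ^ 2 * (C ^ 2 - S ^ 2)) := by ring
    rw [e2, hC]; ring
  · intro x
    have hcs := Real.sin_sq_add_cos_sq (jacobiAm k (l * x))
    simp only [hsq, hη₂2]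
    set S := Real.sin (jacobiAm k (l * x))
    set C := Real.cos (jacobiAm k (l * x))
    have hC : C ^ 2 = 1 - S ^ 2 := by linarith
    have e : (-(η₁ * l * k ^ 2) * (S * C)) ^ 2 = η₁ ^ 2 * l ^ 2 * k ^ 4 * S ^ 2 * C ^ 2 := by ring
    rw [e, hC, hl2]; ring
  · intro x
    have h1 : η₂ ^ 2 ≤ (η₁ * jacobiDn k (l * x)) ^ 2 := by
      rw [hsq, hη₂2]
      have := Real.sin_sq_le_one (jacobiAm k (l * x))
      have := mul_le_of_le_one_right hk0.le this
      exact mul_le_mul_of_nonneg_left (by linarith) (by positivity)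
    exact le_of_sq_le_sq h1 (mul_pos hη₁ (jacobiDn_pos hk1 _)).le
  · intro x
    exact mul_le_of_le_one_right hη₁.le (Real.sqrt_le_one.2 (one_sub_sq_mul_sin_sq_le_one _ _))
  · intro x
    simp only [mul_add, hlL, jacobiDn_add_two_mul_ellipticK hk1]
  · intro x
    simp only [mul_neg, jacobiDn_neg hk1]
  · intro a ha1 ha2
    -- In terms of the amplitude, Φ² = η₁²(1 - k² sin² am), so Φ² = a means sin² am = q. The first
    -- crossing occurs at amplitude θ = arcsin √q, hence at x₀ = F(θ)/l, and the next one at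
    -- amplitude π - θ, hence at L - x₀.
    set q := (1 - a / η₁ ^ 2) / k ^ 2 with hq
    have hqa : η₁ ^ 2 * (1 - k ^ 2 * q) = a := by
      rw [hq, mul_div_cancel₀ _ hk0.ne']; field_simp; ring
    have hq0 : 0 < q := by
      refine div_pos ?_ hk0
      rw [sub_pos, div_lt_one (by positivity)]; exact ha2
    have hq1 : q < 1 := by
      have : η₁ ^ 2 * (1 - k ^ 2) < η₁ ^ 2 * (1 - k ^ 2 * q) := by rw [hqa, ← hη₂2]; exact ha1
      have := lt_of_mul_lt_mul_left this (by positivity)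
      nlinarith
    set θ := Real.arcsin (√q) with hθ
    have hsq0 : 0 < √q := Real.sqrt_pos.2 hq0
    have hsq1 : √q < 1 := (Real.sqrt_lt' one_pos).2 (by simpa using hq1)
    have hθ0 : 0 < θ := Real.arcsin_pos.2 hsq0
    have hθ1 : θ < Real.pi / 2 := Real.arcsin_lt_pi_div_two.2 hsq1
    have hsinθ : Real.sin θ = √q := Real.sin_arcsin (by linarith) hsq1.le
    have hsinθ2 : Real.sin θ ^ 2 = q := by rw [hsinθ, Real.sq_sqrt hq0.le]
    have hpi := Real.pi_pos
    have ham : ∀ x y, jacobiAm k (l * x) < y ↔ x < ellipticF k y / l := by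
      intro x y
      rw [← (strictMono_ellipticF hk1).lt_iff_lt, ellipticF_jacobiAm hk1, lt_div_iff₀ hl0, mul_comm]
    have ham' : ∀ x y, y < jacobiAm k (l * x) ↔ ellipticF k y / l < x := by
      intro x y
      rw [← (strictMono_ellipticF hk1).lt_iff_lt, ellipticF_jacobiAm hk1, div_lt_iff₀ hl0, mul_comm]
    refine ⟨ellipticF k θ / l, ?_, ?_, ?_, ?_⟩
    · refine div_pos ?_ hl0
      rw [← ellipticF_zero k]; exact strictMono_ellipticF hk1 hθ0
    · have := strictMono_ellipticF hk1 hθ1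
      rw [div_lt_iff₀ hl0]
      have e : L / 2 * l = ellipticF k (Real.pi / 2) := by
        change _ = ellipticK k
        linarith
      rwa [e]
    · intro x hx
      have h1 := (ham x θ).2 hx.2
      have h2 := (ham' x (-θ)).2 (by rw [ellipticF_neg, neg_div]; exact hx.1)
      rw [hsq, ← hqa]
      have h3 : Real.sin (jacobiAm k (l * x)) ^ 2 < q := by
        rw [← hsinθ2]
        refine sq_lt_sq' ?_ ?_
        · rw [← Real.sin_neg]
          exact Real.sin_lt_sin_of_lt_of_le_pi_div_two (by linarith) (by linarith) h2
        · exact Real.sin_lt_sin_of_lt_of_le_pi_div_two (by linarith) (by linarith) h1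
      have := mul_lt_mul_of_pos_left h3 hk0
      exact mul_lt_mul_of_pos_left (by linarith) (by positivity)
    · intro x hx
      have h1 := (ham' x θ).2 hx.1
      have h2 : jacobiAm k (l * x) < Real.pi - θ := by
        rw [ham]
        have e : ellipticF k (Real.pi - θ) / l = L - ellipticF k θ / l := by
          rw [sub_eq_neg_add, ellipticF_add_pi hk1, ellipticF_neg, ← hlL]
          field_simp; ring
        rw [e]; exact hx.2
      rw [hsq, ← hqa]
      have h3 : q < Real.sin (jacobiAm k (l * x)) ^ 2 := by
        rw [← hsinθ2]
        refine pow_lt_pow_left₀ ?_ (by rw [hsinθ]; exact hsq0.le) two_ne_zero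
        rcases le_total (jacobiAm k (l * x)) (Real.pi / 2) with h4 | h4
        · exact Real.sin_lt_sin_of_lt_of_le_pi_div_two (by linarith) h4 h1
        · rw [← Real.sin_pi_sub (jacobiAm k (l * x))]
          exact Real.sin_lt_sin_of_lt_of_le_pi_div_two (by linarith) (by linarith) (by linarith)
      have := mul_lt_mul_of_pos_left h3 hk0
      exact mul_lt_mul_of_pos_left (by linarith) (by positivity)

theorem IsDnoidalWave.exists_profile {L : ℝ} {α β c σ : ℝ} (hα : 0 < α) (hβ : 0 < β) (hc : 0 < c)
    {φ ψ : C(AddCircle L, ℝ)} (h : IsDnoidalWave α β c σ φ ψ) :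
    ∃ η₁ η₂ : ℝ, ∃ Φ Φ' : ℝ → ℝ, IsDnProfile L (α * β / (2 * c)) η₁ η₂ Φ Φ' ∧
      α * β / (2 * c) * (η₁ ^ 2 + η₂ ^ 2) = σ ∧ (∀ x : ℝ, φ (x : AddCircle L) = Φ x) ∧
      ∀ x : AddCircle L, ψ x = -(β / c) * φ x ^ 2 := by
  obtain ⟨η₁, η₂, k, l, h1, h2, h3, h4, h5, h6, h7, h8⟩ := h
  refine ⟨η₁, η₂, _, _, isDnProfile_jacobiDn (by positivity) h1 h2 h4 h5 h6, ?_, h7, h8⟩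
  rw [h3]; field_simp

/-- A continuous function on the circle from a continuous periodic function. -/
def circleLift {L : ℝ} (f : ℝ → ℝ) (hf : Continuous f) (hp : Function.Periodic f L) :
    C(AddCircle L, ℝ) :=
  ⟨hp.lift, continuous_coinduced_dom.2 (by exact hf)⟩

theorem circleLift_coe {L : ℝ} {f : ℝ → ℝ} (hf : Continuous f) (hp : Function.Periodic f L)
    (x : ℝ) : circleLift f hf hp (x : AddCircle L) = f x := hp.lift_coe x

theorem exists_isDnoidalWave {L : ℝ} (hL : 0 < L) {α β c σ : ℝ} (hα : 0 < α) (hβ : 0 < β)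
    (hc : 0 < c) (hσ : 2 * Real.pi ^ 2 / L ^ 2 < σ) :
    ∃ φ ψ : C(AddCircle L, ℝ), IsDnoidalWave α β c σ φ ψ := by
  obtain ⟨k, hk0, hk1, hk⟩ := exists_modulus hL hσ
  have hpi := Real.pi_pos
  have hσ0 : 0 < σ := lt_trans (by positivity) hσ
  set κ := α * β / (2 * c) with hκ
  have hκ0 : 0 < κ := by positivity
  have h2k : 0 < 2 - k ^ 2 := by nlinarith
  -- Determined by κ(η₁² + η₂²) = σ together with η₂² = (1 - k²)η₁².
  set η₁ := √(σ / (κ * (2 - k ^ 2))) with hη₁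
  have hη₁2 : η₁ ^ 2 = σ / (κ * (2 - k ^ 2)) := Real.sq_sqrt (by positivity)
  have hη₁0 : 0 < η₁ := Real.sqrt_pos.2 (by positivity)
  set η₂ := η₁ * √(1 - k ^ 2) with hη₂
  have h1k : 0 < 1 - k ^ 2 := by nlinarith
  have hη₂2 : η₂ ^ 2 = η₁ ^ 2 * (1 - k ^ 2) := by rw [hη₂, mul_pow, Real.sq_sqrt h1k.le]
  have hη₂0 : 0 < η₂ := mul_pos hη₁0 (Real.sqrt_pos.2 h1k)
  have hlt : η₂ < η₁ := by
    refine mul_lt_of_lt_one_right hη₁0 ?_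
    rw [Real.sqrt_lt' one_pos]; nlinarith
  have hkk : k = √((η₁ ^ 2 - η₂ ^ 2) / η₁ ^ 2) := by
    rw [hη₂2]
    have : (η₁ ^ 2 - η₁ ^ 2 * (1 - k ^ 2)) / η₁ ^ 2 = k ^ 2 := by field_simp; ring
    rw [this, Real.sqrt_sq hk0.le]
  have hl0 : 0 < η₁ * √κ := by positivity
  have hL' : 2 * ellipticK k / (η₁ * √κ) = L := by
    rw [div_eq_iff hl0.ne']
    have e : η₁ * √κ * √(2 - k ^ 2) = √σ := by
      rw [hη₁, ← Real.sqrt_mul (by positivity), ← Real.sqrt_mul (by positivity)]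
      congr 1; field_simp
    have h3 : 0 < √(2 - k ^ 2) := Real.sqrt_pos.2 h2k
    refine mul_right_cancel₀ h3.ne' ?_
    rw [hk, mul_assoc, e]
  have hP := isDnProfile_jacobiDn hκ0 hη₂0 hlt hkk rfl hL'
  have hcont : Continuous fun x => η₁ * jacobiDn k (η₁ * √κ * x) :=
    continuous_iff_continuousAt.2 fun x => (hP.deriv x).continuousAt
  let φ := circleLift _ hcont hP.periodic
  refine ⟨φ, -(β / c) • φ ^ 2, η₁, η₂, k, η₁ * √κ, hη₂0, hlt, ?_, hkk, rfl, hL', fun x => ?_,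
    fun x => ?_⟩
  · rw [hη₂2, hη₁2, hκ]; field_simp; ring
  · exact circleLift_coe _ _ x
  · rfl

/-! ### Picone's identity and inequality -/

section Picone

/-- The pointwise Picone identity. -/
theorem picone_hasDerivAt {f f' u u' V : ℝ → ℝ} {lam x : ℝ} (hf : HasDerivAt f (f' x) x)
    (hu : HasDerivAt u (u' x) x) (hu' : HasDerivAt u' ((V x - lam) * u x) x) (h0 : u x ≠ 0) :
    HasDerivAt (fun y => u' y * (f y ^ 2 / u y))
      (f' x ^ 2 + (V x - lam) * f x ^ 2 - (f' x - u' x / u x * f x) ^ 2) x := by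
  have h := hu'.mul ((hf.pow 2).div hu h0)
  refine h.congr_deriv ?_
  simp only [Pi.pow_apply, Pi.div_apply]
  field_simp
  push_cast
  ring

/-- The pointwise identity integrated over an interval free of zeros of u. The boundary terms u'f²/u
are kept: they cancel by periodicity for a positive u, and vanish in the limit at common zeros of f
and u. -/
theorem picone_integral_le {f f' u u' V : ℝ → ℝ} {lam s t : ℝ} (hst : s ≤ t)
    (hf : ∀ x, HasDerivAt f (f' x) x) (hf' : Continuous f')
    (hu : ∀ x, HasDerivAt u (u' x) x) (hu' : ∀ x, HasDerivAt u' ((V x - lam) * u x) x)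
    (hV : Continuous V) (h0 : ∀ x ∈ Icc s t, u x ≠ 0) :
    ∫ x in s..t, (f' x - u' x / u x * f x) ^ 2 =
      (∫ x in s..t, (f' x ^ 2 + (V x - lam) * f x ^ 2)) -
        (u' t * (f t ^ 2 / u t) - u' s * (f s ^ 2 / u s)) := by
  have hcf : Continuous f := continuous_iff_continuousAt.2 fun x => (hf x).continuousAt
  have hcu : Continuous u := continuous_iff_continuousAt.2 fun x => (hu x).continuousAt
  have hcu' : Continuous u' := continuous_iff_continuousAt.2 fun x => (hu' x).continuousAt
  have hI1 : IntervalIntegrable (fun x => f' x ^ 2 + (V x - lam) * f x ^ 2) volume s t :=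
    Continuous.intervalIntegrable (by fun_prop) s t
  have hI2 : IntervalIntegrable (fun x => (f' x - u' x / u x * f x) ^ 2) volume s t := by
    refine ContinuousOn.intervalIntegrable ?_
    rw [uIcc_of_le hst]
    exact (hf'.continuousOn.sub ((hcu'.continuousOn.div hcu.continuousOn h0).mul
      hcf.continuousOn)).pow 2
  have h := intervalIntegral.integral_eq_sub_of_hasDerivAt (a := s) (b := t)
    (f := fun y => u' y * (f y ^ 2 / u y))
    (f' := fun x => f' x ^ 2 + (V x - lam) * f x ^ 2 - (f' x - u' x / u x * f x) ^ 2)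
    (fun x hx => picone_hasDerivAt (hf x) (hu x) (hu' x) (h0 x (by rwa [uIcc_of_le hst] at hx)))
    (hI1.sub hI2)
  rw [intervalIntegral.integral_sub hI1 hI2] at h
  linarith

/-- At a simple zero of u the quotient f/u has the finite limit f'/u', as a quotient of slopes, and
the remaining factor f tends to 0. -/
theorem tendsto_sq_div_zero {f u : ℝ → ℝ} {f' u' b : ℝ} (hf : HasDerivAt f f' b) (hfb : f b = 0)
    (hu : HasDerivAt u u' b) (hub : u b = 0) (hu' : u' ≠ 0) :
    Tendsto (fun t => f t ^ 2 / u t) (𝓝[≠] b) (𝓝 0) := by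
  have h1 := hasDerivAt_iff_tendsto_slope.1 hf
  have h2 := hasDerivAt_iff_tendsto_slope.1 hu
  have h3 : Tendsto f (𝓝[≠] b) (𝓝 0) := by
    rw [← hfb]; exact hf.continuousAt.tendsto.mono_left nhdsWithin_le_nhds
  have h4 := h3.mul (h1.div h2 hu')
  rw [zero_mul] at h4
  refine h4.congr' ?_
  filter_upwards [self_mem_nhdsWithin] with t ht
  have : t - b ≠ 0 := sub_ne_zero.2 ht
  simp only [slope_def_field, hfb, hub, sub_zero, Pi.div_apply]
  field_simp

/-- Picone's inequality between two consecutive simple zeros of `u`. -/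
theorem picone_between_zeros {f f' u u' V : ℝ → ℝ} {lam a b : ℝ} (hab : a < b)
    (hf : ∀ x, HasDerivAt f (f' x) x) (hf' : Continuous f')
    (hu : ∀ x, HasDerivAt u (u' x) x) (hu' : ∀ x, HasDerivAt u' ((V x - lam) * u x) x)
    (hV : Continuous V) (h0 : ∀ x ∈ Ioo a b, u x ≠ 0) (hua : u a = 0) (hub : u b = 0)
    (hua' : u' a ≠ 0) (hub' : u' b ≠ 0) (hfa : f a = 0) (hfb : f b = 0) :
    0 ≤ ∫ x in a..b, (f' x ^ 2 + (V x - lam) * f x ^ 2) := by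
  have hcf : Continuous f := continuous_iff_continuousAt.2 fun x => (hf x).continuousAt
  have hcu' : Continuous u' := continuous_iff_continuousAt.2 fun x => (hu' x).continuousAt
  have hI : ∀ s t, IntervalIntegrable (fun x => f' x ^ 2 + (V x - lam) * f x ^ 2) volume s t :=
    fun s t => Continuous.intervalIntegrable (by fun_prop) s t
  -- The identity is singular at both ends, so each half is treated separately by letting its outer
  -- endpoint tend to the zero; the boundary terms at the midpoint cancel.
  set c := (a + b) / 2 with hc
  have hac : a < c := by rw [hc]; linarith
  have hcb : c < b := by rw [hc]; linarith
  have hbd : ∀ y, (u y = 0) → u' y ≠ 0 → f y = 0 →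
      Tendsto (fun t => u' t * (f t ^ 2 / u t)) (𝓝[≠] y) (𝓝 0) := by
    intro y h1 h2 h3
    have h4 : Tendsto u' (𝓝[≠] y) (𝓝 (u' y)) :=
      (hcu'.tendsto y).mono_left nhdsWithin_le_nhds
    simpa using h4.mul (tendsto_sq_div_zero (hf y) h3 (hu y) h1 h2)
  have hprim : Continuous fun t => ∫ x in c..t, (f' x ^ 2 + (V x - lam) * f x ^ 2) :=
    intervalIntegral.continuous_primitive hI c
  have hright : (u' c * (f c ^ 2 / u c)) * (-1) ≤
      ∫ x in c..b, (f' x ^ 2 + (V x - lam) * f x ^ 2) := by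
    have h1 : Tendsto (fun t => u' t * (f t ^ 2 / u t) - u' c * (f c ^ 2 / u c)) (𝓝[<] b)
        (𝓝 (0 - u' c * (f c ^ 2 / u c))) :=
      ((hbd b hub hub' hfb).mono_left (nhdsWithin_mono _ fun x hx => ne_of_lt hx)).sub_const _
    have h2 := (hprim.tendsto b).mono_left (nhdsWithin_le_nhds (s := Iio b))
    have h3 := le_of_tendsto_of_tendsto h1 h2 (by
      filter_upwards [Ioo_mem_nhdsLT hcb] with t ht
      have h4 := picone_integral_le ht.1.le hf hf' hu hu' hV fun x hx =>
        h0 x ⟨hac.trans_le hx.1, hx.2.trans_lt ht.2⟩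
      have h5 : 0 ≤ ∫ x in c..t, (f' x - u' x / u x * f x) ^ 2 :=
        intervalIntegral.integral_nonneg ht.1.le fun x _ => sq_nonneg _
      linarith)
    linarith
  have hleft : u' c * (f c ^ 2 / u c) ≤
      ∫ x in a..c, (f' x ^ 2 + (V x - lam) * f x ^ 2) := by
    have h1 : Tendsto (fun t => u' c * (f c ^ 2 / u c) - u' t * (f t ^ 2 / u t)) (𝓝[>] a)
        (𝓝 (u' c * (f c ^ 2 / u c) - 0)) :=
      ((hbd a hua hua' hfa).mono_left (nhdsWithin_mono _ fun x hx => ne_of_gt hx)).const_sub _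
    have h2 := ((hprim.tendsto a).mono_left (nhdsWithin_le_nhds (s := Ioi a))).neg
    have h3 := le_of_tendsto_of_tendsto h1 h2 (by
      filter_upwards [Ioo_mem_nhdsGT hac] with t ht
      have h4 := picone_integral_le ht.2.le hf hf' hu hu' hV fun x hx =>
        h0 x ⟨ht.1.trans_le hx.1, hx.2.trans_lt hcb⟩
      have h5 : 0 ≤ ∫ x in t..c, (f' x - u' x / u x * f x) ^ 2 :=
        intervalIntegral.integral_nonneg ht.2.le fun x _ => sq_nonneg _
      rw [intervalIntegral.integral_symm]
      linarith)
    rw [intervalIntegral.integral_symm]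
    linarith
  rw [← intervalIntegral.integral_add_adjacent_intervals (hI a c) (hI c b)]
  linarith

end Picone

/-! ### Explicit eigenfunctions of the Lamé operator -/

section DnLowerBound

variable {L κ η₁ η₂ : ℝ} {Φ Φ' : ℝ → ℝ}

/-- `Φ² - a` is an eigenfunction of `-d²/dx² + κ(η₁² + η₂²) - 6κΦ²` for the roots `a` of
`3a² - 2(η₁² + η₂²)a + η₁²η₂²`. -/
theorem IsDnProfile.eigenfunction (h : IsDnProfile L κ η₁ η₂ Φ Φ') {a : ℝ}
    (ha : 3 * a ^ 2 - 2 * (η₁ ^ 2 + η₂ ^ 2) * a + η₁ ^ 2 * η₂ ^ 2 = 0) (x : ℝ) :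
    HasDerivAt (fun x => Φ x ^ 2 - a) (2 * Φ x * Φ' x) x ∧
    HasDerivAt (fun x => 2 * Φ x * Φ' x)
      ((κ * (η₁ ^ 2 + η₂ ^ 2) - 6 * κ * Φ x ^ 2 - κ * (6 * a - 3 * (η₁ ^ 2 + η₂ ^ 2))) *
        (Φ x ^ 2 - a)) x := by
  refine ⟨?_, ?_⟩
  · refine (((h.deriv x).pow 2).sub_const a).congr_deriv ?_
    push_cast; ring
  · refine (((h.deriv x).const_mul 2).mul (h.deriv' x)).congr_deriv ?_
    have e := h.energy x
    linear_combination 2 * e - 2 * κ * ha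

theorem IsDnProfile.continuous (h : IsDnProfile L κ η₁ η₂ Φ Φ') : Continuous Φ :=
  continuous_iff_continuousAt.2 fun x => (h.deriv x).continuousAt

/-- The form of `-d²/dx² + κ(η₁² + η₂²) - 6κΦ²` is positive on functions vanishing at two
points. -/
theorem IsDnProfile.exists_form_bound (h : IsDnProfile L κ η₁ η₂ Φ Φ') :
    ∃ lam x₀ : ℝ, 0 < lam ∧ 0 < x₀ ∧ x₀ < L / 2 ∧ ∀ f f' : ℝ → ℝ,
      (∀ x, HasDerivAt f (f' x) x) → Continuous f' → f (-x₀) = 0 → f x₀ = 0 → f (L - x₀) = 0 →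
      0 ≤ ∫ x in (-x₀)..(L - x₀), (f' x ^ 2 +
        (κ * (η₁ ^ 2 + η₂ ^ 2) - 6 * κ * Φ x ^ 2 - lam) * f x ^ 2) := by
  set s := η₁ ^ 2 + η₂ ^ 2 with hs
  set p := η₁ ^ 2 * η₂ ^ 2 with hp
  have hη₂ := h.η₂_pos
  have hη₁ : 0 < η₁ := hη₂.trans h.lt
  have hlt2 : η₂ ^ 2 < η₁ ^ 2 := pow_lt_pow_left₀ h.lt hη₂.le two_ne_zero
  have hdisc : 0 < s ^ 2 - 4 * p := by
    have : s ^ 2 - 4 * p = (η₁ ^ 2 - η₂ ^ 2) ^ 2 := by rw [hs, hp]; ring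
    rw [this]; have := sub_pos.2 hlt2; positivity
  have hp0 : 0 < p := by positivity
  have hs0 : 0 < s := by positivity
  set r := √(s ^ 2 - 3 * p) with hr
  have hr2 : r ^ 2 = s ^ 2 - 3 * p := Real.sq_sqrt (by linarith)
  have hr0 : 0 ≤ r := Real.sqrt_nonneg _
  -- This is the sign of the eigenvalue: for a = (s + r)/3 one has κ(6a - 3s) = κ(2r - s), and 4r² -
  -- s² = 3(s² - 4p) > 0.
  have hrs : s < 2 * r := by
    refine lt_of_pow_lt_pow_left₀ 2 (by positivity) ?_
    nlinarith
  set a := (s + r) / 3 with ha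
  have haeq : 3 * a ^ 2 - 2 * s * a + p = 0 := by rw [ha]; nlinarith
  have ha1 : η₂ ^ 2 < a := by
    have : 2 * η₂ ^ 2 < s := by rw [hs]; linarith
    rw [ha]; linarith
  have ha2 : a < η₁ ^ 2 := by
    have h1 : r < 2 * η₁ ^ 2 - η₂ ^ 2 := by
      refine lt_of_pow_lt_pow_left₀ 2 (by linarith) ?_
      rw [hr2, hs, hp]
      nlinarith [mul_pos (pow_pos hη₁ 2) (sub_pos.2 hlt2)]
    rw [ha, hs]; linarith
  obtain ⟨x₀, hx0, hxL, hin, hout⟩ := h.crossing a ha1 ha2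
  have hcont := h.continuous
  -- The crossing property gives strict inequalities on open arcs only; passing to their closures
  -- gives both inequalities at x₀, and evenness and periodicity carry the equality to the other
  -- points.
  have hz : ∀ y, (y = -x₀ ∨ y = x₀ ∨ y = L - x₀) → Φ y ^ 2 = a := by
    have hge : ∀ y ∈ closure (Ioo (-x₀) x₀), a ≤ Φ y ^ 2 := by
      intro y hy
      exact closure_minimal (fun z hz => (hin z hz).le)
        (isClosed_le continuous_const (hcont.pow 2)) hy
    have hle : ∀ y ∈ closure (Ioo x₀ (L - x₀)), Φ y ^ 2 ≤ a := by
      intro y hy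
      exact closure_minimal (fun z hz => (hout z hz).le)
        (isClosed_le (hcont.pow 2) continuous_const) hy
    rw [closure_Ioo (by linarith)] at hge hle
    have e1 : Φ x₀ ^ 2 = a := le_antisymm (hle x₀ ⟨le_rfl, by linarith⟩)
      (hge x₀ ⟨by linarith, le_rfl⟩)
    have e2 : Φ (-x₀) ^ 2 = a := by rw [h.even]; exact e1
    rintro y (rfl | rfl | rfl)
    · exact e2
    · exact e1
    · rw [sub_eq_neg_add, h.periodic]; exact e2
  -- The zeros are simple: by the energy identity Φ' can vanish only where Φ² is η₁² or η₂², and a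
  -- lies strictly between.
  have hz' : ∀ y, Φ y ^ 2 = a → 2 * Φ y * Φ' y ≠ 0 := by
    intro y hy
    have h1 := h.energy y
    rw [hy] at h1
    have h2 : Φ' y ≠ 0 := by
      intro h3
      rw [h3] at h1
      have : 0 < κ * (η₁ ^ 2 - a) * (a - η₂ ^ 2) :=
        mul_pos (mul_pos h.κ_pos (sub_pos.2 ha2)) (sub_pos.2 ha1)
      rw [← h1] at this
      simp at this
    have h3 : Φ y ≠ 0 := (hη₂.trans_le (h.le y)).ne'
    exact mul_ne_zero (mul_ne_zero two_ne_zero h3) h2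
  refine ⟨κ * (6 * a - 3 * s), x₀, mul_pos h.κ_pos (by rw [ha]; linarith), hx0, hxL, ?_⟩
  intro f f' hf hf' h1 h2 h3
  have hV : Continuous fun x => κ * s - 6 * κ * Φ x ^ 2 := by fun_prop
  have hcf : Continuous f := continuous_iff_continuousAt.2 fun x => (hf x).continuousAt
  have hI : ∀ s t, IntervalIntegrable (fun x => f' x ^ 2 +
      (κ * (η₁ ^ 2 + η₂ ^ 2) - 6 * κ * Φ x ^ 2 - κ * (6 * a - 3 * (η₁ ^ 2 + η₂ ^ 2))) * f x ^ 2)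
      volume s t := fun s t => Continuous.intervalIntegrable (by fun_prop) s t
  rw [← intervalIntegral.integral_add_adjacent_intervals (hI _ x₀) (hI x₀ _)]
  refine add_nonneg ?_ ?_
  · exact picone_between_zeros (by linarith) hf hf' (fun x => (h.eigenfunction haeq x).1)
      (fun x => (h.eigenfunction haeq x).2) hV (fun x hx => (sub_pos.2 (hin x hx)).ne')
      (sub_eq_zero.2 (hz _ (.inl rfl))) (sub_eq_zero.2 (hz _ (.inr (.inl rfl))))
      (hz' _ (hz _ (.inl rfl))) (hz' _ (hz _ (.inr (.inl rfl)))) h1 h2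
  · exact picone_between_zeros (by linarith) hf hf' (fun x => (h.eigenfunction haeq x).1)
      (fun x => (h.eigenfunction haeq x).2) hV (fun x hx => (sub_neg.2 (hout x hx)).ne)
      (sub_eq_zero.2 (hz _ (.inr (.inl rfl)))) (sub_eq_zero.2 (hz _ (.inr (.inr rfl))))
      (hz' _ (hz _ (.inr (.inl rfl)))) (hz' _ (hz _ (.inr (.inr rfl)))) h2 h3

/-- The positive eigenfunction with negative eigenvalue. -/
theorem IsDnProfile.exists_negative_eigenfunction (h : IsDnProfile L κ η₁ η₂ Φ Φ') :
    ∃ a lam : ℝ, lam < 0 ∧ (∀ x, 0 < Φ x ^ 2 - a) ∧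
      3 * a ^ 2 - 2 * (η₁ ^ 2 + η₂ ^ 2) * a + η₁ ^ 2 * η₂ ^ 2 = 0 ∧
      lam = κ * (6 * a - 3 * (η₁ ^ 2 + η₂ ^ 2)) := by
  set s := η₁ ^ 2 + η₂ ^ 2 with hs
  set p := η₁ ^ 2 * η₂ ^ 2 with hp
  have hη₂ := h.η₂_pos
  have hη₁ : 0 < η₁ := hη₂.trans h.lt
  have hlt2 : η₂ ^ 2 < η₁ ^ 2 := pow_lt_pow_left₀ h.lt hη₂.le two_ne_zero
  have hdisc : 0 < s ^ 2 - 4 * p := by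
    have : s ^ 2 - 4 * p = (η₁ ^ 2 - η₂ ^ 2) ^ 2 := by rw [hs, hp]; ring
    rw [this]; have := sub_pos.2 hlt2; positivity
  have hp0 : 0 < p := by positivity
  have hs0 : 0 < s := by positivity
  set r := √(s ^ 2 - 3 * p) with hr
  have hr2 : r ^ 2 = s ^ 2 - 3 * p := Real.sq_sqrt (by linarith)
  have hr0 : 0 ≤ r := Real.sqrt_nonneg _
  -- The smaller root lies below η₂² ≤ Φ², so the eigenfunction has no zeros; its eigenvalue is -κ(s
  -- + 2r).
  refine ⟨(s - r) / 3, κ * (6 * ((s - r) / 3) - 3 * s), ?_, fun x => ?_, by nlinarith, rfl⟩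
  · refine mul_neg_of_pos_of_neg h.κ_pos ?_
    linarith
  · have h1 : (s - r) / 3 < η₂ ^ 2 := by
      have : η₁ ^ 2 - 2 * η₂ ^ 2 < r := by
        by_contra hle
        push Not at hle
        have := pow_le_pow_left₀ hr0 hle 2
        rw [hr2, hs, hp] at this
        nlinarith [mul_pos (pow_pos hη₂ 2) (sub_pos.2 hlt2)]
      rw [hs]; linarith
    have h2 := pow_le_pow_left₀ hη₂.le (h.le x) 2
    linarith

end DnLowerBound

/-! ### Derivatives, integrals and forms on the circle -/

section CircleCalculus

variable {L : ℝ} [hL : Fact (0 < L)]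

theorem integral_haar_eq {E : Type*} [NormedAddCommGroup E] [NormedSpace ℝ E]
    (f : AddCircle L → E) (t : ℝ) :
    ∫ x, f x ∂haarAddCircle = L⁻¹ • ∫ x in t..(t + L), f (x : AddCircle L) := by
  rw [integral_haarAddCircle, AddCircle.intervalIntegral_preimage L t f]

theorem fourierCoeff_of_hasDerivAt {p r : C(AddCircle L, ℂ)}
    (h : ∀ x : ℝ, HasDerivAt (fun y : ℝ => p (y : AddCircle L)) (r (x : AddCircle L)) x) (n : ℤ) :
    fourierCoeff r n = Complex.I * waveNumber L n * fourierCoeff p n := by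
  rw [fourierCoeff_eq_intervalIntegral _ _ 0, fourierCoeff_eq_intervalIntegral _ _ 0]
  have hd : ∀ x : ℝ, HasDerivAt (fun y : ℝ => fourier (-n) (y : AddCircle L) * p (y : AddCircle L))
      (fourier (-n) (x : AddCircle L) • r (x : AddCircle L) -
        (Complex.I * waveNumber L n) * (fourier (-n) (x : AddCircle L) • p (x : AddCircle L))) x := by
    intro x
    refine ((waveNumber_deriv_fourier (L := L) (-n) x).mul (h x)).congr_deriv ?_
    rw [waveNumber_neg, smul_eq_mul, smul_eq_mul]; push_cast; ring
  have hq : Continuous fun x : ℝ => (x : AddCircle L) := AddCircle.continuous_mk' L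
  have hc1 : Continuous fun x : ℝ => fourier (-n) (x : AddCircle L) • r (x : AddCircle L) :=
    ((fourier (-n)).continuous.comp hq).smul (r.continuous.comp hq)
  have hc2 : Continuous fun x : ℝ => fourier (-n) (x : AddCircle L) • p (x : AddCircle L) :=
    ((fourier (-n)).continuous.comp hq).smul (p.continuous.comp hq)
  have hi := intervalIntegral.integral_eq_sub_of_hasDerivAt (a := 0) (b := 0 + L)
    (fun x _ => hd x) ((hc1.sub (hc2.const_mul _)).intervalIntegrable _ _)
  rw [intervalIntegral.integral_sub (hc1.intervalIntegrable _ _)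
    ((hc2.const_mul _).intervalIntegrable _ _), intervalIntegral.integral_const_mul] at hi
  have e : ((0 + L : ℝ) : AddCircle L) = ((0 : ℝ) : AddCircle L) := by simp
  rw [e, sub_self, sub_eq_zero] at hi
  rw [hi, mul_smul_comm]

theorem fourierCoeff_add' (p q : C(AddCircle L, ℂ)) (n : ℤ) :
    fourierCoeff (p + q : C(AddCircle L, ℂ)) n = fourierCoeff p n + fourierCoeff q n := by
  rw [← coeff_toLp, ← coeff_toLp, ← coeff_toLp, map_add, map_add]; rfl

theorem fourierCoeff_smul' (c : ℂ) (p : C(AddCircle L, ℂ)) (n : ℤ) :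
    fourierCoeff (c • p : C(AddCircle L, ℂ)) n = c * fourierCoeff p n := by
  rw [← coeff_toLp, ← coeff_toLp, map_smul, map_smul]; rfl

/-- A continuous function whose formal derivative is continuous is differentiable. -/
theorem hasDerivAt_of_fourierCoeff {p r : C(AddCircle L, ℂ)}
    (h : ∀ n, fourierCoeff r n = Complex.I * waveNumber L n * fourierCoeff p n) (x : ℝ) :
    HasDerivAt (fun y : ℝ => p (y : AddCircle L)) (r (x : AddCircle L)) x := by
  have hq : Continuous fun x : ℝ => (x : AddCircle L) := AddCircle.continuous_mk' L
  have hr : Continuous fun x : ℝ => r (x : AddCircle L) := r.continuous.comp hq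
  -- The zeroth coefficient of r vanishes, so this primitive is periodic. It has the same
  -- coefficients as p at every n ≠ 0, and therefore differs from p by a constant.
  let Q : ℝ → ℂ := fun x => ∫ t in (0 : ℝ)..x, r (t : AddCircle L)
  have hQ : ∀ x : ℝ, HasDerivAt Q (r (x : AddCircle L)) x := fun x =>
    intervalIntegral.integral_hasDerivAt_right (hr.intervalIntegrable _ _)
      hr.stronglyMeasurable.stronglyMeasurableAtFilter hr.continuousAt
  have hQc : Continuous Q := continuous_iff_continuousAt.2 fun x => (hQ x).continuousAt
  have h00 : ∫ t in (0 : ℝ)..(0 + L), r (t : AddCircle L) = 0 := by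
    have h1 := h 0
    rw [fourierCoeff_eq_intervalIntegral _ _ 0] at h1
    have hw : waveNumber L 0 = 0 := by simp [waveNumber]
    simp only [neg_zero, fourier_zero, one_smul, hw, Complex.ofReal_zero, mul_zero, zero_mul] at h1
    exact (smul_eq_zero.1 h1).resolve_left (one_div_ne_zero hL.out.ne')
  have hper : Function.Periodic (fun x : ℝ => r (x : AddCircle L)) L := fun x => by
    simp
  have hQp : Function.Periodic Q L := by
    intro x
    have h1 := intervalIntegral.integral_add_adjacent_intervals
      (hr.intervalIntegrable (μ := volume) 0 x) (hr.intervalIntegrable x (x + L))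
    have h2 := hper.intervalIntegral_add_eq x 0
    change ∫ t in (0 : ℝ)..(x + L), r (t : AddCircle L) = _
    rw [← h1, h2, h00, add_zero]
  let q : C(AddCircle L, ℂ) := ⟨hQp.lift, continuous_coinduced_dom.2 (by exact hQc)⟩
  have hqQ : ∀ x : ℝ, q (x : AddCircle L) = Q x := fun x => hQp.lift_coe x
  have hq' : ∀ x : ℝ, HasDerivAt (fun y : ℝ => q (y : AddCircle L)) (r (x : AddCircle L)) x := by
    intro x
    simp only [hqQ]; exact hQ x
  have hcoef := fourierCoeff_of_hasDerivAt hq'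
  have hpq : p = q + (fourierCoeff p 0 - fourierCoeff q 0) • (fourier 0 : C(AddCircle L, ℂ)) := by
    refine fourierCoeff_injective fun n => ?_
    rw [fourierCoeff_add', fourierCoeff_smul', fourierCoeff_fourier]
    by_cases hn : n = 0
    · subst hn; simp
    · have h1 := h n
      rw [hcoef n] at h1
      have hw : (waveNumber L n : ℂ) ≠ 0 := by
        have := hL.out.ne'
        have := Real.pi_ne_zero
        rw [Complex.ofReal_ne_zero]
        unfold waveNumber
        have : (n : ℝ) ≠ 0 := Int.cast_ne_zero.2 hn
        positivity
      have h2 := mul_left_cancel₀ (mul_ne_zero Complex.I_ne_zero hw) h1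
      simp [hn, h2]
  have e : (fun y : ℝ => p (y : AddCircle L)) =
      fun y : ℝ => q (y : AddCircle L) + (fourierCoeff p 0 - fourierCoeff q 0) := by
    funext y
    conv_lhs => rw [hpq]
    simp
  rw [e]
  exact (hq' x).add_const _

theorem inner_toLp (g h : C(AddCircle L, ℂ)) :
    inner ℂ (ContinuousMap.toLp 2 haarAddCircle ℂ g : L2per L)
      (ContinuousMap.toLp 2 haarAddCircle ℂ h) = ∫ x, h x * conj (g x) ∂haarAddCircle :=
  ContinuousMap.inner_toLp (𝕜 := ℂ) haarAddCircle g h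

theorem norm_sq_toLp (g : C(AddCircle L, ℂ)) :
    ‖(ContinuousMap.toLp 2 haarAddCircle ℂ g : L2per L)‖ ^ 2 = ∫ x, ‖g x‖ ^ 2 ∂haarAddCircle := by
  have h := inner_toLp g g
  rw [inner_self_eq_norm_sq_to_K] at h
  have e : ∀ x, g x * conj (g x) = ((‖g x‖ ^ 2 : ℝ) : ℂ) := fun x => by
    rw [Complex.mul_conj, Complex.normSq_eq_norm_sq]
  simp only [e, integral_complex_ofReal] at h
  exact Complex.ofReal_injective (by rw [← h, Complex.ofReal_pow]; rfl)

/-- Elements of `H²` are represented by continuously differentiable functions. -/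
theorem exists_C1_rep (f : (negLaplacian L).domain) :
    ∃ g g' : C(AddCircle L, ℂ), ContinuousMap.toLp 2 haarAddCircle ℂ g = (f : L2per L) ∧
      (∀ x : ℝ, HasDerivAt (fun y : ℝ => g (y : AddCircle L)) (g' (x : AddCircle L)) x) ∧
      inner ℂ (f : L2per L) (negLaplacian L f) = ((∫ x, ‖g' x‖ ^ 2 ∂haarAddCircle : ℝ) : ℂ) := by
  refine ⟨greenC L (negLaplacian L f + f), greenC' L (negLaplacian L f + f), ?_,
    hasDerivAt_greenC _, ?_⟩
  · rw [toLp_greenC, green_apply]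
  · rw [← norm_sq_toLp]
    push_cast
    have h1 := inner_self_eq_norm_sq_to_K (𝕜 := ℂ)
      (ContinuousMap.toLp 2 haarAddCircle ℂ (greenC' L (negLaplacian L f + f)) : L2per L)
    refine Eq.trans ?_ h1
    rw [inner_eq_tsum_coeff, inner_eq_tsum_coeff]
    refine tsum_congr fun n => ?_
    have h2 : fourierCoeff (greenC L (negLaplacian L f + f)) n =
        fourierBasis.repr (f : L2per L) n := by
      rw [← coeff_toLp, toLp_greenC, green_apply]
    rw [coeff_toLp, fourierCoeff_greenC', h2, coeff_negLaplacian]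
    simp only [map_mul, Complex.conj_I, Complex.conj_ofReal]
    push_cast
    linear_combination ((waveNumber L n : ℂ) ^ 2 * fourierBasis.repr (f : L2per L) n *
      conj (fourierBasis.repr (f : L2per L) n)) * Complex.I_mul_I

theorem inner_mulOp_toLp (V : C(AddCircle L, ℝ)) (g : C(AddCircle L, ℂ)) :
    inner ℂ (ContinuousMap.toLp 2 haarAddCircle ℂ g : L2per L)
      (mulOp V (ContinuousMap.toLp 2 haarAddCircle ℂ g)) =
      ((∫ x, V x * ‖g x‖ ^ 2 ∂haarAddCircle : ℝ) : ℂ) := by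
  rw [mulOp_eq, mulC_toLp, inner_toLp, ← integral_complex_ofReal]
  congr 1; funext x
  rw [ContinuousMap.mul_apply, mul_assoc, Complex.mul_conj, Complex.normSq_eq_norm_sq]
  change (V x : ℂ) * _ = _
  push_cast; ring

theorem integrable_circle {f : AddCircle L → ℝ} (hf : Continuous f) :
    Integrable f haarAddCircle :=
  (ContinuousMap.mk f hf).continuous.integrable_of_hasCompactSupport (.of_compactSpace f)

end CircleCalculus

/-! ### Profiles read on the line -/

section

variable {L : ℝ}

theorem continuous_coe_circle (g : C(AddCircle L, ℂ)) :
    Continuous fun x : ℝ => g (x : AddCircle L) :=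
  g.continuous.comp (AddCircle.continuous_mk' L)

theorem continuous_coe_circle_real (g : C(AddCircle L, ℝ)) :
    Continuous fun x : ℝ => g (x : AddCircle L) :=
  g.continuous.comp (AddCircle.continuous_mk' L)

theorem cplx_mul (g h : C(AddCircle L, ℝ)) : cplx (g * h) = cplx g * cplx h := by
  ext x; simp [cplx]

end

/-! ### Schrödinger operators with a positive null solution -/

section GroundState

variable {L : ℝ} [hL : Fact (0 < L)]

theorem HasDerivAt.complex_re {g : ℝ → ℂ} {g' : ℂ} {x : ℝ} (h : HasDerivAt g g' x) :
    HasDerivAt (fun y => (g y).re) g'.re x :=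
  Complex.reCLM.hasFDerivAt.comp_hasDerivAt x h

theorem HasDerivAt.complex_im {g : ℝ → ℂ} {g' : ℂ} {x : ℝ} (h : HasDerivAt g g' x) :
    HasDerivAt (fun y => (g y).im) g'.im x :=
  Complex.imCLM.hasFDerivAt.comp_hasDerivAt x h

theorem toL2_eq (g : C(AddCircle L, ℝ)) :
    toL2 g = ContinuousMap.toLp 2 haarAddCircle ℂ (cplx g) := rfl

theorem mulOp_toL2 (g h : C(AddCircle L, ℝ)) : mulOp g (toL2 h) = toL2 (g * h) := by
  rw [mulOp_eq, toL2_eq, mulC_toLp, toL2_eq, cplx_mul]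

/-- Weak solutions of `u'' = V u` in `H²` are classical solutions. -/
theorem exists_classical_solution {V u : C(AddCircle L, ℝ)}
    (hu : toL2 u ∈ (negLaplacian L).domain) (e : negLaplacian L ⟨toL2 u, hu⟩ = -mulOp V (toL2 u)) :
    ∃ u' : C(AddCircle L, ℝ),
      (∀ x : ℝ, HasDerivAt (fun y : ℝ => u (y : AddCircle L)) (u' (x : AddCircle L)) x) ∧
      ∀ x : ℝ, HasDerivAt (fun y : ℝ => u' (y : AddCircle L))
        (V (x : AddCircle L) * u (x : AddCircle L)) x := by
  set v := negLaplacian L ⟨toL2 u, hu⟩ + toL2 u with hv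
  have h1 : greenC L v = cplx u := toLp_injective (by
    rw [toLp_greenC]; exact green_apply ⟨toL2 u, hu⟩)
  have h2 : ∀ n, fourierCoeff (cplx (V * u)) n =
      Complex.I * waveNumber L n * fourierCoeff (greenC' L v) n := by
    intro n
    have h3 := coeff_negLaplacian ⟨toL2 u, hu⟩ n
    rw [e, mulOp_toL2, map_neg, lp.coeFn_neg, Pi.neg_apply, toL2_eq, coeff_toLp] at h3
    simp only [toL2_eq, coeff_toLp] at h3
    rw [fourierCoeff_greenC', h1]
    push_cast at h3
    linear_combination -h3 - (waveNumber L n : ℂ) ^ 2 * fourierCoeff (cplx u) n * Complex.I_mul_I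
  refine ⟨⟨fun x => (greenC' L v x).re, by fun_prop⟩, fun x => ?_, fun x => ?_⟩
  · have := (hasDerivAt_greenC v x).complex_re
    rw [h1] at this
    exact this
  · have := (hasDerivAt_of_fourierCoeff h2 x).complex_re
    simpa [cplx] using this

theorem form_mulOp (V : C(AddCircle L, ℝ)) (f : (perturbed (mulOp V)).domain) :
    ∃ g g' : C(AddCircle L, ℂ), ContinuousMap.toLp 2 haarAddCircle ℂ g = (f : L2per L) ∧
      (∀ x : ℝ, HasDerivAt (fun y : ℝ => g (y : AddCircle L)) (g' (x : AddCircle L)) x) ∧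
      inner ℂ (f : L2per L) (perturbed (mulOp V) f) =
        ((∫ x, (‖g' x‖ ^ 2 + V x * ‖g x‖ ^ 2) ∂haarAddCircle : ℝ) : ℂ) := by
  obtain ⟨f, hf⟩ := f
  obtain ⟨g, g', h1, h2, h3⟩ := exists_C1_rep ⟨f, mem_negLaplacian_domain hf⟩
  refine ⟨g, g', h1, h2, ?_⟩
  simp only at h1 h3
  rw [perturbed_apply, inner_add_right, h3, integral_add, Complex.ofReal_add, add_comm]
  · have h6 := inner_mulOp_toLp V g
    rw [h1] at h6
    exact congrArg _ h6
  · exact integrable_circle (by fun_prop)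
  · exact integrable_circle (by fun_prop)

/-- Jacobi's factorization of the form by a positive solution. -/
theorem form_eq_of_positive_solution {V u u' : C(AddCircle L, ℝ)} (hpos : ∀ x, 0 < u x)
    (hu : ∀ x : ℝ, HasDerivAt (fun y : ℝ => u (y : AddCircle L)) (u' (x : AddCircle L)) x)
    (hu' : ∀ x : ℝ, HasDerivAt (fun y : ℝ => u' (y : AddCircle L))
      (V (x : AddCircle L) * u (x : AddCircle L)) x)
    {g g' : C(AddCircle L, ℂ)}
    (hg : ∀ x : ℝ, HasDerivAt (fun y : ℝ => g (y : AddCircle L)) (g' (x : AddCircle L)) x) :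
    ∫ x, (‖g' x‖ ^ 2 + V x * ‖g x‖ ^ 2) ∂haarAddCircle =
      ∫ x, ‖g' x - ((u' x / u x : ℝ) : ℂ) * g x‖ ^ 2 ∂haarAddCircle := by
  rw [integral_haar_eq _ 0, integral_haar_eq _ 0]
  congr 1
  rw [zero_add]
  have hcV := continuous_coe_circle_real V
  have hcg := continuous_coe_circle g
  have hcg' := continuous_coe_circle g'
  have hcu := continuous_coe_circle_real u
  have hcu' := continuous_coe_circle_real u'
  have hu'' : ∀ x : ℝ, HasDerivAt (fun y : ℝ => u' (y : AddCircle L))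
      ((V (x : AddCircle L) - 0) * u (x : AddCircle L)) x := by simpa using hu'
  have e0 : ((L : ℝ) : AddCircle L) = ((0 : ℝ) : AddCircle L) := by simp
  have h1 := picone_integral_le (s := 0) (t := L) hL.out.le (fun x => (hg x).complex_re)
    (by fun_prop) hu hu'' hcV (fun x _ => (hpos _).ne')
  have h2 := picone_integral_le (s := 0) (t := L) hL.out.le (fun x => (hg x).complex_im)
    (by fun_prop) hu hu'' hcV (fun x _ => (hpos _).ne')
  -- Over a full period the two boundary terms coincide, and V - 0 plays the role of potential minus
  -- eigenvalue.
  rw [e0, sub_self, sub_zero] at h1 h2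
  have hdiv : Continuous fun x : ℝ => u' (x : AddCircle L) / u (x : AddCircle L) :=
    hcu'.div hcu fun x => (hpos _).ne'
  have e1 : ∀ x : ℝ, ‖g' (x : AddCircle L)‖ ^ 2 + V (x : AddCircle L) * ‖g (x : AddCircle L)‖ ^ 2 =
      ((g' (x : AddCircle L)).re ^ 2 + (V (x : AddCircle L) - 0) * (g (x : AddCircle L)).re ^ 2) +
      ((g' (x : AddCircle L)).im ^ 2 + (V (x : AddCircle L) - 0) * (g (x : AddCircle L)).im ^ 2) := by
    intro x
    rw [← Complex.normSq_eq_norm_sq, ← Complex.normSq_eq_norm_sq, Complex.normSq_apply,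
      Complex.normSq_apply]
    ring
  have e2 : ∀ x : ℝ, ‖g' (x : AddCircle L) -
      ((u' (x : AddCircle L) / u (x : AddCircle L) : ℝ) : ℂ) * g (x : AddCircle L)‖ ^ 2 =
      ((g' (x : AddCircle L)).re - u' (x : AddCircle L) / u (x : AddCircle L) *
        (g (x : AddCircle L)).re) ^ 2 +
      ((g' (x : AddCircle L)).im - u' (x : AddCircle L) / u (x : AddCircle L) *
        (g (x : AddCircle L)).im) ^ 2 := by
    intro x
    rw [← Complex.normSq_eq_norm_sq, Complex.normSq_apply]
    simp only [Complex.sub_re, Complex.sub_im, Complex.re_ofReal_mul, Complex.im_ofReal_mul]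
    ring
  simp only [e1, e2]
  have h3 := congrArg₂ (· + ·) h1 h2
  beta_reduce at h3
  rw [← intervalIntegral.integral_add (Continuous.intervalIntegrable (by fun_prop) _ _)
    (Continuous.intervalIntegrable (by fun_prop) _ _),
    ← intervalIntegral.integral_add (Continuous.intervalIntegrable (by fun_prop) _ _)
    (Continuous.intervalIntegrable (by fun_prop) _ _)] at h3
  exact h3.symm

variable {V u : C(AddCircle L, ℝ)}

theorem form_nonneg_of_positive_solution (hpos : ∀ x, 0 < u x)
    (hu : toL2 u ∈ (negLaplacian L).domain) (e : negLaplacian L ⟨toL2 u, hu⟩ = -mulOp V (toL2 u))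
    (f : (perturbed (mulOp V)).domain) :
    0 ≤ (inner ℂ (f : L2per L) (perturbed (mulOp V) f)).re := by
  obtain ⟨u', h1, h2⟩ := exists_classical_solution hu e
  obtain ⟨g, g', -, h4, h5⟩ := form_mulOp V f
  rw [h5, Complex.ofReal_re, form_eq_of_positive_solution hpos h1 h2 h4]
  exact integral_nonneg fun x => sq_nonneg _

/-- A null vector makes the factorized form vanish, so g' = (u'/u) g everywhere. Then (g/u)' = 0,
and g is a multiple of u. -/
theorem isSimpleEigenpair_of_positive_solution (hpos : ∀ x, 0 < u x)
    (hu : toL2 u ∈ (negLaplacian L).domain)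
    (e : negLaplacian L ⟨toL2 u, hu⟩ = -mulOp V (toL2 u)) :
    IsSimpleEigenpair (perturbed (mulOp V)) 0 (toL2 u) := by
  obtain ⟨u', h1, h2⟩ := exists_classical_solution hu e
  refine ⟨fun h0 => ?_, le_antisymm ?_ ?_⟩
  · have h3 : cplx u = 0 := toLp_injective (by rw [← toL2_eq, h0, map_zero])
    have h4 := DFunLike.congr_fun h3 0
    have h5 : (u 0 : ℂ) = 0 := h4
    exact (hpos 0).ne' (Complex.ofReal_eq_zero.1 h5)
  · rintro f ⟨hf, ef⟩
    obtain ⟨g, g', h3, h4, h5⟩ := form_mulOp V ⟨f, hf⟩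
    simp only at h3
    rw [ef, zero_smul, inner_zero_right, form_eq_of_positive_solution hpos h1 h2 h4] at h5
    have h6 : ∫ x, ‖g' x - ((u' x / u x : ℝ) : ℂ) * g x‖ ^ 2 ∂haarAddCircle = 0 :=
      (Complex.ofReal_eq_zero.1 h5.symm)
    have hdiv : Continuous fun x => u' x / u x := u'.continuous.div u.continuous
      fun x => (hpos x).ne'
    have hcont : Continuous fun x => ‖g' x - ((u' x / u x : ℝ) : ℂ) * g x‖ ^ 2 := by fun_prop
    have h7 := (integral_eq_zero_iff_of_nonneg (fun x => sq_nonneg _)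
      (integrable_circle hcont)).1 h6
    have h8 := (Continuous.ae_eq_iff_eq haarAddCircle hcont continuous_const).1 h7
    have h9 : ∀ x, g' x = ((u' x / u x : ℝ) : ℂ) * g x := by
      intro x
      have := congrFun h8 x
      exact sub_eq_zero.1 (norm_eq_zero.1 (pow_eq_zero_iff two_ne_zero |>.1 this))
    have hune : ∀ x, (u x : ℂ) ≠ 0 := fun x => Complex.ofReal_ne_zero.2 (hpos x).ne'
    have hd : ∀ x : ℝ, HasDerivAt (fun y : ℝ => g (y : AddCircle L) / (u (y : AddCircle L) : ℂ))
        0 x := by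
      intro x
      refine ((h4 x).div (h1 x).ofReal_comp (hune _)).congr_deriv ?_
      rw [h9]
      have := hune (x : AddCircle L)
      push_cast
      field_simp
      ring
    have hc := is_const_of_deriv_eq_zero (fun x => (hd x).differentiableAt) fun x => (hd x).deriv
    rw [Submodule.mem_span_singleton]
    refine ⟨g 0 / u 0, ?_⟩
    rw [← h3, toL2_eq, ← map_smul]
    congr 1
    ext x
    induction x using QuotientAddGroup.induction_on with
    | H x =>
      have := hc x 0
      rw [div_eq_iff (hune _)] at this
      exact this.symm
  · rw [Submodule.span_singleton_le_iff_mem]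
    refine ⟨mem_perturbed_domain hu, ?_⟩
    rw [perturbed_apply, zero_smul]
    change mulOp V (toL2 u) + negLaplacian L ⟨toL2 u, hu⟩ = 0
    rw [e, add_neg_cancel]

end GroundState

/-! ### Form bounds in codimension two and counting of eigenvalues -/

section CodimTwo

variable {L : ℝ} [hL : Fact (0 < L)]

/-- The form of `-d²/dx² + B` is bounded below by `μ` on a subspace of codimension at most two. -/
def FormBound (B : L2per L →L[ℂ] L2per L) (μ : ℝ) : Prop :=
  ∃ e : L2per L × L2per L →ₗ[ℂ] (Fin 2 → ℂ), ∀ f w, (f, w) ∈ (perturbed B).graph →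
    e (f, w) = 0 → μ * ‖f‖ ^ 2 ≤ (inner ℂ f w).re

variable {B B' : L2per L →L[ℂ] L2per L} {μ : ℝ}

theorem mem_graph_perturbed {f w : L2per L} : (f, w) ∈ (perturbed B).graph ↔
    ∃ h : f ∈ (negLaplacian L).domain, negLaplacian L ⟨f, h⟩ = w - B f := by
  rw [LinearPMap.mem_graph_iff]
  constructor
  · rintro ⟨⟨y, hy⟩, rfl, h2⟩
    refine ⟨mem_negLaplacian_domain hy, ?_⟩
    simp only at h2
    rw [← h2, perturbed_apply, add_sub_cancel_left]
  · rintro ⟨h, e⟩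
    refine ⟨⟨f, mem_perturbed_domain h⟩, rfl, ?_⟩
    rw [perturbed_apply]
    simp only
    rw [e, add_sub_cancel]

/-- All these operators share the domain H², so changing the bounded part only shears the graph. -/
theorem mem_graph_of_mem_graph {f w : L2per L} (h : (f, w) ∈ (perturbed B).graph) :
    (f, w - B f + B' f) ∈ (perturbed B').graph := by
  rw [mem_graph_perturbed] at h ⊢
  simpa using h

theorem mem_opEigenspace_iff {f : L2per L} {z : ℂ} :
    f ∈ opEigenspace (perturbed B) z ↔ (f, z • f) ∈ (perturbed B).graph := by
  rw [LinearPMap.mem_graph_iff]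
  constructor
  · rintro ⟨h, e⟩
    exact ⟨⟨f, h⟩, rfl, e⟩
  · rintro ⟨⟨y, hy⟩, h1, h2⟩
    simp only at h1 h2
    subst h1
    exact ⟨hy, h2⟩

/-- Only a one-sided comparison of the quadratic forms is required, not closeness of B and B'. The
two linear conditions are pulled back along the shear that identifies the graphs. -/
theorem FormBound.mono {ε : ℝ} (h : FormBound B μ)
    (hB : ∀ f, (inner ℂ f (B f)).re - ε * ‖f‖ ^ 2 ≤ (inner ℂ f (B' f)).re) :
    FormBound B' (μ - ε) := by
  obtain ⟨e, he⟩ := h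
  let S : L2per L × L2per L →ₗ[ℂ] L2per L × L2per L :=
    LinearMap.prod (LinearMap.fst ℂ _ _) (LinearMap.snd ℂ _ _ -
      (B' : L2per L →ₗ[ℂ] L2per L) ∘ₗ LinearMap.fst ℂ _ _ +
      (B : L2per L →ₗ[ℂ] L2per L) ∘ₗ LinearMap.fst ℂ _ _)
  refine ⟨e ∘ₗ S, fun f w hfw h0 => ?_⟩
  have h1 := he f (w - B' f + B f) (mem_graph_of_mem_graph hfw) h0
  rw [inner_add_right, inner_sub_right, Complex.add_re, Complex.sub_re] at h1
  have := hB f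
  linarith

/-- Two linear conditions have a nonzero common solution in a space of three coefficients. There the
form is at least μ‖·‖² and at most η‖·‖², so the corresponding vector is 0. -/
theorem not_linearIndependent_of_formBound (h : FormBound B μ) {η : ℝ} (hη : η < μ)
    {F W : Fin 3 → L2per L} (hF : ∀ i, (F i, W i) ∈ (perturbed B).graph)
    (hform : ∀ c : Fin 3 → ℂ, (inner ℂ (∑ i, c i • F i) (∑ i, c i • W i)).re ≤
      η * ‖∑ i, c i • F i‖ ^ 2) : ¬ LinearIndependent ℂ F := by
  intro hli
  obtain ⟨e, he⟩ := h
  let T : (Fin 3 → ℂ) →ₗ[ℂ] (Fin 2 → ℂ) :=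
    e ∘ₗ Fintype.linearCombination ℂ (fun i => (F i, W i))
  have hker : LinearMap.ker T ≠ ⊥ := LinearMap.ker_ne_bot_of_finrank_lt (by simp)
  obtain ⟨c, hc, hc0⟩ := (Submodule.ne_bot_iff _).1 hker
  have hsum : Fintype.linearCombination ℂ (fun i => (F i, W i)) c =
      (∑ i, c i • F i, ∑ i, c i • W i) := by
    rw [Fintype.linearCombination_apply]
    ext1
    · rw [Prod.fst_sum]; rfl
    · rw [Prod.snd_sum]; rfl
  have h1 : (∑ i, c i • F i, ∑ i, c i • W i) ∈ (perturbed B).graph := by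
    rw [← hsum, Fintype.linearCombination_apply]
    exact Submodule.sum_mem _ fun i _ => Submodule.smul_mem _ _ (hF i)
  have h2 := he _ _ h1 (by rw [← hsum]; exact hc)
  have h3 := hform c
  have h4 : ‖∑ i, c i • F i‖ ^ 2 ≤ 0 := by nlinarith
  have h5 : ∑ i, c i • F i = 0 := by
    rw [← norm_eq_zero]
    nlinarith [norm_nonneg (∑ i, c i • F i)]
  exact hc0 (funext fun i => Fintype.linearIndependent_iff.1 hli c h5 i)

/-- At most two eigenvalues, counted with multiplicity, lie below `μ`. -/
theorem FormBound.false_of_three_eigenvectors (h : FormBound B μ) {η : ℝ} (hη : η < μ)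
    {f₁ f₂ f₃ : L2per L} {r₁ r₂ r₃ : ℝ}
    (h₁ : f₁ ∈ opEigenspace (perturbed B) r₁) (h₂ : f₂ ∈ opEigenspace (perturbed B) r₂)
    (h₃ : f₃ ∈ opEigenspace (perturbed B) r₃) (n₁ : f₁ ≠ 0) (n₂ : f₂ ≠ 0) (n₃ : f₃ ≠ 0)
    (h12 : inner ℂ f₁ f₂ = 0) (h13 : inner ℂ f₁ f₃ = 0) (h23 : inner ℂ f₂ f₃ = 0)
    (l₁ : r₁ ≤ η) (l₂ : r₂ ≤ η) (l₃ : r₃ ≤ η) : False := by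
  have h21 := inner_eq_zero_symm.1 h12
  have h31 := inner_eq_zero_symm.1 h13
  have h32 := inner_eq_zero_symm.1 h23
  refine not_linearIndependent_of_formBound h hη (F := ![f₁, f₂, f₃])
    (W := ![(r₁ : ℂ) • f₁, (r₂ : ℂ) • f₂, (r₃ : ℂ) • f₃]) ?_ ?_ ?_
  · intro i
    fin_cases i
    · exact mem_opEigenspace_iff.1 h₁
    · exact mem_opEigenspace_iff.1 h₂
    · exact mem_opEigenspace_iff.1 h₃
  · intro c
    have hn : ∀ f : L2per L, inner ℂ f f = ((‖f‖ ^ 2 : ℝ) : ℂ) := fun f => by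
      rw [inner_self_eq_norm_sq_to_K]; norm_cast
    have e1 : (inner ℂ (∑ i, c i • ![f₁, f₂, f₃] i)
        (∑ i, c i • ![(r₁ : ℂ) • f₁, (r₂ : ℂ) • f₂, (r₃ : ℂ) • f₃] i)) =
        ((r₁ * (Complex.normSq (c 0) * ‖f₁‖ ^ 2) + r₂ * (Complex.normSq (c 1) * ‖f₂‖ ^ 2) +
          r₃ * (Complex.normSq (c 2) * ‖f₃‖ ^ 2) : ℝ) : ℂ) := by
      simp only [Fin.sum_univ_three, Matrix.cons_val_zero, Matrix.cons_val_one, Matrix.cons_val,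
        inner_add_left, inner_add_right, inner_smul_left, inner_smul_right, h12, h13, h23, h21,
        h31, h32, hn]
      push_cast [Complex.normSq_eq_conj_mul_self]
      ring
    have e2 : ‖∑ i, c i • ![f₁, f₂, f₃] i‖ ^ 2 = Complex.normSq (c 0) * ‖f₁‖ ^ 2 +
        Complex.normSq (c 1) * ‖f₂‖ ^ 2 + Complex.normSq (c 2) * ‖f₃‖ ^ 2 := by
      have := hn (∑ i, c i • ![f₁, f₂, f₃] i)
      refine Complex.ofReal_injective (this.symm.trans ?_)
      simp only [Fin.sum_univ_three, Matrix.cons_val_zero, Matrix.cons_val_one, Matrix.cons_val]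
      simp only [inner_add_left, inner_add_right, inner_smul_left, inner_smul_right, h12, h13, h23,
        h21, h31, h32]
      simp only [hn]
      push_cast [Complex.normSq_eq_conj_mul_self]
      ring
    rw [e1, e2, Complex.ofReal_re]
    have p1 := mul_nonneg (Complex.normSq_nonneg (c 0)) (sq_nonneg ‖f₁‖)
    have p2 := mul_nonneg (Complex.normSq_nonneg (c 1)) (sq_nonneg ‖f₂‖)
    have p3 := mul_nonneg (Complex.normSq_nonneg (c 2)) (sq_nonneg ‖f₃‖)
    have q1 := mul_le_mul_of_nonneg_right l₁ p1
    have q2 := mul_le_mul_of_nonneg_right l₂ p2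
    have q3 := mul_le_mul_of_nonneg_right l₃ p3
    linarith
  · refine linearIndependent_of_ne_zero_of_inner_eq_zero (𝕜 := ℂ) ?_ ?_
    · intro i; fin_cases i <;> assumption
    · intro i j hij
      fin_cases i <;> fin_cases j <;> first | exact absurd rfl hij | assumption

theorem isSimpleEigenpair_of_orthogonal {z : ℂ} {χ : L2per L}
    (hχ : χ ∈ opEigenspace (perturbed B) z) (h0 : χ ≠ 0)
    (h : ∀ f ∈ opEigenspace (perturbed B) z, inner ℂ χ f = 0 → f = 0) :
    IsSimpleEigenpair (perturbed B) z χ := by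
  refine ⟨h0, le_antisymm (fun f hf => ?_) ((Submodule.span_singleton_le_iff_mem _ _).2 hχ)⟩
  rw [Submodule.mem_span_singleton]
  refine ⟨inner ℂ χ f / inner ℂ χ χ, ?_⟩
  have h1 := h (f - (inner ℂ χ f / inner ℂ χ χ) • χ)
    (Submodule.sub_mem _ hf (Submodule.smul_mem _ _ hχ)) (by
      rw [inner_sub_right, inner_smul_right, div_mul_cancel₀ _ (inner_self_ne_zero.2 h0), sub_self])
  exact (sub_eq_zero.1 h1).symm

/-- If the form is positive in codimension two, `0` is an eigenvalue and the form takes a negative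
value, then there is exactly one negative eigenvalue, and it and `0` are simple. -/
theorem FormBound.spectrum (hB : ∀ x y, inner ℂ (B x) y = inner ℂ x (B y)) (hμ : 0 < μ)
    (h : FormBound B μ) {p : L2per L} (hp : (p, 0) ∈ (perturbed B).graph) (hp0 : p ≠ 0)
    {q w : L2per L} (hq : (q, w) ∈ (perturbed B).graph) (hqw : (inner ℂ q w).re < 0) :
    ∃ lam : ℝ, lam < 0 ∧ ∃ χ, IsSimpleEigenpair (perturbed B) lam χ ∧
      IsSimpleEigenpair (perturbed B) 0 p ∧
      (∀ z ∈ opSpectrum (perturbed B), z ≠ lam → z ≠ 0 → ∃ r : ℝ, μ / 2 < r ∧ z = r) ∧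
      ∀ f w, (f, w) ∈ (perturbed B).graph → inner ℂ χ f = 0 → 0 ≤ (inner ℂ f w).re := by
  have hp' : p ∈ opEigenspace (perturbed B) ((0 : ℝ) : ℂ) := by
    rw [mem_opEigenspace_iff]; simpa using hp
  have hneg : ∃ lam : ℝ, lam < 0 ∧ opEigenspace (perturbed B) lam ≠ ⊥ := by
    obtain ⟨y, hy1, hy2⟩ := LinearPMap.mem_graph_iff _ |>.1 hq
    refine exists_negative_eigenvalue hB y ?_
    rw [hy2, hy1]; exact hqw
  obtain ⟨lam, hlam, hne⟩ := hneg
  obtain ⟨χ, hχ, hχ0⟩ := (Submodule.ne_bot_iff _).1 hne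
  have hχp : inner ℂ χ p = 0 := inner_eigenvectors_eq_zero hB hχ hp' (by
    exact_mod_cast hlam.ne)
  refine ⟨lam, hlam, χ, ?_, ?_, ?_, ?_⟩
  · refine isSimpleEigenpair_of_orthogonal hχ hχ0 fun f hf hχf => ?_
    by_contra hf0
    have hfp : inner ℂ f p = 0 := inner_eigenvectors_eq_zero hB hf hp' (by exact_mod_cast hlam.ne)
    exact h.false_of_three_eigenvectors hμ hχ hf hp' hχ0 hf0 hp0 hχf hχp hfp hlam.le hlam.le le_rfl
  · rw [← Complex.ofReal_zero]
    refine isSimpleEigenpair_of_orthogonal hp' hp0 fun f hf hpf => ?_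
    by_contra hf0
    have hχf : inner ℂ χ f = 0 := inner_eigenvectors_eq_zero hB hχ hf (by exact_mod_cast hlam.ne)
    exact h.false_of_three_eigenvectors hμ hχ hp' hf hχ0 hp0 hf0 hχp hχf hpf hlam.le le_rfl le_rfl
  · intro z hz hz1 hz0
    obtain ⟨f, hf, hf0⟩ := (Submodule.ne_bot_iff _).1 (exists_eigenvector_of_mem_opSpectrum hz)
    obtain ⟨r, rfl⟩ := exists_real_of_eigenvalue hB hf hf0
    refine ⟨r, ?_, rfl⟩
    by_contra hle
    push Not at hle
    have hχf : inner ℂ χ f = 0 := inner_eigenvectors_eq_zero hB hχ hf hz1.symm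
    have hpf : inner ℂ p f = 0 := inner_eigenvectors_eq_zero hB hp' hf (by simpa using hz0.symm)
    exact h.false_of_three_eigenvectors (half_lt_self hμ) hχ hp' hf hχ0 hp0 hf0 hχp hχf hpf
      (by linarith) (by linarith) hle
  · intro f w hfw hχf
    by_contra hlt
    push Not at hlt
    have hsym : ∀ {f g w v : L2per L}, (f, w) ∈ (perturbed B).graph → (g, v) ∈ (perturbed B).graph →
        inner ℂ w g = inner ℂ f v := by
      intro f g w v h1 h2
      obtain ⟨y, rfl, rfl⟩ := LinearPMap.mem_graph_iff _ |>.1 h1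
      obtain ⟨y', rfl, rfl⟩ := LinearPMap.mem_graph_iff _ |>.1 h2
      exact inner_perturbed hB y y'
    have hχg := mem_opEigenspace_iff.1 hχ
    have e1 : inner ℂ χ w = 0 := by
      rw [← hsym hχg hfw, inner_smul_left, hχf, mul_zero]
    have e2 : inner ℂ f χ = 0 := inner_eq_zero_symm.1 hχf
    have e3 : inner ℂ p w = 0 := by rw [← hsym hp hfw, inner_zero_left]
    have e4 : inner ℂ p χ = 0 := inner_eq_zero_symm.1 hχp
    -- The form is diagonal on the span of χ, f and p, because χ is an eigenvector orthogonal to f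
    -- and p is a null vector. If it were negative at f, it would be non-positive on a
    -- three-dimensional space.
    have hform : ∀ c : Fin 3 → ℂ, (inner ℂ (∑ i, c i • ![χ, f, p] i)
        (∑ i, c i • ![(lam : ℂ) • χ, w, 0] i)).re =
        lam * (Complex.normSq (c 0) * ‖χ‖ ^ 2) + Complex.normSq (c 1) * (inner ℂ f w).re := by
      intro c
      have hn : inner ℂ χ χ = ((‖χ‖ ^ 2 : ℝ) : ℂ) := by
        rw [inner_self_eq_norm_sq_to_K]; norm_cast
      have e5 : inner ℂ (∑ i, c i • ![χ, f, p] i) (∑ i, c i • ![(lam : ℂ) • χ, w, 0] i) =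
          ((lam * (Complex.normSq (c 0) * ‖χ‖ ^ 2) : ℝ) : ℂ) +
            ((Complex.normSq (c 1) : ℝ) : ℂ) * inner ℂ f w := by
        simp only [Fin.sum_univ_three, Matrix.cons_val_zero, Matrix.cons_val_one, Matrix.cons_val,
          inner_add_left, inner_add_right, inner_smul_left, inner_smul_right, e1, e2, e3, e4, hn,
          inner_zero_right]
        push_cast [Complex.normSq_eq_conj_mul_self]
        ring
      rw [e5, Complex.add_re, Complex.ofReal_re, Complex.re_ofReal_mul]
    refine not_linearIndependent_of_formBound h hμ (F := ![χ, f, p])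
      (W := ![(lam : ℂ) • χ, w, 0]) ?_ ?_ ?_
    · intro i
      fin_cases i
      · exact hχg
      · exact hfw
      · exact hp
    · intro c
      rw [hform, zero_mul]
      have p1 := mul_nonneg (Complex.normSq_nonneg (c 0)) (sq_nonneg ‖χ‖)
      have p2 := Complex.normSq_nonneg (c 1)
      nlinarith
    -- The vectors f and p need not be orthogonal, so independence is read off from the form: on a
    -- vanishing combination it is 0, which kills the coefficients of χ and f, and then that of p.
    · rw [Fintype.linearIndependent_iff]
      intro c hc
      have h1 := hform c
      rw [hc, inner_zero_left, Complex.zero_re] at h1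
      have p0 := mul_nonneg (Complex.normSq_nonneg (c 0)) (sq_nonneg ‖χ‖)
      have p1 := mul_nonneg_of_nonpos_of_nonpos hlam.le (neg_nonpos.2 p0)
      have p2 := mul_nonneg (Complex.normSq_nonneg (c 1)) (neg_nonneg.2 hlt.le)
      have q1 : Complex.normSq (c 0) * ‖χ‖ ^ 2 = 0 := by
        have : lam * (Complex.normSq (c 0) * ‖χ‖ ^ 2) = 0 := by linarith
        exact (mul_eq_zero.1 this).resolve_left hlam.ne
      have q2 : Complex.normSq (c 1) = 0 := by
        have : Complex.normSq (c 1) * (inner ℂ f w).re = 0 := by linarith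
        exact (mul_eq_zero.1 this).resolve_right hlt.ne
      have c0 : c 0 = 0 := Complex.normSq_eq_zero.1 ((mul_eq_zero.1 q1).resolve_right
        (pow_ne_zero 2 (norm_ne_zero_iff.2 hχ0)))
      have c1 : c 1 = 0 := Complex.normSq_eq_zero.1 q2
      have c2 : c 2 = 0 := by
        simp [Fin.sum_univ_three, c0, c1] at hc
        exact hc.resolve_right hp0
      intro i
      fin_cases i
      · exact c0
      · exact c1
      · exact c2

end CodimTwo

/-! ### The multiplier 𝓚_γ⁻¹: strong continuity and form bounds -/

section Symbols

variable (L : ℝ) {c : ℝ} (hc : 0 < c)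

/-- The symbol of `𝓚_γ⁻¹` as a bounded sequence, extended by its value at `0` to `γ > 0`. -/
def kSymbol (γ : ℝ) : lp (fun _ : ℤ => ℂ) ∞ :=
  bddSymbol (kInvSymbol L (min γ 0) c) c⁻¹ (norm_kInvSymbol_le L (min_le_right _ _) hc)

/-- The value `(-γ|ω| + c)⁻¹` of the symbol. -/
def kReal (c γ : ℝ) (n : ℤ) : ℝ := (-(min γ 0) * |waveNumber L n| + c)⁻¹

variable {L}

theorem coeff_kSymbol [Fact (0 < L)] (γ : ℝ) (f : L2per L) (n : ℤ) :
    fourierBasis.repr (fmul (kSymbol L hc γ) f) n = (kReal L c γ n : ℂ) * fourierBasis.repr f n :=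
  coeff_fmul _ _ _

theorem le_kReal_inv (c γ : ℝ) (n : ℤ) :
    c ≤ -(min γ 0) * |waveNumber L n| + c := by
  have := mul_nonneg (neg_nonneg.2 (min_le_right γ 0)) (abs_nonneg (waveNumber L n))
  linarith

theorem kReal_pos (hc : 0 < c) (γ : ℝ) (n : ℤ) : 0 < kReal L c γ n :=
  inv_pos.2 (hc.trans_le (le_kReal_inv c γ n))

theorem kReal_le (hc : 0 < c) (γ : ℝ) (n : ℤ) : kReal L c γ n ≤ c⁻¹ := inv_anti₀ hc (le_kReal_inv c γ n)

theorem kReal_zero (c : ℝ) (n : ℤ) : kReal L c 0 n = c⁻¹ := by simp [kReal]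

theorem tendsto_kReal (hc : 0 < c) (n : ℤ) : Tendsto (fun γ => kReal L c γ n) (𝓝 0) (𝓝 c⁻¹) := by
  have h : ContinuousAt (fun γ => kReal L c γ n) 0 := by
    unfold kReal
    refine ContinuousAt.inv₀ (by fun_prop) ?_
    simpa using hc.ne'
  have := h.tendsto
  rwa [kReal_zero] at this

variable [hL : Fact (0 < L)]

theorem fmul_kSymbol_zero (f : L2per L) : fmul (kSymbol L hc 0) f = ((c⁻¹ : ℝ) : ℂ) • f := by
  refine coeff_ext fun n => ?_
  rw [coeff_kSymbol, kReal_zero, map_smul, lp.coeFn_smul, Pi.smul_apply, smul_eq_mul]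

theorem norm_fmul_kSymbol_le (γ : ℝ) (f : L2per L) :
    ‖fmul (kSymbol L hc γ) f‖ ≤ c⁻¹ * ‖f‖ :=
  ((fmul (kSymbol L hc γ)).le_opNorm f).trans (mul_le_mul_of_nonneg_right
    ((norm_fmul_le _).trans (norm_bddSymbol_le _)) (norm_nonneg _))

theorem hasSum_norm_sq_coeff (f : L2per L) :
    HasSum (fun n => ‖fourierBasis.repr f n‖ ^ 2) (‖f‖ ^ 2) := by
  have h := lp.hasSum_norm (p := 2) (by norm_num) (fourierBasis.repr f)
  rw [LinearIsometryEquiv.norm_map] at h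
  simpa using h

/-- Only strong convergence holds: for γ < 0 the symbol tends to 0 at infinity and stays at distance
1/c from the constant 1/c. Dominated convergence applies to the squared coefficients of a fixed f.
-/
theorem tendsto_fmul_kSymbol_apply (f : L2per L) :
    Tendsto (fun γ => fmul (kSymbol L hc γ) f) (𝓝 0) (𝓝 (fmul (kSymbol L hc 0) f)) := by
  rw [tendsto_iff_norm_sub_tendsto_zero]
  have e : ∀ γ, ‖fmul (kSymbol L hc γ) f - fmul (kSymbol L hc 0) f‖ ^ 2 =
      ∑' n, (kReal L c γ n - c⁻¹) ^ 2 * ‖fourierBasis.repr f n‖ ^ 2 := by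
    intro γ
    rw [← (hasSum_norm_sq_coeff _).tsum_eq]
    refine tsum_congr fun n => ?_
    rw [map_sub, lp.coeFn_sub, Pi.sub_apply, coeff_kSymbol, coeff_kSymbol, kReal_zero, ← sub_mul,
      norm_mul, mul_pow, ← Complex.ofReal_sub, Complex.norm_real, Real.norm_eq_abs, sq_abs]
  have h1 : Tendsto (fun γ => ∑' n, (kReal L c γ n - c⁻¹) ^ 2 * ‖fourierBasis.repr f n‖ ^ 2) (𝓝 0)
      (𝓝 (∑' n : ℤ, (0 : ℝ))) := by
    refine tendsto_tsum_of_dominated_convergence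
      (bound := fun n => (c⁻¹) ^ 2 * ‖fourierBasis.repr f n‖ ^ 2)
      ((hasSum_norm_sq_coeff f).summable.mul_left _) (fun n => ?_) (Eventually.of_forall
        fun γ n => ?_)
    · have := (((tendsto_kReal (L := L) hc n).sub_const c⁻¹).pow 2).mul_const
        (‖fourierBasis.repr f n‖ ^ 2)
      simpa using this
    · rw [Real.norm_of_nonneg (by positivity)]
      refine mul_le_mul_of_nonneg_right ?_ (sq_nonneg _)
      have h1 := kReal_pos (L := L) hc γ n
      have h2 := kReal_le (L := L) hc γ n
      exact sq_le_sq' (by linarith) (by linarith)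
  simp only [← e, tsum_zero] at h1
  have := h1.sqrt
  simpa [Real.sqrt_sq (norm_nonneg _)] using this

theorem tendsto_fmul_kSymbol {l : Filter ℝ} (hl : l ≤ 𝓝 0) {F : ℝ → L2per L} {f : L2per L}
    (hF : Tendsto F l (𝓝 f)) :
    Tendsto (fun γ => fmul (kSymbol L hc γ) (F γ)) l (𝓝 (fmul (kSymbol L hc 0) f)) := by
  have h1 := (tendsto_fmul_kSymbol_apply hc f).mono_left hl
  have h2 : Tendsto (fun γ => fmul (kSymbol L hc γ) (F γ - f)) l (𝓝 0) := by
    refine squeeze_zero_norm (fun γ => norm_fmul_kSymbol_le hc γ _) ?_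
    have := (tendsto_iff_norm_sub_tendsto_zero.1 hF).const_mul c⁻¹
    simpa using this
  have := h2.add h1
  simpa using this

theorem inner_fmul_kSymbol (γ : ℝ) (f g : L2per L) :
    inner ℂ (fmul (kSymbol L hc γ) f) g = inner ℂ f (fmul (kSymbol L hc γ) g) :=
  inner_symm_of_coeff (coeff_kSymbol hc γ f) (coeff_kSymbol hc γ g)

theorem hasSum_re_inner_fmul_kSymbol (γ : ℝ) (f : L2per L) :
    HasSum (fun n => kReal L c γ n * ‖fourierBasis.repr f n‖ ^ 2)
      (inner ℂ f (fmul (kSymbol L hc γ) f)).re := by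
  have h := lp.hasSum_inner (𝕜 := ℂ) (fourierBasis.repr f)
    (fourierBasis.repr (fmul (kSymbol L hc γ) f))
  rw [fourierBasis.repr.inner_map_map] at h
  have h2 : HasSum _ (inner ℂ f (fmul (kSymbol L hc γ) f)).re := Complex.reCLM.hasSum h
  convert h2 using 2 with n
  rw [coeff_kSymbol, ← smul_eq_mul (kReal L c γ n : ℂ), inner_smul_right, Complex.reCLM_apply,
    Complex.re_ofReal_mul]
  congr 1
  exact (inner_self_eq_norm_sq (𝕜 := ℂ) (fourierBasis.repr f n)).symm

/-- The order relation 𝓚_γ⁻¹ ≤ 1/c takes the place of norm convergence in the spectral argument. -/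
theorem re_inner_fmul_kSymbol_le (γ : ℝ) (f : L2per L) :
    (inner ℂ f (fmul (kSymbol L hc γ) f)).re ≤ c⁻¹ * ‖f‖ ^ 2 :=
  hasSum_le (fun n => mul_le_mul_of_nonneg_right (kReal_le hc γ n) (sq_nonneg _))
    (hasSum_re_inner_fmul_kSymbol hc γ f) ((hasSum_norm_sq_coeff f).mul_left _)

theorem re_inner_fmul_kSymbol_pos (γ : ℝ) {f : L2per L} (hf : f ≠ 0) :
    0 < (inner ℂ f (fmul (kSymbol L hc γ) f)).re := by
  have : ∃ n, fourierBasis.repr f n ≠ 0 := by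
    by_contra! h
    exact hf (coeff_ext fun n => by rw [h n]; simp)
  obtain ⟨n, hn⟩ := this
  have h1 := le_hasSum (hasSum_re_inner_fmul_kSymbol hc γ f) n fun m _ =>
    mul_nonneg (kReal_pos hc γ m).le (sq_nonneg _)
  exact (mul_pos (kReal_pos hc γ n) (by positivity)).trans_le h1

end Symbols

/-! ### The bounded part of 𝓛_γ -/

section Linearization

variable {L : ℝ} [hL : Fact (0 < L)]

theorem inner_mulOp (V : C(AddCircle L, ℝ)) (f g : L2per L) :
    inner ℂ (mulOp V f) g = inner ℂ f (mulOp V g) := by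
  rw [MeasureTheory.L2.inner_def, MeasureTheory.L2.inner_def, mulOp_eq]
  refine integral_congr_ae ?_
  filter_upwards [coeFn_mulC (cplx V) f, coeFn_mulC (cplx V) g] with x h1 h2
  rw [h1, h2, ← smul_eq_mul, ← smul_eq_mul, inner_smul_left, inner_smul_right]
  congr 1
  exact Complex.conj_ofReal _

theorem norm_cplx_le (V : C(AddCircle L, ℝ)) : ‖cplx V‖ ≤ ‖V‖ := by
  refine (ContinuousMap.norm_le _ (norm_nonneg _)).2 fun x => ?_
  change ‖((V x : ℝ) : ℂ)‖ ≤ _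
  rw [Complex.norm_real]
  exact V.norm_coe_le_norm x

theorem norm_mulOp_le (V : C(AddCircle L, ℝ)) : ‖mulOp V‖ ≤ ‖V‖ :=
  (norm_mulC_le _).trans (norm_cplx_le V)

theorem neg_norm_le_re_inner_mulOp (V : C(AddCircle L, ℝ)) (f : L2per L) :
    -(‖V‖ * ‖f‖ ^ 2) ≤ (inner ℂ f (mulOp V f)).re := by
  have h1 := (Complex.abs_re_le_norm _).trans (norm_inner_le_norm (𝕜 := ℂ) f (mulOp V f))
  have h2 := ((mulOp V).le_opNorm f).trans (mul_le_mul_of_nonneg_right (norm_mulOp_le V)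
    (norm_nonneg f))
  have h3 := mul_le_mul_of_nonneg_left h2 (norm_nonneg f)
  have h4 := (abs_le.1 h1).1
  nlinarith

theorem mulOp_add (V W : C(AddCircle L, ℝ)) : mulOp (V + W) = mulOp V + mulOp W := by
  have : cplx (V + W) = cplx V + cplx W := by ext x; simp [cplx]
  rw [mulOp_eq, this, map_add]; rfl

theorem mulOp_smul (r : ℝ) (V : C(AddCircle L, ℝ)) : mulOp (r • V) = (r : ℂ) • mulOp V := by
  have : cplx (r • V) = (r : ℂ) • cplx V := by ext x; simp [cplx]
  rw [mulOp_eq, this, map_smul]; rfl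

theorem mulOp_sub (V W : C(AddCircle L, ℝ)) : mulOp (V - W) = mulOp V - mulOp W := by
  have := mulOp_add (V - W) W
  rw [sub_add_cancel] at this
  rw [this, add_sub_cancel_right]

theorem mulOp_one : mulOp (1 : C(AddCircle L, ℝ)) = ContinuousLinearMap.id ℂ _ := by
  ext1 f
  refine Lp.ext ?_
  filter_upwards [coeFn_mulC (cplx (1 : C(AddCircle L, ℝ))) f] with x h
  rw [mulOp_eq, h]
  simp [cplx]

theorem mulOp_mul (V W : C(AddCircle L, ℝ)) (f : L2per L) :
    mulOp (V * W) f = mulOp V (mulOp W f) := by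
  refine Lp.ext ?_
  rw [mulOp_eq, mulOp_eq, mulOp_eq]
  filter_upwards [coeFn_mulC (cplx (V * W)) f, coeFn_mulC (cplx V) (mulC (cplx W) f),
    coeFn_mulC (cplx W) f] with x h1 h2 h3
  rw [h1, h2, h3, cplx_mul, ContinuousMap.mul_apply, mul_assoc]

/-- The bounded part of `𝓛`, with a general multiplier. -/
def linOp (α β σ : ℝ) (m : lp (fun _ : ℤ => ℂ) ∞) (φ ψ : C(AddCircle L, ℝ)) :
    L2per L →L[ℂ] L2per L :=
  mulOp (σ • (1 : C(AddCircle L, ℝ)) + α • ψ) -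
    ((2 * α * β : ℝ) : ℂ) • (mulOp φ ∘L fmul m ∘L mulOp φ)

theorem opLplus_eq (α σ : ℝ) (ψ : C(AddCircle L, ℝ)) :
    opLplus α σ ψ = perturbed (mulOp (σ • (1 : C(AddCircle L, ℝ)) + α • ψ)) := by
  unfold opLplus perturbed
  congr 1
  rw [mulOp_add, mulOp_smul, mulOp_smul, mulOp_one]
  rfl

theorem kInv_eq {γ c : ℝ} (hγ : γ ≤ 0) (hc : 0 < c) (f : L2per L) :
    kInv hγ hc f = fmul (kSymbol L hc γ) f := by
  refine coeff_ext fun n => ?_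
  rw [coeff_kSymbol, kReal, min_eq_left hγ]
  exact coeff_fourierMul (m := kInvSymbol L γ c) ⟨f, mem_domain_kInv hγ hc f⟩ n

theorem opL_eq (α β σ : ℝ) {γ c : ℝ} (hγ : γ ≤ 0) (hc : 0 < c) (φ ψ : C(AddCircle L, ℝ)) :
    opL α β σ hγ hc φ ψ = perturbed (linOp α β σ (kSymbol L hc γ) φ ψ) := by
  unfold opL
  rw [opLplus_eq]
  unfold perturbed
  rw [vadd_vadd]
  congr 1
  ext1 f
  change -((2 * α * β : ℝ) : ℂ) • mulOp φ (kInv hγ hc (mulOp φ f)) + _ =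
    _ - ((2 * α * β : ℝ) : ℂ) • mulOp φ (fmul (kSymbol L hc γ) (mulOp φ f))
  rw [kInv_eq, neg_smul, neg_add_eq_sub]

theorem linOp_apply (α β σ : ℝ) (m : lp (fun _ : ℤ => ℂ) ∞) (φ ψ : C(AddCircle L, ℝ))
    (f : L2per L) : linOp α β σ m φ ψ f = mulOp (σ • (1 : C(AddCircle L, ℝ)) + α • ψ) f -
      ((2 * α * β : ℝ) : ℂ) • mulOp φ (fmul m (mulOp φ f)) := rfl

variable {α β c σ γ : ℝ} {φ ψ : C(AddCircle L, ℝ)}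

theorem linOp_symm (hc : 0 < c) (x y : L2per L) :
    inner ℂ (linOp α β σ (kSymbol L hc γ) φ ψ x) y =
      inner ℂ x (linOp α β σ (kSymbol L hc γ) φ ψ y) := by
  rw [linOp_apply, linOp_apply, inner_sub_left, inner_sub_right, inner_smul_left, inner_smul_right,
    inner_mulOp, inner_mulOp, inner_fmul_kSymbol, inner_mulOp, Complex.conj_ofReal]

/-- The nonlocal term is subtracted, so replacing 𝓚_γ⁻¹ by its upper bound 1/c lowers the form and
leaves a multiplication operator. -/
theorem re_inner_linOp_ge (hα : 0 < α) (hβ : 0 < β) (hc : 0 < c) (f : L2per L) :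
    (inner ℂ f (mulOp (σ • (1 : C(AddCircle L, ℝ)) + α • ψ - (2 * α * β / c) • (φ * φ)) f)).re ≤
      (inner ℂ f (linOp α β σ (kSymbol L hc γ) φ ψ f)).re := by
  rw [mulOp_sub, mulOp_smul, linOp_apply, sub_apply,
    smul_apply, inner_sub_right, inner_sub_right, inner_smul_right,
    inner_smul_right, mulOp_mul, ← inner_mulOp φ f (mulOp φ f),
    ← inner_mulOp φ f (fmul _ _), Complex.sub_re, Complex.sub_re,
    Complex.re_ofReal_mul, Complex.re_ofReal_mul]
  have h1 := re_inner_fmul_kSymbol_le hc γ (mulOp φ f)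
  have h2 : (inner ℂ (mulOp φ f) (mulOp φ f)).re = ‖mulOp φ f‖ ^ 2 :=
    (inner_self_eq_norm_sq (𝕜 := ℂ) (mulOp φ f))
  rw [h2]
  have h3 := mul_le_mul_of_nonneg_left h1 (by positivity : 0 ≤ 2 * α * β)
  have h4 : 2 * α * β / c * ‖mulOp φ f‖ ^ 2 = 2 * α * β * (c⁻¹ * ‖mulOp φ f‖ ^ 2) := by
    rw [div_eq_mul_inv]; ring
  linarith

end Linearization

/-! ### Consequences of the traveling wave equations -/

section WaveIdentities

variable {L : ℝ} [hL : Fact (0 < L)] {α β c σ γ : ℝ} {φ ψ : C(AddCircle L, ℝ)}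

theorem IsTravelingWave.negLaplacian_eq (h : IsTravelingWave α β γ c σ φ ψ) :
    ∃ hφ : toL2 φ ∈ (negLaplacian L).domain, negLaplacian L ⟨toL2 φ, hφ⟩ =
      -mulOp (σ • (1 : C(AddCircle L, ℝ)) + α • ψ) (toL2 φ) := by
  obtain ⟨hφ, hψ, h1, h2⟩ := h
  refine ⟨hφ, ?_⟩
  rw [mulOp_add, mulOp_smul, mulOp_smul, mulOp_one, add_apply,
    smul_apply, smul_apply, mulOp_toL2, ← h1]
  simp

theorem IsTravelingWave.eq_fmul (hγ : γ ≤ 0) (hc : 0 < c) (h : IsTravelingWave α β γ c σ φ ψ) :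
    toL2 ψ = -((β : ℂ) • fmul (kSymbol L hc γ) (toL2 (φ * φ))) := by
  obtain ⟨hφ, hψ, h1, h2⟩ := h
  refine coeff_ext fun n => ?_
  have h3 := congrArg (fun f => fourierBasis.repr f n) h2
  simp only [map_sub, map_smul, lp.coeFn_sub, Pi.sub_apply, lp.coeFn_smul, Pi.smul_apply,
    smul_eq_mul] at h3
  rw [coeff_absD] at h3
  rw [map_neg, lp.coeFn_neg, Pi.neg_apply, map_smul, lp.coeFn_smul, Pi.smul_apply, coeff_kSymbol,
    smul_eq_mul, mul_left_comm, ← h3]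
  have h4 := (hc.trans_le (le_kReal_inv (L := L) c γ n)).ne'
  rw [kReal, min_eq_left hγ] at *
  have h5 : ((-γ * |waveNumber L n| + c : ℝ) : ℂ) ≠ 0 := Complex.ofReal_ne_zero.2 h4
  rw [Complex.ofReal_inv, eq_comm, neg_eq_iff_eq_neg, inv_mul_eq_iff_eq_mul₀ h5]
  push_cast
  ring

/-- Since 𝓛⁺φ = 0, only the nonlocal term survives when 𝓛 is applied to φ. -/
theorem IsTravelingWave.mem_graph (hc : 0 < c)
    (h : IsTravelingWave α β γ c σ φ ψ) :
    (toL2 φ, -(((2 * α * β : ℝ) : ℂ) • mulOp φ (fmul (kSymbol L hc γ) (toL2 (φ * φ))))) ∈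
      (perturbed (linOp α β σ (kSymbol L hc γ) φ ψ)).graph := by
  obtain ⟨hφ, h1⟩ := h.negLaplacian_eq
  rw [mem_graph_perturbed]
  refine ⟨hφ, ?_⟩
  rw [h1, linOp_apply, mulOp_toL2 φ φ]
  abel

theorem toL2_ne_zero {g : C(AddCircle L, ℝ)} {x : AddCircle L} (hx : g x ≠ 0) : toL2 g ≠ 0 := by
  intro h0
  have h3 : cplx g = 0 := toLp_injective (by rw [← toL2_eq, h0, map_zero])
  have h4 := DFunLike.congr_fun h3 x
  exact hx (Complex.ofReal_eq_zero.1 h4)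

/-- Moving one factor φ across, the form at φ becomes -2αβ⟨φ², 𝓚_γ⁻¹φ²⟩, and the symbol of 𝓚_γ⁻¹ is
strictly positive. So φ is a negative direction. -/
theorem re_inner_form_wave_neg (hα : 0 < α) (hβ : 0 < β) (hc : 0 < c) (h0 : φ 0 ≠ 0) :
    (inner ℂ (toL2 φ)
      (-(((2 * α * β : ℝ) : ℂ) • mulOp φ (fmul (kSymbol L hc γ) (toL2 (φ * φ)))))).re < 0 := by
  rw [inner_neg_right, inner_smul_right, ← inner_mulOp, mulOp_toL2, Complex.neg_re,
    Complex.re_ofReal_mul]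
  have := re_inner_fmul_kSymbol_pos hc γ (toL2_ne_zero (g := φ * φ) (x := 0) (mul_ne_zero h0 h0))
  have h2 : 0 < 2 * α * β := by positivity
  have := mul_pos h2 this
  linarith

theorem mem_ddx_of_mem_negLaplacian {f : L2per L} (h : f ∈ (negLaplacian L).domain) :
    f ∈ (ddx L).domain := by
  obtain ⟨h1, -⟩ := exists_fourierMul_eq (f := f) (m := fun n => Complex.I * (waveNumber L n : ℂ))
    (w := ContinuousMap.toLp 2 haarAddCircle ℂ (greenC' L (negLaplacian L ⟨f, h⟩ + f))) fun n => by
      rw [coeff_toLp, fourierCoeff_greenC', ← coeff_toLp, toLp_greenC]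
      exact congrArg (fun g => Complex.I * (waveNumber L n : ℂ) * fourierBasis.repr g n)
        (green_apply ⟨f, h⟩)
  exact h1

theorem mem_ddx_of_mem_absD {f : L2per L} (h : f ∈ (absD L).domain) : f ∈ (ddx L).domain := by
  refine Memℓp.mono' (E := fun _ : ℤ => ℂ) (F := fun _ : ℤ => ℂ) h fun n => ?_
  simp

/-- The derivative of the wave lies in the kernel of the linearization. -/
theorem IsTravelingWave.ddx_mem_graph (hγ : γ ≤ 0) (hc : 0 < c)
    (h : IsTravelingWave α β γ c σ φ ψ) (hd : toL2 φ ∈ (ddx L).domain) :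
    (ddx L ⟨toL2 φ, hd⟩, 0) ∈ (perturbed (linOp α β σ (kSymbol L hc γ) φ ψ)).graph := by
  obtain ⟨hφ, h1⟩ := h.negLaplacian_eq
  have h2 := h.eq_fmul hγ hc
  obtain ⟨-, hψ, -, -⟩ := h
  have hψd := mem_ddx_of_mem_absD hψ
  set p := ddx L ⟨toL2 φ, hd⟩ with hp
  set q := ddx L ⟨toL2 ψ, hψd⟩ with hq
  set V : C(AddCircle L, ℝ) := σ • (1 : C(AddCircle L, ℝ)) + α • ψ with hV
  have cp : ∀ n, fourierBasis.repr p n = Complex.I * waveNumber L n * fourierCoeff (cplx φ) n :=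
    fun n => by rw [hp, coeff_ddx, ← coeff_toLp]; rfl
  have cq : ∀ n, fourierBasis.repr q n = Complex.I * waveNumber L n * fourierCoeff (cplx ψ) n :=
    fun n => by rw [hq, coeff_ddx, ← coeff_toLp]; rfl
  -- The derivative of ψ = -β𝓚_γ⁻¹(φ²).
  have eq : q = -((2 * β : ℝ) : ℂ) • fmul (kSymbol L hc γ) (mulOp φ p) := by
    refine coeff_ext fun n => ?_
    have h3 := ddx_mul cp cp n
    rw [← two_smul ℂ, map_smul, lp.coeFn_smul, Pi.smul_apply, smul_eq_mul] at h3
    rw [hq, coeff_ddx]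
    simp only
    rw [h2, map_neg, lp.coeFn_neg, Pi.neg_apply, map_smul, map_smul, lp.coeFn_smul, lp.coeFn_smul,
      Pi.smul_apply, Pi.smul_apply, coeff_kSymbol, coeff_kSymbol, toL2_eq, coeff_toLp, cplx_mul,
      smul_eq_mul, smul_eq_mul, mulOp_eq]
    push_cast
    linear_combination ((kReal L c γ n : ℂ) * β) * h3
  have cV : ∀ n, fourierBasis.repr ((α : ℂ) • q) n =
      Complex.I * waveNumber L n * fourierCoeff (cplx V) n := by
    intro n
    have e : cplx V = (σ : ℂ) • (fourier 0 : C(AddCircle L, ℂ)) + (α : ℂ) • cplx ψ := by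
      ext x; simp [cplx, hV]
    rw [e, fourierCoeff_add', fourierCoeff_smul', fourierCoeff_smul', map_smul, lp.coeFn_smul,
      Pi.smul_apply, cq, smul_eq_mul, fourierCoeff_fourier]
    by_cases hn : n = 0
    · subst hn; simp [waveNumber]
    · simp only [Pi.single_apply, hn, if_false]; ring
  rw [mem_graph_perturbed]
  -- The derivative of φ'' = Vφ, which also shows that φ' lies in H²; the term φV' is then rewritten
  -- with the formula for ψ'.
  obtain ⟨hp2, ep2⟩ := exists_fourierMul_eq (f := p)
    (m := fun n => ((waveNumber L n ^ 2 : ℝ) : ℂ))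
    (w := -(mulC (cplx φ) ((α : ℂ) • q) + mulC (cplx V) p)) fun n => by
      rw [map_neg, lp.coeFn_neg, Pi.neg_apply, ddx_mul cV cp, cp]
      have h3 := coeff_negLaplacian ⟨toL2 φ, hφ⟩ n
      rw [h1, mulOp_toL2, map_neg, lp.coeFn_neg, Pi.neg_apply, toL2_eq, coeff_toLp, cplx_mul] at h3
      simp only [toL2_eq, coeff_toLp] at h3
      linear_combination (Complex.I * waveNumber L n) * h3
  refine ⟨hp2, ep2.trans ?_⟩
  rw [linOp_apply, zero_sub, map_smul, eq, map_smul, mulOp_eq, mulOp_eq, smul_smul]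
  push_cast
  rw [show (α : ℂ) * -(2 * β) = -(2 * α * β) by ring, neg_smul]
  abel

theorem ddx_ne_zero {f : C(AddCircle L, ℝ)} (hf : toL2 f ∈ (ddx L).domain)
    {x y : AddCircle L} (hxy : f x ≠ f y) : ddx L ⟨toL2 f, hf⟩ ≠ 0 := by
  intro h0
  have h1 : ∀ n : ℤ, n ≠ 0 → fourierCoeff (cplx f) n = 0 := by
    intro n hn
    have h2 := coeff_ddx ⟨toL2 f, hf⟩ n
    rw [h0, map_zero] at h2
    simp only [toL2_eq, coeff_toLp] at h2
    have h3 : (waveNumber L n : ℂ) ≠ 0 := by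
      rw [Complex.ofReal_ne_zero]
      have := hL.out.ne'
      have := Real.pi_ne_zero
      have : (n : ℝ) ≠ 0 := Int.cast_ne_zero.2 hn
      unfold waveNumber
      positivity
    exact (mul_eq_zero.1 h2.symm).resolve_left (mul_ne_zero Complex.I_ne_zero h3)
  have h2 : cplx f = fourierCoeff (cplx f) 0 • (fourier 0 : C(AddCircle L, ℂ)) := by
    refine fourierCoeff_injective fun n => ?_
    rw [fourierCoeff_smul', fourierCoeff_fourier]
    by_cases hn : n = 0
    · subst hn; simp
    · simp [hn, h1 n hn]
  have h3 := DFunLike.congr_fun h2 x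
  have h4 := DFunLike.congr_fun h2 y
  simp only [ContinuousMap.smul_apply, fourier_zero] at h3 h4
  exact hxy (Complex.ofReal_injective (h3.trans h4.symm))

end WaveIdentities

/-! ### The linearization at the dnoidal wave -/

section DnoidalLinearization

variable {L : ℝ} [hL : Fact (0 < L)] {κ η₁ η₂ : ℝ} {Φ Φ' : ℝ → ℝ}

/-- The two conditions are the vanishing of the representative at x₀ and at -x₀. The real bound is
applied to the real and imaginary parts. -/
theorem IsDnProfile.formBound (h : IsDnProfile L κ η₁ η₂ Φ Φ') {V : C(AddCircle L, ℝ)}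
    (hV : ∀ x : ℝ, V (x : AddCircle L) = κ * (η₁ ^ 2 + η₂ ^ 2) - 6 * κ * Φ x ^ 2) :
    ∃ μ : ℝ, 0 < μ ∧ FormBound (mulOp V) μ := by
  obtain ⟨lam, x₀, hlam, -, -, hb⟩ := h.exists_form_bound
  -- Point values are not defined on L². On the graph, however, f = (1 - d²/dx²)⁻¹(w - Vf + f), and
  -- the continuous representative of the right side is linear on all pairs (f, w).
  let S : L2per L × L2per L →ₗ[ℂ] C(AddCircle L, ℂ) :=
    (greenC L : L2per L →ₗ[ℂ] C(AddCircle L, ℂ)) ∘ₗ (LinearMap.snd ℂ _ _ -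
      (mulOp V : L2per L →ₗ[ℂ] L2per L) ∘ₗ LinearMap.fst ℂ _ _ + LinearMap.fst ℂ _ _)
  let e : L2per L × L2per L →ₗ[ℂ] (Fin 2 → ℂ) := LinearMap.pi fun i =>
    (ContinuousMap.evalCLM ℂ ((![x₀, -x₀] i : ℝ) : AddCircle L) : C(AddCircle L, ℂ) →L[ℂ] ℂ).toLinearMap ∘ₗ S
  refine ⟨lam, hlam, e, fun f w hfw h0 => ?_⟩
  obtain ⟨hf, hw⟩ := mem_graph_perturbed.1 hfw
  obtain ⟨⟨y, hy⟩, h1, h2⟩ := LinearPMap.mem_graph_iff _ |>.1 hfw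
  simp only at h1 h2
  subst h1
  obtain ⟨g, g', hg, hg', hform⟩ := form_mulOp V ⟨y, hy⟩
  simp only at hg
  have hgS : S (y, w) = g := by
    refine toLp_injective ?_
    rw [hg]
    have h3 := green_apply ⟨y, hf⟩
    rw [hw] at h3
    exact (toLp_greenC _).trans h3
  have hz0 : g (x₀ : AddCircle L) = 0 := by
    have := congrFun h0 0
    rw [← hgS]; exact this
  have hz1 : g ((-x₀ : ℝ) : AddCircle L) = 0 := by
    have := congrFun h0 1
    rw [← hgS]; exact this
  have hz2 : g ((L - x₀ : ℝ) : AddCircle L) = 0 := by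
    rw [← hz1]; congr 1
    rw [sub_eq_add_neg, AddCircle.coe_add, AddCircle.coe_period, zero_add]
  have hcg := continuous_coe_circle g
  have hcg' := continuous_coe_circle g'
  have hΦ := h.continuous
  have b1 := hb _ _ (fun x => (hg' x).complex_re) (by fun_prop)
    (congrArg Complex.re hz1) (congrArg Complex.re hz0) (congrArg Complex.re hz2)
  have b2 := hb _ _ (fun x => (hg' x).complex_im) (by fun_prop)
    (congrArg Complex.im hz1) (congrArg Complex.im hz0) (congrArg Complex.im hz2)
  have b3 := add_nonneg b1 b2
  rw [← intervalIntegral.integral_add (Continuous.intervalIntegrable (by fun_prop) _ _)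
    (Continuous.intervalIntegrable (by fun_prop) _ _)] at b3
  rw [← h2, hform, Complex.ofReal_re, ← hg, norm_sq_toLp, ← sub_nonneg, ← integral_const_mul,
    ← integral_sub (integrable_circle (by fun_prop)) (integrable_circle (by fun_prop)),
    integral_haar_eq _ (-x₀), smul_eq_mul]
  refine mul_nonneg (inv_nonneg.2 hL.out.le) ?_
  rw [neg_add_eq_sub]
  refine b3.trans_eq (intervalIntegral.integral_congr fun x _ => ?_)
  rw [hV, ← Complex.normSq_eq_norm_sq, ← Complex.normSq_eq_norm_sq, Complex.normSq_apply,
    Complex.normSq_apply]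
  ring

theorem IsDnProfile.periodic' (h : IsDnProfile L κ η₁ η₂ Φ Φ') : Function.Periodic Φ' L := by
  intro x
  have h1 : HasDerivAt (fun y => Φ (y + L)) (Φ' (x + L)) x := (h.deriv (x + L)).comp_add_const x L
  simp only [h.periodic _] at h1
  exact h1.unique (h.deriv x)

theorem IsDnProfile.exists_ne (h : IsDnProfile L κ η₁ η₂ Φ Φ') {φ : C(AddCircle L, ℝ)}
    (hφ : ∀ x : ℝ, φ (x : AddCircle L) = Φ x) : ∃ x y, φ x ≠ φ y := by
  obtain ⟨x₀, h1, h2, h3, h4⟩ := h.crossing ((η₁ ^ 2 + η₂ ^ 2) / 2)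
    (by nlinarith [h.lt, h.η₂_pos]) (by nlinarith [h.lt, h.η₂_pos])
  refine ⟨((0 : ℝ) : AddCircle L), ((L / 2 : ℝ) : AddCircle L), fun e => ?_⟩
  rw [hφ, hφ] at e
  have h5 := h3 0 ⟨by linarith, h1⟩
  have h6 := h4 (L / 2) ⟨h2, by linarith⟩
  rw [e] at h5
  linarith

theorem mem_graph_of_hasDerivAt {V u u' : C(AddCircle L, ℝ)} {lam : ℝ}
    (hu : ∀ x : ℝ, HasDerivAt (fun y : ℝ => u (y : AddCircle L)) (u' (x : AddCircle L)) x)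
    (hu' : ∀ x : ℝ, HasDerivAt (fun y : ℝ => u' (y : AddCircle L))
      ((V (x : AddCircle L) - lam) * u (x : AddCircle L)) x) :
    (toL2 u, (lam : ℂ) • toL2 u) ∈ (perturbed (mulOp V)).graph := by
  have h1 := fourierCoeff_of_hasDerivAt (p := cplx u) (r := cplx u')
    fun x => (hu x).ofReal_comp
  have h2 := fourierCoeff_of_hasDerivAt (p := cplx u')
    (r := cplx ((V - lam • (1 : C(AddCircle L, ℝ))) * u))
    fun x => by
      have := (hu' x).ofReal_comp
      simpa [cplx] using this
  rw [mem_graph_perturbed]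
  refine exists_fourierMul_eq fun n => ?_
  have e : (lam : ℂ) • toL2 u - mulOp V (toL2 u) =
      -toL2 ((V - lam • (1 : C(AddCircle L, ℝ))) * u) := by
    rw [← mulOp_toL2, mulOp_sub, mulOp_smul, mulOp_one, sub_apply, smul_apply, ContinuousLinearMap.id_apply,
      neg_sub]
  rw [e, map_neg, lp.coeFn_neg, Pi.neg_apply, toL2_eq, toL2_eq, coeff_toLp, coeff_toLp, h2, h1]
  push_cast
  linear_combination (-(waveNumber L n : ℂ) ^ 2 * fourierCoeff (cplx u) n) * Complex.I_mul_I

theorem IsDnProfile.exists_negative_eigenvector (h : IsDnProfile L κ η₁ η₂ Φ Φ')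
    {V φ : C(AddCircle L, ℝ)} (hφ : ∀ x : ℝ, φ (x : AddCircle L) = Φ x)
    (hV : ∀ x : ℝ, V (x : AddCircle L) = κ * (η₁ ^ 2 + η₂ ^ 2) - 6 * κ * Φ x ^ 2) :
    ∃ lam : ℝ, lam < 0 ∧ ∃ χ : C(AddCircle L, ℝ), (∀ x, 0 < χ x) ∧ (∀ x, χ (-x) = χ x) ∧
      (toL2 χ, (lam : ℂ) • toL2 χ) ∈ (perturbed (mulOp V)).graph := by
  obtain ⟨a, lam, hlam, hpos, hq, hlam'⟩ := h.exists_negative_eigenfunction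
  have hc' : Continuous Φ' := continuous_iff_continuousAt.2 fun x => (h.deriv' x).continuousAt
  have hper : Function.Periodic (fun x => 2 * Φ x * Φ' x) L := fun x => by
    simp only [h.periodic x, h.periodic' x]
  have hΦ := h.continuous
  refine ⟨lam, hlam, φ * φ - a • (1 : C(AddCircle L, ℝ)), fun x => ?_, fun x => ?_, ?_⟩
  · induction x using QuotientAddGroup.induction_on with
    | H x =>
      have := hpos x
      change 0 < φ (x : AddCircle L) * φ (x : AddCircle L) - a * 1
      rw [hφ]; nlinarith
  · induction x using QuotientAddGroup.induction_on with
    | H x =>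
      change φ ((-x : ℝ) : AddCircle L) * φ ((-x : ℝ) : AddCircle L) - a * 1 =
        φ (x : AddCircle L) * φ (x : AddCircle L) - a * 1
      rw [hφ, hφ, h.even]
  · refine mem_graph_of_hasDerivAt (u' := circleLift _ (by fun_prop) hper) (fun x => ?_)
      fun x => ?_
    · rw [circleLift_coe]
      have h1 := ((h.deriv x).mul (h.deriv x)).sub_const (a * 1)
      refine (h1.congr_of_eventuallyEq (Eventually.of_forall fun y => ?_)).congr_deriv (by ring)
      change φ (y : AddCircle L) * φ (y : AddCircle L) - a * 1 = _
      rw [hφ]; rfl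
    · have h1 := ((h.deriv x).const_mul 2).mul (h.deriv' x)
      refine (h1.congr_of_eventuallyEq (Eventually.of_forall fun y => ?_)).congr_deriv ?_
      · exact circleLift_coe _ _ y
      · change _ = (V (x : AddCircle L) - lam) * (φ (x : AddCircle L) * φ (x : AddCircle L) - a * 1)
        rw [hφ, hV, hlam']
        linear_combination 2 * h.energy x - 2 * κ * hq

end DnoidalLinearization

/-! ### Continuity of branches in the uniform norm -/

section Curves

variable {L : ℝ} [hL : Fact (0 < L)]

/-- The sequence `(1 + n²)^{-s/2}`. -/
def hsWeight (s : ℝ) (hs : 1 ≤ s) : lp (fun _ : ℤ => ℂ) 2 :=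
  ⟨fun n => (((1 + (n : ℝ) ^ 2) ^ (-(s / 2)) : ℝ) : ℂ),
    memℓp_two_of_sq_mul_le 1 fun n => by
      have h0 : (0 : ℝ) < 1 + (n : ℝ) ^ 2 := by positivity
      rw [Complex.norm_real, Real.norm_of_nonneg (Real.rpow_nonneg h0.le _), ← Real.rpow_natCast,
        ← Real.rpow_mul h0.le]
      have h1 : (1 + (n : ℝ) ^ 2) ^ (-(s / 2) * (2 : ℕ)) ≤ (1 + (n : ℝ) ^ 2) ^ (-1 : ℝ) :=
        Real.rpow_le_rpow_of_exponent_le (by nlinarith [sq_nonneg (n : ℝ)]) (by push_cast; linarith)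
      refine (mul_le_mul_of_nonneg_right h1 (sq_nonneg _)).trans ?_
      rw [Real.rpow_neg_one, inv_mul_le_iff₀ h0]
      linarith⟩

theorem hsWeight_apply (s : ℝ) (hs : 1 ≤ s) (n : ℤ) :
    hsWeight s hs n = (((1 + (n : ℝ) ^ 2) ^ (-(s / 2)) : ℝ) : ℂ) := rfl

/-- The real part of a continuous function. -/
def reC : C(AddCircle L, ℂ) →L[ℝ] C(AddCircle L, ℝ) :=
  Complex.reCLM.compLeftContinuous ℝ _

theorem reC_cplx (f : C(AddCircle L, ℝ)) : reC (cplx f) = f := by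
  ext x; exact Complex.ofReal_re _

/-- This is the embedding of H^s into the continuous functions: for s ≥ 1 the weight (1 + n²)^{-s/2}
is square summable, so removing it from an ℓ² sequence gives a uniformly convergent series. -/
theorem IsCurveInHs.continuousOn {s γ₁ : ℝ} (hs : 1 ≤ s) {f : ℝ → C(AddCircle L, ℝ)}
    (h : IsCurveInHs s γ₁ f) : ContinuousOn f (Ioc (-γ₁) 0) := by
  obtain ⟨F, h1, h2, -⟩ := h
  have h3 : ContinuousOn (fun γ => reC (synth (hsWeight s hs)
      ((fourierBasis (T := L)).repr.symm (F γ)))) (Ioc (-γ₁) 0) :=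
    (reC.continuous.comp ((synth (hsWeight s hs)).continuous.comp
      (fourierBasis (T := L)).repr.symm.continuous)).comp_continuousOn h2
  refine h3.congr fun γ hγ => ?_
  have h4 : synth (hsWeight s hs) ((fourierBasis (T := L)).repr.symm (F γ)) = cplx (f γ) := by
    refine fourierCoeff_injective fun n => ?_
    rw [fourierCoeff_synth, LinearIsometryEquiv.apply_symm_apply, h1 γ hγ, hsWeight_apply,
      ← mul_assoc, ← Complex.ofReal_mul, ← Real.rpow_add (by positivity), neg_add_cancel,
      Real.rpow_zero, Complex.ofReal_one, one_mul]
  simp only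
  rw [h4, reC_cplx]

theorem IsCurveInHs.tendsto {s γ₁ : ℝ} (hγ₁ : 0 < γ₁) (hs : 1 ≤ s) {f : ℝ → C(AddCircle L, ℝ)}
    (h : IsCurveInHs s γ₁ f) : Tendsto f (𝓝[<] 0) (𝓝 (f 0)) := by
  have h1 := (h.continuousOn hs) 0 ⟨by linarith, le_rfl⟩
  refine h1.tendsto.mono_left (nhdsWithin_le_of_mem ?_)
  exact mem_of_superset (Ioo_mem_nhdsLT (by linarith)) Ioo_subset_Ioc_self

theorem continuous_cplx : Continuous (cplx : C(AddCircle L, ℝ) → C(AddCircle L, ℂ)) := by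
  have h := (Complex.ofRealCLM.compLeftContinuous ℝ (AddCircle L)).continuous
  exact h

theorem continuous_toL2 : Continuous (toL2 : C(AddCircle L, ℝ) → L2per L) :=
  (ContinuousMap.toLp 2 haarAddCircle ℂ).continuous.comp continuous_cplx

theorem tendsto_mulOp_apply {ι : Type*} {l : Filter ι} {p : ι → C(AddCircle L, ℝ)}
    {g : ι → L2per L} {p₀ : C(AddCircle L, ℝ)} {g₀ : L2per L} (hp : Tendsto p l (𝓝 p₀))
    (hg : Tendsto g l (𝓝 g₀)) :
    Tendsto (fun i => mulOp (p i) (g i)) l (𝓝 (mulOp p₀ g₀)) := by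
  have h1 : Tendsto (fun i => mulC (cplx (p i))) l (𝓝 (mulC (cplx p₀))) :=
    ((mulC.continuous.comp continuous_cplx).tendsto p₀).comp hp
  have h2 : Continuous fun q : (L2per L →L[ℂ] L2per L) × L2per L => q.1 q.2 :=
    isBoundedBilinearMap_apply.continuous
  exact (h2.tendsto (mulC (cplx p₀), g₀)).comp (h1.prodMk_nhds hg)

end Curves

/-! ### Spectral properties of 𝓛_γ and 𝓛_γ⁺ along a branch -/

section SpectralProperties

variable {L : ℝ} [hL : Fact (0 < L)] {α β c σ γ : ℝ} {φ ψ : C(AddCircle L, ℝ)}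

theorem integral_eq_inner_toL2 (φ : C(AddCircle L, ℝ)) (χ : L2per L) :
    ∫ x : AddCircle L, (φ x : ℂ) * χ x = (L : ℂ) * inner ℂ (toL2 φ) χ := by
  rw [volume_eq_smul_haarAddCircle, integral_smul_measure, MeasureTheory.L2.inner_def,
    ENNReal.toReal_ofReal hL.out.le, Complex.real_smul]
  congr 1
  refine integral_congr_ae ?_
  filter_upwards [ContinuousMap.coeFn_toLp (p := 2) (𝕜 := ℂ) haarAddCircle (cplx φ)] with x h
  rw [toL2_eq, h]
  change _ = χ x * conj ((φ x : ℝ) : ℂ)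
  rw [Complex.conj_ofReal, mul_comm]

/-- An approximate eigenvector with negative eigenvalue has a component along the ground state. -/
theorem inner_groundState_ne_zero {B : L2per L →L[ℂ] L2per L} {lam lam' ε : ℝ} {χ X R p : L2per L}
    (hχ : χ ∈ opEigenspace (perturbed B) lam) (hχ0 : χ ≠ 0)
    (hpos : ∀ f w, (f, w) ∈ (perturbed B).graph → inner ℂ χ f = 0 → 0 ≤ (inner ℂ f w).re)
    (hlam' : lam' < 0) (hX : (X, (lam' : ℂ) • X + R) ∈ (perturbed B).graph)
    (hε : ‖R‖ ≤ ε) (hp : ‖p‖ * ε < |lam'| * ‖inner ℂ p X‖) : inner ℂ p χ ≠ 0 := by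
  intro hpχ
  set t := inner ℂ χ X / inner ℂ χ χ with ht
  have hgraph : (X - t • χ, ((lam' : ℂ) • X + R) - t • ((lam : ℂ) • χ)) ∈ (perturbed B).graph :=
    Submodule.sub_mem _ hX (Submodule.smul_mem _ t (mem_opEigenspace_iff.1 hχ))
  have horth : inner ℂ χ (X - t • χ) = 0 := by
    rw [inner_sub_right, inner_smul_right, ht, div_mul_cancel₀ _ (inner_self_ne_zero.2 hχ0),
      sub_self]
  have horth' := inner_eq_zero_symm.1 horth
  have h1 := hpos _ _ hgraph horth
  -- If p ⊥ χ, then ⟨p, X⟩ = ⟨p, f⟩. Non-negativity of the form at f ⊥ χ gives |lam'|‖f‖ ≤ ε, so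
  -- |lam'| |⟨p, X⟩| ≤ ‖p‖ε, contrary to assumption.
  set f := X - t • χ with hf
  have hXf : X = f + t • χ := by rw [hf, sub_add_cancel]
  rw [hXf, smul_add, inner_sub_right, inner_add_right, inner_add_right, inner_smul_right,
    inner_smul_right, inner_smul_right, inner_smul_right, inner_smul_right, horth', mul_zero,
    mul_zero, mul_zero, mul_zero, add_zero, sub_zero, Complex.add_re, Complex.re_ofReal_mul] at h1
  have h2 : (inner ℂ f f).re = ‖f‖ ^ 2 := inner_self_eq_norm_sq (𝕜 := ℂ) f
  rw [h2] at h1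
  have h3 := ((Complex.re_le_norm _).trans (norm_inner_le_norm (𝕜 := ℂ) f R)).trans
    (mul_le_mul_of_nonneg_left hε (norm_nonneg f))
  have h4 : |lam'| * ‖f‖ ≤ ε := by
    rw [abs_of_neg hlam']
    by_cases hf0 : ‖f‖ = 0
    · rw [hf0, mul_zero]; exact (norm_nonneg R).trans hε
    · have hfp : 0 < ‖f‖ := lt_of_le_of_ne (norm_nonneg f) (Ne.symm hf0)
      refine le_of_mul_le_mul_right ?_ hfp
      nlinarith
  have h5 : inner ℂ p X = inner ℂ p f := by
    rw [hXf, inner_add_right, inner_smul_right, hpχ, mul_zero, add_zero]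
  rw [h5] at hp
  have h6 := mul_le_mul_of_nonneg_left (norm_inner_le_norm (𝕜 := ℂ) p f) (abs_nonneg lam')
  have h7 := mul_le_mul_of_nonneg_left h4 (norm_nonneg p)
  nlinarith

theorem linOp_zero (hc : 0 < c) : linOp α β σ (kSymbol L hc 0) φ ψ =
    mulOp (σ • (1 : C(AddCircle L, ℝ)) + α • ψ - (2 * α * β / c) • (φ * φ)) := by
  ext1 f
  rw [linOp_apply, fmul_kSymbol_zero, mulOp_sub, mulOp_smul (2 * α * β / c), sub_apply, smul_apply,
    mulOp_mul, map_smul, smul_smul, ← Complex.ofReal_mul, div_eq_mul_inv]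

theorem tendsto_linOp_apply (hc : 0 < c) {l : Filter ℝ} (hl : l ≤ 𝓝 0)
    {φ ψ : ℝ → C(AddCircle L, ℝ)} {φ₀ ψ₀ : C(AddCircle L, ℝ)} (hφ : Tendsto φ l (𝓝 φ₀))
    (hψ : Tendsto ψ l (𝓝 ψ₀)) (f : L2per L) :
    Tendsto (fun γ => linOp α β σ (kSymbol L hc γ) (φ γ) (ψ γ) f) l
      (𝓝 (linOp α β σ (kSymbol L hc 0) φ₀ ψ₀ f)) := by
  simp only [linOp_apply]
  have t1 : Tendsto (fun γ => mulOp (φ γ) f) l (𝓝 (mulOp φ₀ f)) :=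
    tendsto_mulOp_apply hφ tendsto_const_nhds
  have t2 := tendsto_fmul_kSymbol hc hl t1
  have t3 : Tendsto (fun γ => mulOp (φ γ) (fmul (kSymbol L hc γ) (mulOp (φ γ) f))) l
      (𝓝 (mulOp φ₀ (fmul (kSymbol L hc 0) (mulOp φ₀ f)))) :=
    tendsto_mulOp_apply hφ t2
  have t4 : Tendsto (fun γ => mulOp (σ • (1 : C(AddCircle L, ℝ)) + α • ψ γ) f) l
      (𝓝 (mulOp (σ • (1 : C(AddCircle L, ℝ)) + α • ψ₀) f)) :=
    tendsto_mulOp_apply (tendsto_const_nhds.add (hψ.const_smul α)) tendsto_const_nhds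
  exact t4.sub (t3.const_smul _)

theorem inner_toL2_ne_zero_of_pos {g h : C(AddCircle L, ℝ)} (hg : ∀ x, 0 < g x)
    (hh : ∀ x, 0 < h x) : inner ℂ (toL2 g) (toL2 h) ≠ 0 := by
  intro h0
  have h1 : inner ℂ (toL2 g) (toL2 h) = ((∫ x, g x * h x ∂haarAddCircle : ℝ) : ℂ) := by
    rw [toL2_eq, toL2_eq, inner_toLp, ← integral_complex_ofReal]
    congr 1; funext x
    change ((h x : ℝ) : ℂ) * conj ((g x : ℝ) : ℂ) = _
    rw [Complex.conj_ofReal]; push_cast; ring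
  rw [h1, Complex.ofReal_eq_zero] at h0
  have hcont : Continuous fun x => g x * h x := by fun_prop
  have hp : ∀ x, 0 < g x * h x := fun x => mul_pos (hg x) (hh x)
  have h7 := (integral_eq_zero_iff_of_nonneg (fun x => (hp x).le)
    (integrable_circle hcont)).1 h0
  have h8 := (Continuous.ae_eq_iff_eq haarAddCircle hcont continuous_const).1 h7
  exact (hp 0).ne' (congrFun h8 0)

theorem opLplus_properties (h : IsTravelingWave α β γ c σ φ ψ) (hpos : ∀ x, 0 < φ x) :
    IsSelfAdjoint (opLplus α σ ψ) ∧
    (∀ f : (opLplus α σ ψ).domain, 0 ≤ (inner ℂ (f : L2per L) (opLplus α σ ψ f)).re) ∧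
    IsSimpleEigenpair (opLplus α σ ψ) 0 (toL2 φ) ∧
    (∀ z ∈ opSpectrum (opLplus α σ ψ), z ≠ 0 →
      (∃ r : ℝ, 0 < r ∧ z = (r : ℂ)) ∧ opEigenspace (opLplus α σ ψ) z ≠ ⊥) ∧
    ∀ R : ℝ, (opSpectrum (opLplus α σ ψ) ∩ Metric.closedBall 0 R).Finite := by
  obtain ⟨hφ, e⟩ := h.negLaplacian_eq
  rw [opLplus_eq]
  set V : C(AddCircle L, ℝ) := σ • (1 : C(AddCircle L, ℝ)) + α • ψ with hV
  have hsym := inner_mulOp V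
  have hnonneg := form_nonneg_of_positive_solution hpos hφ e
  refine ⟨isSelfAdjoint_perturbed hsym, hnonneg,
    isSimpleEigenpair_of_positive_solution hpos hφ e, fun z hz hz0 => ?_,
    finite_opSpectrum_inter_closedBall hsym⟩
  have hne := exists_eigenvector_of_mem_opSpectrum hz
  refine ⟨?_, hne⟩
  obtain ⟨f, hf, hf0⟩ := (Submodule.ne_bot_iff _).1 hne
  obtain ⟨r, rfl⟩ := exists_real_of_eigenvalue hsym hf hf0
  refine ⟨r, lt_of_le_of_ne ?_ fun h0 => hz0 (by rw [← h0, Complex.ofReal_zero]), rfl⟩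
  obtain ⟨hd, hfe⟩ := hf
  have h1 := hnonneg ⟨f, hd⟩
  rw [hfe, inner_smul_right, Complex.re_ofReal_mul] at h1
  have h2 : (inner ℂ f f).re = ‖f‖ ^ 2 := inner_self_eq_norm_sq (𝕜 := ℂ) f
  simp only at h1
  rw [h2] at h1
  have h3 : 0 < ‖f‖ ^ 2 := by positivity
  exact nonneg_of_mul_nonneg_left h1 h3

/-- A version for a single wave, with closeness to γ = 0 expressed by two inequalities: the local
comparison potential is within μ/2 of V₀, and the negative eigenvector X of the unperturbed operator
has a small residual. -/
theorem opL_properties (hα : 0 < α) (hβ : 0 < β) (hc : 0 < c) (hγ : γ ≤ 0)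
    (h : IsTravelingWave α β γ c σ φ ψ) (h0 : φ 0 ≠ 0) {x y : AddCircle L} (hxy : φ x ≠ φ y)
    {V₀ : C(AddCircle L, ℝ)} {μ : ℝ} (hμ : 0 < μ) (hbound : FormBound (mulOp V₀) μ)
    (hV : ‖σ • (1 : C(AddCircle L, ℝ)) + α • ψ - (2 * α * β / c) • (φ * φ) - V₀‖ ≤ μ / 2)
    {lam' : ℝ} (hlam' : lam' < 0) {X : L2per L}
    (hX : (X, (lam' : ℂ) • X) ∈ (perturbed (mulOp V₀)).graph)
    (hr : ‖toL2 φ‖ * ‖linOp α β σ (kSymbol L hc γ) φ ψ X - mulOp V₀ X‖ <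
      |lam'| * ‖inner ℂ (toL2 φ) X‖) :
    IsSelfAdjoint (opL α β σ hγ hc φ ψ) ∧ ∃ lam : ℝ, lam < 0 ∧
      (∃ χ : L2per L, IsSimpleEigenpair (opL α β σ hγ hc φ ψ) (lam : ℂ) χ ∧
        ∫ x : AddCircle L, (φ x : ℂ) * χ x ≠ 0) ∧
      (∃ h : toL2 φ ∈ (ddx L).domain,
        IsSimpleEigenpair (opL α β σ hγ hc φ ψ) 0 (ddx L ⟨toL2 φ, h⟩)) ∧
      ∃ η : ℝ, 0 < η ∧ ∀ z ∈ opSpectrum (opL α β σ hγ hc φ ψ),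
        z ≠ (lam : ℂ) → z ≠ 0 → ∃ r : ℝ, η < r ∧ z = (r : ℂ) := by
  rw [opL_eq]
  have hsym := linOp_symm (L := L) (α := α) (β := β) (σ := σ) (γ := γ) (φ := φ) (ψ := ψ) hc
  have hd : toL2 φ ∈ (ddx L).domain := mem_ddx_of_mem_negLaplacian h.negLaplacian_eq.1
  -- Two one-sided comparisons are chained: 𝓛 lies above the local operator, which lies above the
  -- operator with potential V₀ up to μ/2.
  have hFB : FormBound (linOp α β σ (kSymbol L hc γ) φ ψ) (μ - μ / 2) := by
    refine hbound.mono fun f => ?_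
    refine le_trans ?_ (re_inner_linOp_ge hα hβ hc f)
    have h1 := neg_norm_le_re_inner_mulOp
      (σ • (1 : C(AddCircle L, ℝ)) + α • ψ - (2 * α * β / c) • (φ * φ) - V₀) f
    rw [mulOp_sub _ V₀, sub_apply, inner_sub_right, Complex.sub_re] at h1
    have h2 := mul_le_mul_of_nonneg_right hV (sq_nonneg ‖f‖)
    linarith
  obtain ⟨lam, hlam, χ, hχ, hker, hspec, hpos⟩ := hFB.spectrum hsym (by linarith)
    (h.ddx_mem_graph hγ hc hd) (ddx_ne_zero hd hxy) (h.mem_graph hc) (re_inner_form_wave_neg hα hβ hc h0)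
  refine ⟨isSelfAdjoint_perturbed hsym, lam, hlam, ⟨χ, hχ, ?_⟩, ⟨hd, hker⟩, _,
    by linarith, hspec⟩
  rw [integral_eq_inner_toL2]
  refine mul_ne_zero (Complex.ofReal_ne_zero.2 hL.out.ne') ?_
  have hχm : χ ∈ opEigenspace (perturbed (linOp α β σ (kSymbol L hc γ) φ ψ)) lam := by
    rw [hχ.2]; exact Submodule.mem_span_singleton_self χ
  refine inner_groundState_ne_zero (X := X)
    (R := linOp α β σ (kSymbol L hc γ) φ ψ X - mulOp V₀ X) hχm hχ.1 hpos hlam' ?_ le_rfl hr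
  have := mem_graph_of_mem_graph (B' := linOp α β σ (kSymbol L hc γ) φ ψ) hX
  convert this using 2
  abel

theorem linearizedPotential_eq {η₁ η₂ : ℝ} {Φ : ℝ → ℝ} (hc : 0 < c)
    (hσ : α * β / (2 * c) * (η₁ ^ 2 + η₂ ^ 2) = σ) (hφ : ∀ x : ℝ, φ (x : AddCircle L) = Φ x)
    (hψ : ∀ x, ψ x = -(β / c) * φ x ^ 2) (x : ℝ) :
    (σ • (1 : C(AddCircle L, ℝ)) + α • ψ - (2 * α * β / c) • (φ * φ)) (x : AddCircle L) =
      α * β / (2 * c) * (η₁ ^ 2 + η₂ ^ 2) - 6 * (α * β / (2 * c)) * Φ x ^ 2 := by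
  change σ * 1 + α * ψ (x : AddCircle L) -
    2 * α * β / c * (φ (x : AddCircle L) * φ (x : AddCircle L)) = _
  rw [hψ, hφ, hσ]
  field_simp
  ring

/-- All that is required of a single wave holds at γ = 0 as a strict inequality between quantities
that converge as γ tends to 0 from below, hence on some interval (-γ₂, 0). -/
theorem IsWaveBranch.spectral_properties {γ₁ : ℝ} {φ ψ : ℝ → C(AddCircle L, ℝ)}
    (hα : 0 < α) (hβ : 0 < β) (hc : 0 < c) (hγ₁ : 0 < γ₁) (h : IsWaveBranch α β c σ γ₁ φ ψ) :
    ∃ γ₂ : ℝ, 0 < γ₂ ∧ γ₂ ≤ γ₁ ∧ ∀ (γ : ℝ) (hγ : γ ∈ Set.Ioo (-γ₂) 0),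
      (IsSelfAdjoint (opL α β σ hγ.2.le hc (φ γ) (ψ γ)) ∧ ∃ lam : ℝ, lam < 0 ∧
        (∃ χ : L2per L, IsSimpleEigenpair (opL α β σ hγ.2.le hc (φ γ) (ψ γ)) (lam : ℂ) χ ∧
          ∫ x : AddCircle L, (φ γ x : ℂ) * χ x ≠ 0) ∧
        (∃ h : toL2 (φ γ) ∈ (ddx L).domain,
          IsSimpleEigenpair (opL α β σ hγ.2.le hc (φ γ) (ψ γ)) 0 (ddx L ⟨toL2 (φ γ), h⟩)) ∧
        ∃ η : ℝ, 0 < η ∧ ∀ z ∈ opSpectrum (opL α β σ hγ.2.le hc (φ γ) (ψ γ)),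
          z ≠ (lam : ℂ) → z ≠ 0 → ∃ r : ℝ, η < r ∧ z = (r : ℂ)) ∧
      IsTravelingWave α β γ c σ (φ γ) (ψ γ) ∧ ∀ x, 0 < φ γ x := by
  obtain ⟨η₁, η₂, Φ, Φ', hP, hσ, hφ, hψ⟩ := h.dnoidal.exists_profile hα hβ hc
  have hφt := h.curve_fst.tendsto hγ₁ (by norm_num)
  have hψt := h.curve_snd.tendsto hγ₁ le_rfl
  set κ := α * β / (2 * c) with hκ
  set V : C(AddCircle L, ℝ) × C(AddCircle L, ℝ) → C(AddCircle L, ℝ) :=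
    fun p => σ • (1 : C(AddCircle L, ℝ)) + α • p.2 - (2 * α * β / c) • (p.1 * p.1) with hVdef
  have hVcont : Continuous V := by fun_prop
  have hV : ∀ x : ℝ, V (φ 0, ψ 0) (x : AddCircle L) =
      κ * (η₁ ^ 2 + η₂ ^ 2) - 6 * κ * Φ x ^ 2 := linearizedPotential_eq hc hσ hφ hψ
  obtain ⟨μ, hμ, hbound⟩ := hP.formBound hV
  obtain ⟨lam', hlam', χ, hχpos, -, hχ⟩ := hP.exists_negative_eigenvector hφ hV
  have hpos0 : ∀ x, η₂ ≤ φ 0 x := fun x => by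
    induction x using QuotientAddGroup.induction_on with
    | H x => exact (hP.le x).trans_eq (hφ x).symm
  obtain ⟨x₁, y₁, hxy⟩ := hP.exists_ne hφ
  have hpair : Tendsto (fun γ => (φ γ, ψ γ)) (𝓝[<] 0) (𝓝 (φ 0, ψ 0)) := hφt.prodMk_nhds hψt
  have hev : ∀ x, Tendsto (fun γ => φ γ x) (𝓝[<] 0) (𝓝 (φ 0 x)) := fun x =>
    ((ContinuousMap.evalCLM ℝ x).continuous.tendsto _).comp hφt
  have e1 : ∀ᶠ γ in 𝓝[<] 0, φ γ x₁ ≠ φ γ y₁ := by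
    have := ((hev x₁).sub (hev y₁)).eventually_ne (sub_ne_zero.2 hxy)
    filter_upwards [this] with γ hγ using sub_ne_zero.1 hγ
  have e2 : ∀ᶠ γ in 𝓝[<] 0, ∀ x, 0 < φ γ x := by
    have := (Metric.tendsto_nhds.1 hφt) η₂ hP.η₂_pos
    filter_upwards [this] with γ hγ x
    have h1 := (ContinuousMap.dist_apply_le_dist (f := φ γ) (g := φ 0) x).trans_lt hγ
    rw [Real.dist_eq] at h1
    have := (abs_lt.1 h1).1
    linarith [hpos0 x]
  have e3 : ∀ᶠ γ in 𝓝[<] 0, ‖V (φ γ, ψ γ) - V (φ 0, ψ 0)‖ ≤ μ / 2 := by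
    have := (Metric.tendsto_nhds.1 ((hVcont.tendsto _).comp hpair)) (μ / 2) (by linarith)
    filter_upwards [this] with γ hγ
    rw [← dist_eq_norm]; exact hγ.le
  have ht2 := (continuous_toL2.tendsto _).comp hφt
  -- The residual at the fixed vector χ tends to 0 by strong convergence, while the right side has a
  -- positive limit because φ₀ and χ are both positive.
  have e4 : ∀ᶠ γ in 𝓝[<] 0, ‖toL2 (φ γ)‖ * ‖linOp α β σ (kSymbol L hc γ) (φ γ) (ψ γ) (toL2 χ) -
      mulOp (V (φ 0, ψ 0)) (toL2 χ)‖ < |lam'| * ‖inner ℂ (toL2 (φ γ)) (toL2 χ)‖ := by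
    have t1 := tendsto_linOp_apply (α := α) (β := β) (σ := σ) hc nhdsWithin_le_nhds hφt hψt (toL2 χ)
    have t2 := ht2.norm.mul ((t1.sub_const (mulOp (V (φ 0, ψ 0)) (toL2 χ))).norm)
    rw [linOp_zero, sub_self, norm_zero, mul_zero] at t2
    have t3 := ((ht2.inner (𝕜 := ℂ) (tendsto_const_nhds (x := toL2 χ))).norm).const_mul |lam'|
    refine t2.eventually_lt t3 (mul_pos (abs_pos.2 hlam'.ne) (norm_pos_iff.2 ?_))
    exact inner_toL2_ne_zero_of_pos (fun x => hP.η₂_pos.trans_le (hpos0 x)) hχpos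
  have hall := ((e1.and e2).and (e3.and e4))
  rw [Filter.Eventually, mem_nhdsLT_iff_exists_Ioo_subset] at hall
  obtain ⟨l, hl, hsub⟩ := hall
  have hl : l < 0 := hl
  refine ⟨min (-l) γ₁, lt_min (by linarith) hγ₁, min_le_right _ _, fun γ hγ => ?_⟩
  have hγl : γ ∈ Ioo l 0 := ⟨by linarith [hγ.1, min_le_left (-l) γ₁], hγ.2⟩
  have hγ1 : γ ∈ Ioc (-γ₁) 0 := ⟨by linarith [hγ.1, min_le_right (-l) γ₁], hγ.2.le⟩
  obtain ⟨⟨a1, a2⟩, a3, a4⟩ := hsub hγl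
  exact ⟨opL_properties hα hβ hc hγ.2.le (h.wave γ hγ1) (a2 0).ne' a1 hμ hbound a3 hlam' hχ a4,
    h.wave γ hγ1, a2⟩

end SpectralProperties

/-! ### Projection onto real even functions -/

section Parity

variable {L : ℝ} [hL : Fact (0 < L)]

theorem fourier_apply_neg (n : ℤ) (x : AddCircle L) : fourier n (-x) = fourier (-n) x := by
  rw [fourier_apply, fourier_apply, smul_neg, neg_smul]

/-- Reflection `f(-x)` on `L²`. -/
def reflection : L2per L →L[ℝ] L2per L :=
  (Lp.compMeasurePreservingₗᵢ ℝ (Neg.neg : AddCircle L → AddCircle L)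
    (Measure.measurePreserving_neg haarAddCircle)).toContinuousLinearMap

/-- Complex conjugation on `L²`. -/
def conjugation : L2per L →L[ℝ] L2per L :=
  (Complex.conjCLE : ℂ →L[ℝ] ℂ).compLpL 2 haarAddCircle

theorem coeff_reflection (f : L2per L) (n : ℤ) :
    fourierBasis.repr (reflection f) n = fourierBasis.repr f (-n) := by
  rw [fourierBasis_repr, fourierBasis_repr, fourierCoeff, fourierCoeff,
    ← integral_neg_eq_self (fun t => fourier (-(-n)) t • f t)]
  refine integral_congr_ae ?_
  filter_upwards [Lp.coeFn_compMeasurePreserving f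
    (Measure.measurePreserving_neg (haarAddCircle (T := L)))] with x h
  have h1 : (reflection f) x = f (-x) := h
  rw [h1, fourier_apply_neg, neg_neg]

theorem coeff_conjugation (f : L2per L) (n : ℤ) :
    fourierBasis.repr (conjugation f) n = conj (fourierBasis.repr f (-n)) := by
  rw [fourierBasis_repr, fourierBasis_repr, fourierCoeff, fourierCoeff, ← integral_conj]
  refine integral_congr_ae ?_
  filter_upwards [(Complex.conjCLE : ℂ →L[ℝ] ℂ).coeFn_compLpL f] with x h
  have h1 : (conjugation f) x = conj (f x) := h
  rw [h1, smul_eq_mul, smul_eq_mul, map_mul, fourier_neg, fourier_neg, fourier_neg, Complex.conj_conj]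

/-- Real even Fourier coefficients. -/
def IsRealEven (f : L2per L) : Prop :=
  ∀ n, conj (fourierBasis.repr f n) = fourierBasis.repr f n ∧
    fourierBasis.repr f (-n) = fourierBasis.repr f n

/-- The projection onto the real even functions. -/
def realEvenPart : L2per L →L[ℝ] L2per L :=
  (1 / 4 : ℝ) • (ContinuousLinearMap.id ℝ _ + reflection + conjugation +
    reflection ∘L conjugation)

theorem coeff_realEvenPart (f : L2per L) (n : ℤ) : fourierBasis.repr (realEvenPart f) n =
    (1 / 4) * (fourierBasis.repr f n + fourierBasis.repr f (-n) +
      conj (fourierBasis.repr f (-n)) + conj (fourierBasis.repr f n)) := by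
  have e : realEvenPart f = ((1 / 4 : ℝ) : ℂ) • (f + reflection f + conjugation f +
    reflection (conjugation f)) := rfl
  rw [e, map_smul, map_add, map_add, map_add, lp.coeFn_smul, Pi.smul_apply, lp.coeFn_add,
    Pi.add_apply, lp.coeFn_add, Pi.add_apply, lp.coeFn_add, Pi.add_apply, coeff_reflection,
    coeff_conjugation, coeff_reflection, coeff_conjugation, neg_neg, smul_eq_mul]
  push_cast; ring

theorem isRealEven_realEvenPart (f : L2per L) : IsRealEven (realEvenPart f) := by
  intro n
  rw [coeff_realEvenPart, coeff_realEvenPart, neg_neg]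
  refine ⟨?_, by ring⟩
  simp only [map_mul, map_add, Complex.conj_conj, map_div₀, map_one, Complex.conj_ofNat]
  ring

theorem IsRealEven.realEvenPart_eq {f : L2per L} (h : IsRealEven f) : realEvenPart f = f := by
  refine coeff_ext fun n => ?_
  rw [coeff_realEvenPart, (h n).2, (h n).1]
  ring

theorem IsRealEven.of_coeff {f g : L2per L} (hf : IsRealEven f) {m : ℤ → ℝ}
    (hm : ∀ n, m (-n) = m n) (h : ∀ n, fourierBasis.repr g n = (m n : ℂ) * fourierBasis.repr f n) :
    IsRealEven g := by
  intro n
  rw [h, h, map_mul, Complex.conj_ofReal, (hf n).1, (hf n).2, hm]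
  exact ⟨rfl, rfl⟩

theorem reflection_toLp (g : C(AddCircle L, ℂ)) :
    reflection (ContinuousMap.toLp 2 haarAddCircle ℂ g) =
      ContinuousMap.toLp 2 haarAddCircle ℂ (g.comp ⟨fun x => -x, continuous_neg⟩) := by
  refine Lp.ext ?_
  have h0 := (Measure.measurePreserving_neg (haarAddCircle (T := L))).quasiMeasurePreserving.ae_eq_comp
    (ContinuousMap.coeFn_toLp (p := 2) (𝕜 := ℂ) haarAddCircle g)
  filter_upwards [h0, ContinuousMap.coeFn_toLp (p := 2) (𝕜 := ℂ) haarAddCircle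
    (g.comp ⟨fun x => -x, continuous_neg⟩), Lp.coeFn_compMeasurePreserving
    (ContinuousMap.toLp 2 haarAddCircle ℂ g : L2per L)
    (Measure.measurePreserving_neg (haarAddCircle (T := L)))] with x h1 h2 h3
  have h4 : (reflection (ContinuousMap.toLp 2 haarAddCircle ℂ g)) x = _ := h3
  rw [h4, h2]
  exact h1

theorem conjugation_toLp (g : C(AddCircle L, ℂ)) :
    conjugation (ContinuousMap.toLp 2 haarAddCircle ℂ g) =
      ContinuousMap.toLp 2 haarAddCircle ℂ (star g) := by
  refine Lp.ext ?_
  filter_upwards [ContinuousMap.coeFn_toLp (p := 2) (𝕜 := ℂ) haarAddCircle g,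
    ContinuousMap.coeFn_toLp (p := 2) (𝕜 := ℂ) haarAddCircle (star g),
    (Complex.conjCLE : ℂ →L[ℝ] ℂ).coeFn_compLpL
      (ContinuousMap.toLp 2 haarAddCircle ℂ g : L2per L)] with x h1 h2 h3
  have h4 : (conjugation (ContinuousMap.toLp 2 haarAddCircle ℂ g)) x = _ := h3
  rw [h4, h2, h1]
  rfl

theorem isRealEven_toL2 {h : C(AddCircle L, ℝ)} (hh : ∀ x, h (-x) = h x) : IsRealEven (toL2 h) := by
  have e1 : reflection (toL2 h) = toL2 h := by
    rw [toL2_eq, reflection_toLp]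
    congr 1; ext x
    change ((h (-x) : ℝ) : ℂ) = (h x : ℂ)
    rw [hh]
  have e2 : conjugation (toL2 h) = toL2 h := by
    rw [toL2_eq, conjugation_toLp]
    congr 1; ext x
    exact Complex.conj_ofReal _
  intro n
  have h1 := coeff_reflection (toL2 h) n
  have h2 := coeff_conjugation (toL2 h) n
  rw [e1] at h1
  rw [e2] at h2
  rw [← h1] at h2
  exact ⟨h2.symm, h1.symm⟩

theorem IsRealEven.exists_real {g : C(AddCircle L, ℂ)}
    (hg : IsRealEven (ContinuousMap.toLp 2 haarAddCircle ℂ g)) :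
    cplx (reC g) = g ∧ ∀ x, reC g (-x) = reC g x := by
  have e1 : g.comp ⟨fun x => -x, continuous_neg⟩ = g := toLp_injective (by
    rw [← reflection_toLp]
    exact coeff_ext fun n => by rw [coeff_reflection, (hg n).2])
  have e2 : star g = g := toLp_injective (by
    rw [← conjugation_toLp]
    exact coeff_ext fun n => by rw [coeff_conjugation, (hg n).2, (hg n).1])
  constructor
  · ext x
    have := DFunLike.congr_fun e2 x
    exact Complex.conj_eq_iff_re.1 this
  · intro x
    exact congrArg Complex.re (DFunLike.congr_fun e1 x)

end Parity

/-! ### Dependence of the multiplier on γ -/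

section Symbols

variable (L : ℝ) {c : ℝ} (hc : 0 < c)

theorem kReal_mul (hc : 0 < c) (γ : ℝ) (n : ℤ) :
    kReal L c γ n * (-(min γ 0) * |waveNumber L n| + c) = 1 :=
  inv_mul_cancel₀ (hc.trans_le (le_kReal_inv c γ n)).ne'

theorem one_add_I_mul_ne_zero (x : ℝ) : 1 + Complex.I * (x : ℂ) ≠ 0 := by
  intro h
  have := congrArg Complex.re h
  simp at this

theorem normSq_one_add_I_mul (x : ℝ) : ‖1 + Complex.I * (x : ℂ)‖ ^ 2 = 1 + x ^ 2 := by
  rw [← Complex.normSq_eq_norm_sq, Complex.normSq_apply]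
  simp; ring

theorem one_le_norm_one_add_I_mul (x : ℝ) : 1 ≤ ‖1 + Complex.I * (x : ℂ)‖ := by
  have := normSq_one_add_I_mul x
  nlinarith [norm_nonneg (1 + Complex.I * (x : ℂ)), sq_nonneg x]

theorem abs_le_norm_one_add_I_mul (x : ℝ) : |x| ≤ ‖1 + Complex.I * (x : ℂ)‖ :=
  abs_le_of_sq_le_sq (by rw [normSq_one_add_I_mul]; linarith [sq_nonneg x]) (norm_nonneg _)

/-- The symbol of `(1 + d/dx)⁻¹`. -/
def resolventSymbol : lp (fun _ : ℤ => ℂ) ∞ :=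
  bddSymbol (fun n => (1 + Complex.I * (waveNumber L n : ℂ))⁻¹) 1 fun n => by
    rw [norm_inv]
    exact inv_le_one_of_one_le₀ (one_le_norm_one_add_I_mul _)

/-- The symbol of `𝓚_γ⁻¹ (1 + d/dx)⁻¹`. -/
def kResolventSymbol (γ : ℝ) : lp (fun _ : ℤ => ℂ) ∞ := kSymbol L hc γ * resolventSymbol L

theorem fmul_mul [Fact (0 < L)] (a b : lp (fun _ : ℤ => ℂ) ∞) (f : L2per L) :
    fmul (a * b) f = fmul a (fmul b f) := by
  refine coeff_ext fun n => ?_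
  rw [coeff_fmul, coeff_fmul, coeff_fmul, lp.infty_coeFn_mul, Pi.mul_apply, mul_assoc]

/-- For γ, γ' ≤ 0 the symbols differ by k_γ k_γ'(γ - γ')|ω|, and the unbounded factor |ω| is
absorbed by (1 + iω)⁻¹. One derivative is thus traded for norm continuity up to γ = 0. -/
theorem lipschitz_kResolventSymbol (γ γ' : ℝ) :
    ‖kResolventSymbol L hc γ - kResolventSymbol L hc γ'‖ ≤ (c⁻¹) ^ 2 * |γ - γ'| := by
  refine lp.norm_le_of_forall_le (by positivity) fun n => ?_
  have e : (kResolventSymbol L hc γ - kResolventSymbol L hc γ') n =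
      (((kReal L c γ n - kReal L c γ' n : ℝ)) : ℂ) *
        (1 + Complex.I * (waveNumber L n : ℂ))⁻¹ := by
    rw [lp.coeFn_sub, Pi.sub_apply, kResolventSymbol, kResolventSymbol, lp.infty_coeFn_mul,
      lp.infty_coeFn_mul, Pi.mul_apply, Pi.mul_apply, ← sub_mul, Complex.ofReal_sub]
    rfl
  have h1 := kReal_mul (L := L) hc γ n
  have h2 := kReal_mul (L := L) hc γ' n
  have e2 : kReal L c γ n - kReal L c γ' n =
      kReal L c γ n * kReal L c γ' n * ((min γ 0 - min γ' 0) * |waveNumber L n|) := by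
    linear_combination kReal L c γ' n * h1 - kReal L c γ n * h2
  rw [e, e2, norm_mul, norm_inv, Complex.norm_real, ← div_eq_mul_inv,
    div_le_iff₀ (zero_lt_one.trans_le (one_le_norm_one_add_I_mul _)), Real.norm_eq_abs, abs_mul,
    abs_mul (min γ 0 - min γ' 0), abs_abs, abs_of_pos (mul_pos (kReal_pos hc γ n) (kReal_pos hc γ' n)), ← mul_assoc]
  have h3 : kReal L c γ n * kReal L c γ' n ≤ (c⁻¹) ^ 2 := by
    rw [sq]
    exact mul_le_mul (kReal_le hc γ n) (kReal_le hc γ' n) (kReal_pos hc γ' n).le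
      (inv_nonneg.2 hc.le)
  have h4 : |min γ 0 - min γ' 0| ≤ |γ - γ'| := by
    simpa using abs_min_sub_min_le_max γ 0 γ' 0
  exact mul_le_mul (mul_le_mul h3 h4 (abs_nonneg _) (by positivity))
    (abs_le_norm_one_add_I_mul _) (abs_nonneg _) (by positivity)

theorem continuous_kResolventSymbol : Continuous (kResolventSymbol L hc) := by
  refine (LipschitzWith.of_dist_le_mul (K := ⟨(c⁻¹) ^ 2, by positivity⟩) fun γ γ' => ?_).continuous
  rw [dist_eq_norm, Real.dist_eq]
  exact lipschitz_kResolventSymbol L hc γ γ'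

/-- Near γ₀ the symbol is k_γ₀ (1 - (γ - γ₀)d)⁻¹ with d = |ω|k_γ₀, an inverse in the Banach algebra
ℓ^∞. The bound d ≤ 1/|γ₀| shows why this argument stops at γ₀ = 0. -/
theorem contDiffAt_kSymbol {γ₀ : ℝ} (hγ₀ : γ₀ < 0) {n : WithTop ℕ∞} :
    ContDiffAt ℝ n (kSymbol L hc) γ₀ := by
  have hb : ∀ n : ℤ, ‖((|waveNumber L n| * kReal L c γ₀ n : ℝ) : ℂ)‖ ≤ (-γ₀)⁻¹ := by
    intro n
    have h1 := abs_nonneg (waveNumber L n)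
    have h2 := kReal_pos (L := L) hc γ₀ n
    rw [Complex.norm_real, Real.norm_of_nonneg (mul_nonneg h1 h2.le), kReal, min_eq_left hγ₀.le,
      ← div_eq_mul_inv, div_le_iff₀ (by nlinarith), inv_mul_eq_div, le_div_iff₀ (by linarith)]
    nlinarith
  set d : lp (fun _ : ℤ => ℂ) ∞ := bddSymbol _ _ hb with hd
  have hx : ContDiffAt ℝ n (fun γ : ℝ => 1 - (γ - γ₀) • d) γ₀ := by fun_prop
  have hinv : ContDiffAt ℝ n (fun γ : ℝ => Ring.inverse (1 - (γ - γ₀) • d)) γ₀ := by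
    refine ContDiffAt.comp γ₀ (g := Ring.inverse) ?_ hx
    have := contDiffAt_ringInverse ℝ (n := n) (1 : (lp (fun _ : ℤ => ℂ) ∞)ˣ)
    simpa using this
  have hk : ContDiffAt ℝ n
      (fun γ : ℝ => kSymbol L hc γ₀ * Ring.inverse (1 - (γ - γ₀) • d)) γ₀ :=
    contDiffAt_const.mul hinv
  refine hk.congr_of_eventuallyEq ?_
  have hu : ∀ᶠ γ : ℝ in 𝓝 γ₀, IsUnit (1 - (γ - γ₀) • d) := by
    refine hx.continuousAt.eventually (Units.isOpen.mem_nhds ?_)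
    simp
  filter_upwards [hu, Iio_mem_nhds hγ₀] with γ h1 h2
  rw [← Ring.mul_inverse_cancel_right _ (kSymbol L hc γ) h1]
  congr 1
  refine lp.ext (funext fun n => ?_)
  rw [lp.infty_coeFn_mul, Pi.mul_apply]
  change (kReal L c γ n : ℂ) * ((1 : ℂ) - ((γ - γ₀ : ℝ) : ℂ) *
    ((|waveNumber L n| * kReal L c γ₀ n : ℝ) : ℂ)) = (kReal L c γ₀ n : ℂ)
  have h2 : γ < 0 := h2
  have h3 := kReal_mul (L := L) hc γ n
  have h4 := kReal_mul (L := L) hc γ₀ n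
  rw [min_eq_left h2.le] at h3
  rw [min_eq_left hγ₀.le] at h4
  have e : kReal L c γ n * (1 - (γ - γ₀) * (|waveNumber L n| * kReal L c γ₀ n)) =
      kReal L c γ₀ n := by
    linear_combination kReal L c γ₀ n * h3 - kReal L c γ n * h4
  exact_mod_cast e

end Symbols

/-! ### The traveling wave equation as a fixed point problem -/

section WaveMap

variable {L : ℝ} [hL : Fact (0 < L)]

/-- `(1 + d/dx)(φ²)` for `φ = (1 - d²/dx²)⁻¹ u`. -/
def sqH1 (u : L2per L) : L2per L :=
  ContinuousMap.toLp 2 haarAddCircle ℂ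
    (greenC L u * greenC L u + (greenC' L u * greenC L u + greenC L u * greenC' L u))

theorem coeff_sqH1 (u : L2per L) (n : ℤ) : fourierBasis.repr (sqH1 u) n =
    (1 + Complex.I * waveNumber L n) * fourierCoeff (greenC L u * greenC L u) n := by
  have hd : ∀ n, fourierBasis.repr (ContinuousMap.toLp 2 haarAddCircle ℂ (greenC' L u) : L2per L) n =
      Complex.I * waveNumber L n * fourierCoeff (greenC L u) n := fun n => by
    rw [coeff_toLp, fourierCoeff_greenC']
  have h := ddx_mul hd hd n
  rw [mulC_toLp, ← map_add, coeff_toLp] at h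
  rw [sqH1, coeff_toLp, fourierCoeff_add', mul_comm (greenC' L u), h, add_mul, one_mul]

theorem fmul_resolventSymbol_sqH1 (u : L2per L) : fmul (resolventSymbol L) (sqH1 u) =
    ContinuousMap.toLp 2 haarAddCircle ℂ (greenC L u * greenC L u) := by
  refine coeff_ext fun n => ?_
  rw [coeff_fmul, coeff_sqH1, coeff_toLp, ← mul_assoc]
  change (1 + Complex.I * (waveNumber L n : ℂ))⁻¹ * _ * _ = _
  rw [inv_mul_cancel₀ (one_add_I_mul_ne_zero _), one_mul]

theorem fmul_kResolventSymbol_sqH1 {c : ℝ} (hc : 0 < c) (γ : ℝ) (u : L2per L) :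
    fmul (kResolventSymbol L hc γ) (sqH1 u) =
      fmul (kSymbol L hc γ) (ContinuousMap.toLp 2 haarAddCircle ℂ (greenC L u * greenC L u)) := by
  rw [kResolventSymbol, fmul_mul, fmul_resolventSymbol_sqH1]

/-- The nonlinearity of the traveling wave equation for `u = φ - φ''`. -/
def waveTerm (α β σ : ℝ) (p : lp (fun _ : ℤ => ℂ) ∞ × L2per L) : L2per L :=
  (1 - σ) • green L p.2 + (α * β) • mulC (greenC L p.2) (fmul p.1 (sqH1 p.2))

/-- The traveling wave equation for `u = φ - φ''` among real even functions. -/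
def waveMap (α β σ : ℝ) (p : lp (fun _ : ℤ => ℂ) ∞ × L2per L) : L2per L :=
  p.2 - realEvenPart (waveTerm α β σ p)

theorem contDiff_sqH1 {n : WithTop ℕ∞} : ContDiff ℝ n (sqH1 : L2per L → L2per L) := by
  have h1 : ContDiff ℝ n (fun u : L2per L => greenC L u) := ((greenC L).restrictScalars ℝ).contDiff
  have h2 : ContDiff ℝ n (fun u : L2per L => greenC' L u) :=
    ((greenC' L).restrictScalars ℝ).contDiff
  exact ((ContinuousMap.toLp 2 haarAddCircle ℂ :
    C(AddCircle L, ℂ) →L[ℂ] L2per L).restrictScalars ℝ).contDiff.comp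
    ((h1.mul h1).add ((h2.mul h1).add (h1.mul h2)))

/-- Jointly in the multiplier and u the equation is built from bounded real-linear and multilinear
maps. With the multiplier as an independent variable, the limited regularity in γ at 0 plays no role
here. -/
theorem contDiff_waveMap (α β σ : ℝ) {n : WithTop ℕ∞} :
    ContDiff ℝ n (waveMap α β σ : lp (fun _ : ℤ => ℂ) ∞ × L2per L → L2per L) := by
  have h1 : ContDiff ℝ n (fun p : lp (fun _ : ℤ => ℂ) ∞ × L2per L => greenC L p.2) :=
    ((greenC L).restrictScalars ℝ).contDiff.comp contDiff_snd
  have h2 : ContDiff ℝ n (fun p : lp (fun _ : ℤ => ℂ) ∞ × L2per L => green L p.2) :=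
    ((green L).restrictScalars ℝ).contDiff.comp contDiff_snd
  have h3 : ContDiff ℝ n (fun p : lp (fun _ : ℤ => ℂ) ∞ × L2per L => fmul p.1 (sqH1 p.2)) :=
    ((fmul (L := L).bilinearRestrictScalars ℝ).contDiff.comp contDiff_fst).clm_apply
      (contDiff_sqH1.comp contDiff_snd)
  have h4 : ContDiff ℝ n (fun p : lp (fun _ : ℤ => ℂ) ∞ × L2per L =>
      mulC (greenC L p.2) (fmul p.1 (sqH1 p.2))) :=
    ((mulC (L := L).bilinearRestrictScalars ℝ).contDiff.comp h1).clm_apply h3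
  exact contDiff_snd.sub ((realEvenPart (L := L)).contDiff.comp
    ((h2.const_smul _).add (h4.const_smul _)))

variable {α β c σ γ : ℝ} {φ ψ : C(AddCircle L, ℝ)}

theorem kReal_neg (c γ : ℝ) (n : ℤ) : kReal L c γ (-n) = kReal L c γ n := by
  rw [kReal, kReal, waveNumber_neg, abs_neg]

theorem IsRealEven.exists_greenC {u : L2per L} (hu : IsRealEven u) :
    ∃ φ : C(AddCircle L, ℝ), cplx φ = greenC L u ∧ ∀ x, φ (-x) = φ x := by
  have h : IsRealEven (ContinuousMap.toLp 2 haarAddCircle ℂ (greenC L u) : L2per L) := by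
    rw [toLp_greenC]
    exact hu.of_coeff (m := fun n => (1 + waveNumber L n ^ 2)⁻¹)
      (fun n => by rw [waveNumber_neg, neg_sq]) (coeff_green u)
  exact ⟨_, h.exists_real⟩

theorem waveTerm_eq (hc : 0 < c) {u : L2per L} (hφ : cplx φ = greenC L u)
    (hψ : toL2 ψ = -((β : ℂ) • fmul (kSymbol L hc γ) (toL2 (φ * φ)))) :
    waveTerm α β σ (kResolventSymbol L hc γ, u) = toL2 ((1 - σ) • φ - α • (ψ * φ)) := by
  have h1 : green L u = toL2 φ := by rw [toL2_eq, hφ, toLp_greenC]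
  have h2 : toL2 ((1 - σ) • φ - α • (ψ * φ)) = ((1 - σ : ℝ) : ℂ) • toL2 φ -
      (α : ℂ) • mulOp φ (toL2 ψ) := by
    rw [mulOp_toL2, toL2_eq, toL2_eq, toL2_eq, ← map_smul, ← map_smul, ← map_sub]
    congr 1
    ext x
    simp [cplx, mul_comm]
  rw [h2, hψ, waveTerm, fmul_kResolventSymbol_sqH1, h1, ← hφ, ← cplx_mul, ← toL2_eq, ← mulOp_eq,
    map_neg, map_smul, smul_neg, sub_neg_eq_add, smul_smul, ← Complex.ofReal_mul, Complex.coe_smul,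
    Complex.coe_smul]
  rfl

/-- With u = φ - φ'' the fixed point equation reads φ - φ'' = (1 - σ)φ - αψφ, and the formula for ψ
is the second equation multiplied by 𝓚_γ⁻¹. -/
theorem isTravelingWave_of_fixedPoint (hc : 0 < c) (hγ : γ ≤ 0) {u : L2per L}
    (hφ : cplx φ = greenC L u)
    (hψ : toL2 ψ = -((β : ℂ) • fmul (kSymbol L hc γ) (toL2 (φ * φ))))
    (hu : waveTerm α β σ (kResolventSymbol L hc γ, u) = u) :
    IsTravelingWave α β γ c σ φ ψ := by
  have h1 : toL2 φ = green L u := by rw [toL2_eq, hφ, toLp_greenC]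
  rw [waveTerm_eq hc hφ hψ] at hu
  obtain ⟨hmem', hlap'⟩ : ∃ h : toL2 φ ∈ (negLaplacian L).domain,
      negLaplacian L ⟨toL2 φ, h⟩ = u - toL2 φ := by
    rw [h1]; exact green_mem u
  -- The symbol |ω|/(1 + iω) is bounded, so Dψ is a bounded multiplier applied to (1 + d/dx)φ². This
  -- puts ψ in H¹ without any smoothing from 𝓚_γ⁻¹, hence also for γ = 0.
  have hs : ∀ n, ‖((|waveNumber L n| : ℝ) : ℂ) * (1 + Complex.I * (waveNumber L n : ℂ))⁻¹‖ ≤ 1 := by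
    intro n
    rw [norm_mul, norm_inv, Complex.norm_real, Real.norm_eq_abs, abs_abs, ← div_eq_mul_inv]
    exact div_le_one_of_le₀ (abs_le_norm_one_add_I_mul _) (norm_nonneg _)
  obtain ⟨hψmem, hψe⟩ := exists_fourierMul_eq (f := toL2 ψ)
    (m := fun n => ((|waveNumber L n| : ℝ) : ℂ))
    (w := -((β : ℂ) • fmul (kSymbol L hc γ) (fmul (bddSymbol _ 1 hs) (sqH1 u)))) fun n => by
      rw [hψ, map_neg, lp.coeFn_neg, Pi.neg_apply, map_smul, lp.coeFn_smul, Pi.smul_apply,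
        coeff_kSymbol, coeff_fmul, coeff_sqH1, map_neg, lp.coeFn_neg, Pi.neg_apply, map_smul,
        lp.coeFn_smul, Pi.smul_apply, coeff_kSymbol, toL2_eq, coeff_toLp, cplx_mul, hφ, smul_eq_mul,
        smul_eq_mul]
      change -(_ * (_ * ((_ * (1 + Complex.I * (waveNumber L n : ℂ))⁻¹) * _))) = _
      have := one_add_I_mul_ne_zero (waveNumber L n)
      field_simp
  refine ⟨hmem', hψmem, ?_, ?_⟩
  · rw [hlap', ← hu]
    have e : toL2 ((1 - σ) • φ - α • (ψ * φ)) = ((1 - σ : ℝ) : ℂ) • toL2 φ -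
        (α : ℂ) • toL2 (ψ * φ) := by
      rw [toL2_eq, toL2_eq, toL2_eq, ← map_smul, ← map_smul, ← map_sub]
      congr 1
      ext x
      simp [cplx]
    rw [e]
    push_cast
    module
  · refine coeff_ext fun n => ?_
    have h2 := congrArg (fun f => fourierBasis.repr f n) hψ
    simp only at h2
    rw [map_neg, lp.coeFn_neg, Pi.neg_apply, map_smul, lp.coeFn_smul, Pi.smul_apply, coeff_kSymbol,
      smul_eq_mul] at h2
    rw [map_sub, lp.coeFn_sub, Pi.sub_apply, map_smul, map_smul, map_smul, lp.coeFn_smul,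
      lp.coeFn_smul, lp.coeFn_smul, Pi.smul_apply, Pi.smul_apply, Pi.smul_apply, coeff_absD,
      smul_eq_mul, smul_eq_mul, smul_eq_mul]
    simp only
    rw [h2]
    have h3 := kReal_mul (L := L) hc γ n
    rw [min_eq_left hγ] at h3
    have h4 : (kReal L c γ n : ℂ) * (-(γ : ℂ) * ((|waveNumber L n| : ℝ) : ℂ) + c) = 1 := by
      exact_mod_cast h3
    linear_combination ((β : ℂ) * fourierBasis.repr (toL2 (φ * φ)) n) * h4

theorem cplx_injective : Function.Injective (cplx : C(AddCircle L, ℝ) → C(AddCircle L, ℂ)) :=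
  fun f g h => by rw [← reC_cplx f, h, reC_cplx]

/-- The weight `(1 + n²)^{1/2}/(1 + iω)`. -/
theorem norm_weight_le (n : ℤ) :
    ‖(((1 + (n : ℝ) ^ 2) ^ ((1 : ℝ) / 2) : ℝ) : ℂ) * (1 + Complex.I * (waveNumber L n : ℂ))⁻¹‖ ≤
      1 + L / (2 * Real.pi) := by
  have hL0 := hL.out
  have hx := one_le_norm_one_add_I_mul (waveNumber L n)
  have hy := abs_le_norm_one_add_I_mul (waveNumber L n)
  have e : |(n : ℝ)| = L / (2 * Real.pi) * |waveNumber L n| := by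
    rw [← abs_of_pos (by positivity : 0 < L / (2 * Real.pi)), ← abs_mul]
    congr 1
    have := Real.pi_ne_zero
    unfold waveNumber; field_simp
  rw [norm_mul, norm_inv, ← div_eq_mul_inv, div_le_iff₀ (by linarith), Complex.norm_real,
    ← Real.sqrt_eq_rpow, Real.norm_of_nonneg (Real.sqrt_nonneg _)]
  refine (Real.sqrt_le_iff.2 ⟨by positivity, ?_⟩ : _ ≤ 1 + |(n : ℝ)|).trans ?_
  · rw [← sq_abs (n : ℝ)]; nlinarith [abs_nonneg (n : ℝ)]
  · rw [e]
    have h0 : 0 < L / (2 * Real.pi) := by positivity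
    nlinarith

theorem norm_weight_two_le (n : ℤ) :
    ‖((((1 + (n : ℝ) ^ 2) * (1 + waveNumber L n ^ 2)⁻¹ : ℝ)) : ℂ)‖ ≤
      1 + (L / (2 * Real.pi)) ^ 2 := by
  rw [Complex.norm_real, Real.norm_of_nonneg (by positivity), ← div_eq_mul_inv,
    div_le_iff₀ (by positivity), sq_eq_waveNumber L n]
  nlinarith [sq_nonneg (L / (2 * Real.pi)), sq_nonneg (waveNumber L n)]

end WaveMap

/-! ### Invertibility of the linearization at the dnoidal wave -/

section Linearization

variable {L : ℝ} [hL : Fact (0 < L)] {α β c σ γ : ℝ} {φ ψ : C(AddCircle L, ℝ)}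

theorem IsDnoidalWave.even (hα : 0 < α) (hβ : 0 < β) (hc : 0 < c) (h : IsDnoidalWave α β c σ φ ψ)
    (x : AddCircle L) : φ (-x) = φ x := by
  obtain ⟨η₁, η₂, Φ, Φ', hP, -, hφ, -⟩ := h.exists_profile hα hβ hc
  induction x using QuotientAddGroup.induction_on with
  | H x =>
    change φ ((-x : ℝ) : AddCircle L) = φ (x : AddCircle L)
    rw [hφ, hφ, hP.even]

theorem toL2_smul (r : ℝ) (g : C(AddCircle L, ℝ)) : toL2 (r • g) = (r : ℂ) • toL2 g := by
  rw [toL2_eq, toL2_eq, ← map_smul]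
  congr 1; ext x; simp [cplx]

theorem IsDnoidalWave.toL2_snd (hα : 0 < α) (hβ : 0 < β) (hc : 0 < c)
    (h : IsDnoidalWave α β c σ φ ψ) :
    toL2 ψ = -((β : ℂ) • fmul (kSymbol L hc 0) (toL2 (φ * φ))) := by
  obtain ⟨η₁, η₂, Φ, Φ', -, -, -, hψ⟩ := h.exists_profile hα hβ hc
  have e : ψ = (-(β / c)) • (φ * φ) := by
    ext x
    change ψ x = -(β / c) * (φ x * φ x)
    rw [hψ, sq]
  rw [fmul_kSymbol_zero, smul_smul, ← Complex.ofReal_mul, ← neg_smul, ← Complex.ofReal_neg,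
    ← toL2_smul, ← div_eq_mul_inv, ← e]

theorem real_smul_L2per (r : ℝ) (f : L2per L) : r • f = (r : ℂ) • f := rfl

/-- The dnoidal wave solves the traveling wave equation for `γ = 0`. -/
theorem IsDnoidalWave.exists_fixedPoint (hα : 0 < α) (hβ : 0 < β) (hc : 0 < c)
    (h : IsDnoidalWave α β c σ φ ψ) :
    ∃ u : L2per L, cplx φ = greenC L u ∧ waveTerm α β σ (kResolventSymbol L hc 0, u) = u := by
  obtain ⟨η₁, η₂, Φ, Φ', hP, hσ, hφ, hψ⟩ := h.exists_profile hα hβ hc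
  have hc' : Continuous Φ' := continuous_iff_continuousAt.2 fun x => (hP.deriv' x).continuousAt
  have hg := mem_graph_of_hasDerivAt (V := σ • (1 : C(AddCircle L, ℝ)) + α • ψ) (u := φ)
    (u' := circleLift Φ' hc' hP.periodic') (lam := 0) (fun x => by
      rw [circleLift_coe]
      exact (hP.deriv x).congr_of_eventuallyEq (Eventually.of_forall hφ)) fun x => by
        refine ((hP.deriv' x).congr_of_eventuallyEq
          (Eventually.of_forall fun y => circleLift_coe _ _ y)).congr_deriv ?_
        change _ = (σ * 1 + α * ψ (x : AddCircle L) - 0) * φ (x : AddCircle L)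
        rw [hψ, hφ, ← hσ]
        field_simp
        ring
  obtain ⟨hd, he⟩ := mem_graph_perturbed.1 hg
  have hu : cplx φ = greenC L (negLaplacian L ⟨toL2 φ, hd⟩ + toL2 φ) := toLp_injective (by
    rw [toLp_greenC]
    exact (green_apply ⟨toL2 φ, hd⟩).symm)
  refine ⟨_, hu, ?_⟩
  rw [waveTerm_eq hc hu (h.toL2_snd hα hβ hc), he, mulOp_toL2]
  rw [Complex.ofReal_zero, zero_smul, zero_sub, neg_add_eq_sub]
  have e : toL2 φ - toL2 ((σ • (1 : C(AddCircle L, ℝ)) + α • ψ) * φ) =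
      toL2 (φ - (σ • (1 : C(AddCircle L, ℝ)) + α • ψ) * φ) := by
    rw [toL2_eq, toL2_eq, toL2_eq, ← map_sub]
    congr 1; ext x; simp [cplx]
  rw [e]
  congr 1
  ext x
  change (1 - σ) * φ x - α * (ψ x * φ x) = φ x - (σ * 1 + α * ψ x) * φ x
  ring

/-- The linearization at the dnoidal wave has no even kernel. -/
theorem IsDnoidalWave.eq_zero_of_even (hα : 0 < α) (hβ : 0 < β) (hc : 0 < c)
    (h : IsDnoidalWave α β c σ φ ψ) {f : L2per L}
    (hf : (f, 0) ∈ (perturbed (mulOp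
      (σ • (1 : C(AddCircle L, ℝ)) + α • ψ - (2 * α * β / c) • (φ * φ)))).graph)
    (heven : ∀ n, fourierBasis.repr f (-n) = fourierBasis.repr f n) : f = 0 := by
  obtain ⟨u, hu, hfix⟩ := h.exists_fixedPoint hα hβ hc
  have hwave := isTravelingWave_of_fixedPoint hc le_rfl hu (h.toL2_snd hα hβ hc) hfix
  have hφe := h.even hα hβ hc
  obtain ⟨η₁, η₂, Φ, Φ', hP, hσ, hφ, hψ⟩ := h.exists_profile hα hβ hc
  have hV := linearizedPotential_eq (L := L) hc hσ hφ hψ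
  obtain ⟨μ, hμ, hbound⟩ := hP.formBound hV
  obtain ⟨lam, hlam, χ, hχpos, -, hχ⟩ := hP.exists_negative_eigenvector hφ hV
  obtain ⟨x, y, hxy⟩ := hP.exists_ne hφ
  have hd := mem_ddx_of_mem_negLaplacian hwave.negLaplacian_eq.1
  have hker := hwave.ddx_mem_graph le_rfl hc hd
  rw [linOp_zero] at hker
  set V : C(AddCircle L, ℝ) := σ • (1 : C(AddCircle L, ℝ)) + α • ψ - (2 * α * β / c) • (φ * φ)
  by_contra hf0
  have m1 := mem_opEigenspace_iff.2 hχ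
  have m2 : ddx L ⟨toL2 φ, hd⟩ ∈ opEigenspace (perturbed (mulOp V)) ((0 : ℝ) : ℂ) := by
    rw [mem_opEigenspace_iff]; simpa using hker
  have m3 : f ∈ opEigenspace (perturbed (mulOp V)) ((0 : ℝ) : ℂ) := by
    rw [mem_opEigenspace_iff]; simpa using hf
  have hne : (lam : ℂ) ≠ ((0 : ℝ) : ℂ) := by exact_mod_cast hlam.ne
  -- The derivative φ' is odd and f is even. With the ground state, they would be three orthogonal
  -- eigenvectors with eigenvalues at most 0.
  have hodd : inner ℂ (ddx L ⟨toL2 φ, hd⟩) f = 0 := by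
    have h1 := inner_eq_tsum_coeff (ddx L ⟨toL2 φ, hd⟩) f
    have h2 := h1
    rw [← (Equiv.neg ℤ).tsum_eq] at h2
    have h3 : inner ℂ (ddx L ⟨toL2 φ, hd⟩) f = -inner ℂ (ddx L ⟨toL2 φ, hd⟩) f := by
      conv_lhs => rw [h2]
      rw [h1, ← tsum_neg]
      refine tsum_congr fun n => ?_
      have h4 := (isRealEven_toL2 hφe n).2
      rw [Equiv.neg_apply, heven, coeff_ddx, coeff_ddx, waveNumber_neg]
      simp only
      rw [h4]
      push_cast
      simp only [map_mul, map_neg]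
      ring
    exact self_eq_neg.1 h3
  exact hbound.false_of_three_eigenvectors hμ m1 m2 m3 (toL2_ne_zero (hχpos 0).ne')
    (ddx_ne_zero hd hxy) hf0 (inner_eigenvectors_eq_zero (inner_mulOp V) m1 m2 hne)
    (inner_eigenvectors_eq_zero (inner_mulOp V) m1 m3 hne) hodd hlam.le le_rfl le_rfl

/-- The compact part of the linearization at a solution for `γ = 0`. -/
def waveDeriv (α β c σ : ℝ) (φ : C(AddCircle L, ℝ)) : L2per L →L[ℝ] L2per L :=
  realEvenPart ∘L ((1 - σ) • ContinuousLinearMap.id ℝ _ +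
    (3 * (α * β) / c) • (mulOp (φ * φ)).restrictScalars ℝ) ∘L (green L).restrictScalars ℝ

theorem waveDeriv_apply (v : L2per L) : waveDeriv α β c σ φ v = realEvenPart
    ((1 - σ) • green L v + (3 * (α * β) / c) • mulOp (φ * φ) (green L v)) := rfl

theorem waveMap_zero (hc : 0 < c) (u : L2per L) :
    waveMap α β σ (kResolventSymbol L hc 0, u) = u - realEvenPart ((1 - σ) • green L u +
      (α * β / c) • ContinuousMap.toLp 2 haarAddCircle ℂ (greenC L u ^ 3)) := by
  rw [waveMap, waveTerm, fmul_kResolventSymbol_sqH1, fmul_kSymbol_zero, map_smul, mulC_toLp,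
    real_smul_L2per (α * β), smul_smul, ← Complex.ofReal_mul, ← div_eq_mul_inv,
    ← real_smul_L2per]
  congr 5
  ring

theorem hasFDerivAt_waveMap_zero (hc : 0 < c) {u : L2per L} (hφ : cplx φ = greenC L u) :
    HasFDerivAt (fun v => waveMap α β σ (kResolventSymbol L hc 0, v))
      (ContinuousLinearMap.id ℝ _ - waveDeriv α β c σ φ) u := by
  simp only [waveMap_zero]
  have h1 : HasFDerivAt (fun v : L2per L => greenC L v) ((greenC L).restrictScalars ℝ) u :=
    ((greenC L).restrictScalars ℝ).hasFDerivAt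
  have h2 : HasFDerivAt (fun v : L2per L => green L v) ((green L).restrictScalars ℝ) u :=
    ((green L).restrictScalars ℝ).hasFDerivAt
  have h3 := ((ContinuousMap.toLp 2 haarAddCircle ℂ :
    C(AddCircle L, ℂ) →L[ℂ] L2per L).restrictScalars ℝ).hasFDerivAt.comp u (h1.pow 3)
  have h4 := ((realEvenPart (L := L)).hasFDerivAt.comp u
    ((h2.const_smul (1 - σ)).add (h3.const_smul (α * β / c))))
  refine ((hasFDerivAt_id u).sub h4).congr_fderiv ?_
  ext1 v
  change v - realEvenPart ((1 - σ) • green L v + (α * β / c) •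
    ContinuousMap.toLp 2 haarAddCircle ℂ ((3 • greenC L u ^ 2) * greenC L v)) =
    v - waveDeriv α β c σ φ v
  rw [waveDeriv_apply, ← toLp_greenC v, mulOp_eq, mulC_toLp, cplx_mul, hφ, smul_mul_assoc, map_nsmul,
    ← Nat.cast_smul_eq_nsmul ℝ, smul_smul, sq]
  congr 4
  push_cast; ring

theorem isCompactOperator_waveDeriv : IsCompactOperator (waveDeriv (L := L) α β c σ φ) := by
  have h : IsCompactOperator (green L) := isCompactOperator_green
  have h2 := h.continuous_comp (g := fun v => realEvenPart
    ((1 - σ) • v + (3 * (α * β) / c) • mulOp (φ * φ) v)) (by fun_prop)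
  exact h2

/-- The linearization at the dnoidal wave is invertible. -/
theorem IsDnoidalWave.isInvertible (hα : 0 < α) (hβ : 0 < β) (hc : 0 < c)
    (h : IsDnoidalWave α β c σ φ ψ) :
    (ContinuousLinearMap.id ℝ (L2per L) - waveDeriv α β c σ φ).IsInvertible := by
  have hφe := h.even hα hβ hc
  have key : (1 : ℝ) ∈ resolventSet ℝ (waveDeriv (L := L) α β c σ φ) := by
    refine ((isCompactOperator_waveDeriv).hasEigenvalue_or_mem_resolventSet
      one_ne_zero).resolve_left fun hev => ?_
    obtain ⟨v, hv⟩ := hev.exists_hasEigenvector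
    have hv1 : waveDeriv α β c σ φ v = v := by simpa using hv.apply_eq_smul
    have hv0 := hv.2
    -- A fixed vector lies in the range of the projection; the projection then acts trivially on the
    -- remaining term, and the equation says that (1 - d²/dx²)⁻¹v is in the kernel of 𝓛₀.
    have hre : IsRealEven v := by
      rw [← hv1, waveDeriv_apply]; exact isRealEven_realEvenPart _
    obtain ⟨g, hg, hge⟩ := hre.exists_greenC
    have hgr : green L v = toL2 g := by rw [toL2_eq, hg, toLp_greenC]
    have hsum : (1 - σ) • green L v + (3 * (α * β) / c) • mulOp (φ * φ) (green L v) =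
        toL2 ((1 - σ) • g + (3 * (α * β) / c) • (φ * φ * g)) := by
      rw [hgr, mulOp_toL2, real_smul_L2per, real_smul_L2per, toL2_eq, toL2_eq, toL2_eq,
        ← map_smul, ← map_smul, ← map_add]
      congr 1; ext x; simp [cplx]
    have heven : ∀ x, ((1 - σ) • g + (3 * (α * β) / c) • (φ * φ * g)) (-x) =
        ((1 - σ) • g + (3 * (α * β) / c) • (φ * φ * g)) x := fun x => by
      simp only [ContinuousMap.add_apply, ContinuousMap.smul_apply, ContinuousMap.mul_apply, hge, hφe]
    rw [waveDeriv_apply, hsum, (isRealEven_toL2 heven).realEvenPart_eq] at hv1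
    refine hv0 (green_injective (h.eq_zero_of_even hα hβ hc (f := green L v) ?_ fun n => ?_))
    · rw [mem_graph_perturbed]
      obtain ⟨hm, he⟩ := green_mem v
      refine ⟨hm, he.trans ?_⟩
      obtain ⟨η₁, η₂, Φ, Φ', -, -, -, hψ⟩ := h.exists_profile hα hβ hc
      rw [hgr, mulOp_toL2, zero_sub]
      conv_lhs => rw [← hv1]
      rw [toL2_eq, toL2_eq, toL2_eq, ← map_sub, ← map_neg]
      congr 1
      ext x
      have := hψ x
      simp only [cplx, ContinuousMap.sub_apply, ContinuousMap.add_apply, ContinuousMap.smul_apply,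
        ContinuousMap.mul_apply, ContinuousMap.neg_apply, ContinuousMap.coe_mk,
        ContinuousMap.one_apply, smul_eq_mul, this]
      rw [← Complex.ofReal_sub, ← Complex.ofReal_neg]
      congr 1
      field_simp
      ring
    · rw [hgr]
      exact (isRealEven_toL2 hge n).2
  have hu : IsUnit (ContinuousLinearMap.id ℝ (L2per L) - waveDeriv α β c σ φ) := by
    have := (spectrum.mem_resolventSet_iff).1 key
    rwa [map_one] at this
  obtain ⟨U, hU⟩ := hu
  exact ⟨ContinuousLinearEquiv.ofUnit U, hU⟩

end Linearization

/-! ### Construction of the branch -/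

section Branch

variable {L : ℝ} [hL : Fact (0 < L)] {α β c σ γ : ℝ} {φ ψ : C(AddCircle L, ℝ)}

theorem contDiffAt_kResolventSymbol (hc : 0 < c) (hγ : γ < 0) {n : WithTop ℕ∞} :
    ContDiffAt ℝ n (kResolventSymbol L hc) γ :=
  (contDiffAt_kSymbol L hc hγ).mul contDiffAt_const

theorem waveMap_eq_zero_of_fixedPoint (hc : 0 < c) {u : L2per L} (hφ : cplx φ = greenC L u)
    (hφe : ∀ x, φ (-x) = φ x) (hψe : ∀ x, ψ (-x) = ψ x)
    (hψ : toL2 ψ = -((β : ℂ) • fmul (kSymbol L hc γ) (toL2 (φ * φ))))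
    (hu : waveTerm α β σ (kResolventSymbol L hc γ, u) = u) :
    waveMap α β σ (kResolventSymbol L hc γ, u) = 0 := by
  have he : ∀ x, ((1 - σ) • φ - α • (ψ * φ)) (-x) = ((1 - σ) • φ - α • (ψ * φ)) x := fun x => by
    simp only [ContinuousMap.sub_apply, ContinuousMap.smul_apply, ContinuousMap.mul_apply, hφe, hψe]
  have h1 := (isRealEven_toL2 he).realEvenPart_eq
  rw [← waveTerm_eq hc hφ hψ, hu] at h1
  rw [waveMap, hu, h1, sub_self]

/-- The implicit function theorem at the dnoidal wave. -/
theorem exists_solution_curve (hc : 0 < c) {u₀ : L2per L} (hφ : cplx φ = greenC L u₀)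
    (h0 : waveMap α β σ (kResolventSymbol L hc 0, u₀) = 0)
    (hinv : (ContinuousLinearMap.id ℝ (L2per L) - waveDeriv α β c σ φ).IsInvertible) :
    ∃ γ₁ : ℝ, 0 < γ₁ ∧ ∃ u : ℝ → L2per L, u 0 = u₀ ∧ ContinuousOn u (Ioc (-γ₁) 0) ∧
      (∀ γ ∈ Ioo (-γ₁) 0, ContDiffAt ℝ ∞ u γ) ∧
      ∀ γ ∈ Ioc (-γ₁) 0, waveMap α β σ (kResolventSymbol L hc γ, u γ) = 0 := by
  set q := kResolventSymbol L hc with hq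
  have hF : ContDiffAt ℝ ω (waveMap α β σ) (q 0, u₀) := (contDiff_waveMap α β σ).contDiffAt
  have hn : (ω : WithTop ℕ∞) ≠ 0 := by decide
  have hd : fderiv ℝ (waveMap α β σ) (q 0, u₀) ∘L ContinuousLinearMap.inr ℝ _ _ =
      ContinuousLinearMap.id ℝ (L2per L) - waveDeriv α β c σ φ := by
    have h1 : HasFDerivAt (waveMap α β σ) _ (q 0, u₀) := (hF.differentiableAt hn).hasFDerivAt
    exact (h1.comp u₀ (hasFDerivAt_prodMk_right (q 0) u₀)).unique (hasFDerivAt_waveMap_zero hc hφ)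
  have hi : (fderiv ℝ (waveMap α β σ) (q 0, u₀) ∘L ContinuousLinearMap.inr ℝ _ _).IsInvertible := by
    rw [hd]; exact hinv
  -- The implicit function depends on the multiplier. Composition with γ ↦ q γ, which is continuous
  -- at 0 and smooth for γ < 0, gives exactly the regularity demanded of a branch.
  set Ψ := hF.implicitFunction hn hi with hΨ
  have e1 : ∀ᶠ m in 𝓝 (q 0), waveMap α β σ (m, Ψ m) = 0 := by
    have := hF.eventually_apply_implicitFunction hn hi
    rwa [h0] at this
  have e2 : ∀ᶠ m in 𝓝 (q 0), ContDiffAt ℝ ω Ψ m :=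
    (hF.contDiffAt_implicitFunction hn hi).eventually (by decide)
  have e3 := (continuous_kResolventSymbol L hc).continuousAt.eventually (e1.and e2)
  obtain ⟨γ₁, hγ₁, hball⟩ := Metric.eventually_nhds_iff.1 e3
  have hmem : ∀ γ ∈ Ioc (-γ₁) 0, dist γ 0 < γ₁ := fun γ hγ => by
    rw [Real.dist_eq, sub_zero, abs_of_nonpos hγ.2]
    linarith [hγ.1]
  refine ⟨γ₁, hγ₁, fun γ => Ψ (q γ), hF.implicitFunction_apply_self hn hi, fun γ hγ => ?_,
    fun γ hγ => ?_, fun γ hγ => (hball (hmem γ hγ)).1⟩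
  · exact ((hball (hmem γ hγ)).2.continuousAt.comp
      (continuous_kResolventSymbol L hc).continuousAt).continuousWithinAt
  · exact ((hball (hmem γ (Ioo_subset_Ioc_self hγ))).2.of_le le_top).comp γ
      (contDiffAt_kResolventSymbol hc hγ.2)

/-- The second component of the wave, weighted by `(1 + n²)^{1/2}`. -/
def weightedPsi (β : ℝ) (hc : 0 < c) (γ : ℝ) (u : L2per L) : L2per L :=
  -((β : ℂ) • fmul (kSymbol L hc γ) (fmul (bddSymbol _ _ (norm_weight_le (L := L))) (sqH1 u)))

theorem coeff_weightedPsi (hc : 0 < c) {u : L2per L} (hφ : cplx φ = greenC L u) (n : ℤ) :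
    fourierBasis.repr (weightedPsi β hc γ u) n = (((1 + (n : ℝ) ^ 2) ^ ((1 : ℝ) / 2) : ℝ) : ℂ) *
      fourierBasis.repr (-((β : ℂ) • fmul (kSymbol L hc γ) (toL2 (φ * φ)))) n := by
  rw [weightedPsi, map_neg, lp.coeFn_neg, Pi.neg_apply, map_smul, lp.coeFn_smul, Pi.smul_apply,
    coeff_kSymbol, coeff_fmul, coeff_sqH1, map_neg, lp.coeFn_neg, Pi.neg_apply, map_smul,
    lp.coeFn_smul, Pi.smul_apply, coeff_kSymbol, toL2_eq, coeff_toLp, cplx_mul, hφ, smul_eq_mul,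
    smul_eq_mul]
  change -(_ * (_ * ((_ * (1 + Complex.I * (waveNumber L n : ℂ))⁻¹) * _))) = _
  have := one_add_I_mul_ne_zero (waveNumber L n)
  field_simp

/-- The H¹ weight makes the Fourier series of ψ converge uniformly, and evenness of the symbol in n
keeps ψ real and even. -/
theorem exists_real_psi (hc : 0 < c) {u : L2per L} (hφ : cplx φ = greenC L u)
    (hφe : ∀ x, φ (-x) = φ x) :
    ∃ ψ : C(AddCircle L, ℝ), (∀ x, ψ (-x) = ψ x) ∧
      toL2 ψ = -((β : ℂ) • fmul (kSymbol L hc γ) (toL2 (φ * φ))) := by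
  set g := synth (hsWeight 1 le_rfl) (weightedPsi β hc γ u) with hg
  have h1 : (ContinuousMap.toLp 2 haarAddCircle ℂ g : L2per L) =
      -((β : ℂ) • fmul (kSymbol L hc γ) (toL2 (φ * φ))) := by
    refine coeff_ext fun n => ?_
    rw [coeff_toLp, hg, fourierCoeff_synth, coeff_weightedPsi hc hφ, hsWeight_apply, ← mul_assoc,
      ← Complex.ofReal_mul, ← Real.rpow_add (by positivity), neg_add_cancel, Real.rpow_zero,
      Complex.ofReal_one, one_mul]
  have he : ∀ x, (φ * φ) (-x) = (φ * φ) x := fun x => by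
    simp only [ContinuousMap.mul_apply, hφe]
  have h2 : IsRealEven (ContinuousMap.toLp 2 haarAddCircle ℂ g : L2per L) := by
    rw [h1]
    refine (isRealEven_toL2 he).of_coeff (m := fun n => -(β * kReal L c γ n))
      (fun n => by rw [kReal_neg]) fun n => ?_
    rw [map_neg, lp.coeFn_neg, Pi.neg_apply, map_smul, lp.coeFn_smul, Pi.smul_apply, coeff_kSymbol,
      smul_eq_mul]
    push_cast; ring
  obtain ⟨h3, h4⟩ := h2.exists_real
  exact ⟨reC g, h4, by rw [toL2_eq, h3, h1]⟩

/-- A zero u lies in the range of the projection, so it is real and even; then so is the nonlinear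
term, and the projection can be dropped from the equation. -/
theorem exists_wave_of_waveMap_eq_zero (hc : 0 < c) (hγ : γ ≤ 0) {u : L2per L}
    (hu : waveMap α β σ (kResolventSymbol L hc γ, u) = 0) :
    ∃ φ ψ : C(AddCircle L, ℝ), cplx φ = greenC L u ∧
      toL2 ψ = -((β : ℂ) • fmul (kSymbol L hc γ) (toL2 (φ * φ))) ∧
      (∀ x, φ (-x) = φ x) ∧ (∀ x, ψ (-x) = ψ x) ∧ IsTravelingWave α β γ c σ φ ψ := by
  have h1 : u = realEvenPart (waveTerm α β σ (kResolventSymbol L hc γ, u)) := sub_eq_zero.1 hu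
  have h2 : IsRealEven u := by rw [h1]; exact isRealEven_realEvenPart _
  obtain ⟨φ, hφ, hφe⟩ := h2.exists_greenC
  obtain ⟨ψ, hψe, hψ⟩ := exists_real_psi (β := β) (γ := γ) hc hφ hφe
  refine ⟨φ, ψ, hφ, hψ, hφe, hψe, isTravelingWave_of_fixedPoint hc hγ hφ hψ ?_⟩
  have he : ∀ x, ((1 - σ) • φ - α • (ψ * φ)) (-x) = ((1 - σ) • φ - α • (ψ * φ)) x := fun x => by
    simp only [ContinuousMap.sub_apply, ContinuousMap.smul_apply, ContinuousMap.mul_apply, hφe, hψe]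
  have h3 := (isRealEven_toL2 he).realEvenPart_eq
  rw [← waveTerm_eq hc hφ hψ] at h3
  rw [← h3, ← h1]

variable (L) in
/-- The Fourier coefficients as a real linear map. -/
def coeffCLM : L2per L →L[ℝ] lp (fun _ : ℤ => ℂ) 2 :=
  ((fourierBasis (T := L)).repr.toContinuousLinearEquiv.toContinuousLinearMap).restrictScalars ℝ

theorem isCurveInHs_of_greenC {γ₁ : ℝ} {u : ℝ → L2per L} {φ : ℝ → C(AddCircle L, ℝ)}
    (hφ : ∀ γ ∈ Ioc (-γ₁) 0, cplx (φ γ) = greenC L (u γ)) (hu : ContinuousOn u (Ioc (-γ₁) 0))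
    (hu' : ∀ γ ∈ Ioo (-γ₁) 0, ContDiffAt ℝ ∞ u γ) : IsCurveInHs 2 γ₁ φ := by
  let T : L2per L →L[ℝ] lp (fun _ : ℤ => ℂ) 2 := coeffCLM L ∘L
    (fmul (bddSymbol _ _ (norm_weight_two_le (L := L)))).restrictScalars ℝ
  refine ⟨fun γ => T (u γ), fun γ hγ n => ?_, T.continuous.comp_continuousOn hu, fun γ hγ =>
    (T.contDiff.contDiffAt.comp γ (hu' γ hγ)).contDiffWithinAt⟩
  rw [hφ γ hγ, fourierCoeff_greenC]
  change fourierBasis.repr (fmul _ (u γ)) n = _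
  rw [coeff_fmul]
  change (((1 + (n : ℝ) ^ 2) * (1 + waveNumber L n ^ 2)⁻¹ : ℝ) : ℂ) * _ = _
  rw [div_self two_ne_zero, Real.rpow_one, Complex.ofReal_mul, mul_assoc]

theorem isCurveInHs_of_weightedPsi (hc : 0 < c) {γ₁ : ℝ} {u : ℝ → L2per L}
    {φ ψ : ℝ → C(AddCircle L, ℝ)}
    (hφ : ∀ γ ∈ Ioc (-γ₁) 0, cplx (φ γ) = greenC L (u γ))
    (hψ : ∀ γ ∈ Ioc (-γ₁) 0,
      toL2 (ψ γ) = -((β : ℂ) • fmul (kSymbol L hc γ) (toL2 (φ γ * φ γ))))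
    (hu : ContinuousOn u (Ioc (-γ₁) 0)) (hu' : ∀ γ ∈ Ioo (-γ₁) 0, ContDiffAt ℝ ∞ u γ) :
    IsCurveInHs 1 γ₁ ψ := by
  set M := bddSymbol _ _ (norm_weight_le (L := L)) with hM
  have hsq : Continuous (sqH1 : L2per L → L2per L) := (contDiff_sqH1 (n := 0)).continuous
  have hsmooth : ∀ γ ∈ Ioo (-γ₁) 0, ContDiffAt ℝ ∞ (fun γ => weightedPsi β hc γ (u γ)) γ := by
    intro γ hγ
    have h1 : ContDiffAt ℝ ∞ (fun γ => fmul M (sqH1 (u γ))) γ :=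
      ((fmul (L := L) M).restrictScalars ℝ).contDiff.contDiffAt.comp γ
        (contDiff_sqH1.contDiffAt.comp γ (hu' γ hγ))
    have h2 : ContDiffAt ℝ ∞ (fun γ => fmul (kSymbol L hc γ) (fmul M (sqH1 (u γ)))) γ :=
      ((fmul (L := L).bilinearRestrictScalars ℝ).contDiff.contDiffAt.comp γ
        (contDiffAt_kSymbol L hc hγ.2)).clm_apply h1
    exact (h2.const_smul β).neg
  refine ⟨fun γ => coeffCLM L (weightedPsi β hc γ (u γ)), fun γ hγ n => ?_, fun γ hγ => ?_,
    fun γ hγ => ((coeffCLM L).contDiff.contDiffAt.comp γ (hsmooth γ hγ)).contDiffWithinAt⟩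
  · refine (coeff_weightedPsi hc (hφ γ hγ) n).trans ?_
    rw [← hψ γ hγ, toL2_eq, coeff_toLp]
  · refine (coeffCLM L).continuous.continuousAt.comp_continuousWithinAt ?_
    rcases hγ.2.lt_or_eq with h0 | h0
    · exact (hsmooth γ ⟨hγ.1, h0⟩).continuousAt.continuousWithinAt
    -- At γ = 0 the multiplier is not norm continuous, but strong convergence with the uniform bound
    -- 1/c suffices for a convergent family of arguments.
    · subst h0
      have h1 : Tendsto (fun γ => fmul M (sqH1 (u γ))) (𝓝[Ioc (-γ₁) 0] 0)
          (𝓝 (fmul M (sqH1 (u 0)))) :=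
        (((fmul (L := L) M).continuous.comp hsq).tendsto (u 0)).comp (hu 0 hγ)
      exact ((tendsto_fmul_kSymbol hc nhdsWithin_le_nhds h1).const_smul (β : ℂ)).neg

theorem exists_isWaveBranch (hα : 0 < α) (hβ : 0 < β) (hc : 0 < c)
    (hσ : 2 * Real.pi ^ 2 / L ^ 2 < σ) :
    ∃ γ₁ : ℝ, 0 < γ₁ ∧ ∃ φ ψ : ℝ → C(AddCircle L, ℝ), IsWaveBranch α β c σ γ₁ φ ψ := by
  obtain ⟨φ₀, ψ₀, hdn⟩ := exists_isDnoidalWave hL.out hα hβ hc hσ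
  obtain ⟨u₀, hu₀, hfix⟩ := hdn.exists_fixedPoint hα hβ hc
  have hφ₀ := hdn.even hα hβ hc
  have hψ₀L := hdn.toL2_snd hα hβ hc
  have hψ₀ : ∀ x, ψ₀ (-x) = ψ₀ x := by
    obtain ⟨η₁, η₂, Φ, Φ', -, -, -, hψ⟩ := hdn.exists_profile hα hβ hc
    intro x
    rw [hψ, hψ, hφ₀]
  obtain ⟨γ₁, hγ₁, u, hu0, huc, hus, hsol⟩ := exists_solution_curve hc hu₀
    (waveMap_eq_zero_of_fixedPoint hc hu₀ hφ₀ hψ₀ hψ₀L hfix) (hdn.isInvertible hα hβ hc)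
  -- Pointwise choice loses no regularity, since φ and ψ are determined by u γ through their Fourier
  -- coefficients. Outside the interval the value 0 is a dummy.
  have hex : ∀ γ : ℝ, ∃ φ ψ : C(AddCircle L, ℝ), γ ∈ Ioc (-γ₁) 0 → cplx φ = greenC L (u γ) ∧
      toL2 ψ = -((β : ℂ) • fmul (kSymbol L hc γ) (toL2 (φ * φ))) ∧
      (∀ x, φ (-x) = φ x) ∧ (∀ x, ψ (-x) = ψ x) ∧ IsTravelingWave α β γ c σ φ ψ := by
    intro γ
    by_cases hγ : γ ∈ Ioc (-γ₁) 0
    · obtain ⟨φ, ψ, h⟩ := exists_wave_of_waveMap_eq_zero hc hγ.2 (hsol γ hγ)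
      exact ⟨φ, ψ, fun _ => h⟩
    · exact ⟨0, 0, fun h => absurd h hγ⟩
  choose φ ψ hφψ using hex
  have h0 : (0 : ℝ) ∈ Ioc (-γ₁) 0 := ⟨by linarith, le_rfl⟩
  have eφ : φ 0 = φ₀ := cplx_injective (by rw [(hφψ 0 h0).1, hu0, hu₀])
  have eψ : ψ 0 = ψ₀ := cplx_injective (toLp_injective (by
    rw [← toL2_eq, ← toL2_eq, (hφψ 0 h0).2.1, eφ, hψ₀L]))
  refine ⟨γ₁, hγ₁, φ, ψ, fun γ hγ x => ⟨(hφψ γ hγ).2.2.1 x, (hφψ γ hγ).2.2.2.1 x⟩,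
    fun γ hγ => (hφψ γ hγ).2.2.2.2, isCurveInHs_of_greenC (fun γ hγ => (hφψ γ hγ).1) huc hus,
    isCurveInHs_of_weightedPsi hc (fun γ hγ => (hφψ γ hγ).1) (fun γ hγ => (hφψ γ hγ).2.1) huc hus,
    ?_⟩
  rw [eφ, eψ]
  exact hdn

end Branch

end

theorem theorem8 (L : ℝ) [Fact (0 < L)] (α β c σ : ℝ) (hα : 0 < α) (hβ : 0 < β) (hc : 0 < c)
    (hσ : 2 * Real.pi ^ 2 / L ^ 2 < σ) :
    (∃ γ₁ : ℝ, 0 < γ₁ ∧ ∃ φ ψ : ℝ → C(AddCircle L, ℝ), IsWaveBranch α β c σ γ₁ φ ψ) ∧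
    ∀ (γ₁ : ℝ) (_ : 0 < γ₁) (φ ψ : ℝ → C(AddCircle L, ℝ)), IsWaveBranch α β c σ γ₁ φ ψ →
      ∃ γ₂ : ℝ, 0 < γ₂ ∧ γ₂ ≤ γ₁ ∧ ∀ (γ : ℝ) (hγ : γ ∈ Set.Ioo (-γ₂) 0),
        -- both operators are self-adjoint
        IsSelfAdjoint (opL α β σ hγ.2.le hc (φ γ) (ψ γ)) ∧
        IsSelfAdjoint (opLplus α σ (ψ γ)) ∧
        -- spectrum of the nonlocal operator
        (∃ lam : ℝ, lam < 0 ∧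
          (∃ χ : L2per L,
            IsSimpleEigenpair (opL α β σ hγ.2.le hc (φ γ) (ψ γ)) (lam : ℂ) χ ∧
            ∫ x : AddCircle L, (φ γ x : ℂ) * χ x ≠ 0) ∧
          (∃ h : toL2 (φ γ) ∈ (ddx L).domain,
            IsSimpleEigenpair (opL α β σ hγ.2.le hc (φ γ) (ψ γ)) 0 (ddx L ⟨toL2 (φ γ), h⟩)) ∧
          (∃ η : ℝ, 0 < η ∧ ∀ z ∈ opSpectrum (opL α β σ hγ.2.le hc (φ γ) (ψ γ)),
            z ≠ (lam : ℂ) → z ≠ 0 → ∃ r : ℝ, η < r ∧ z = (r : ℂ))) ∧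
        -- spectrum of the local operator
        (∀ f : (opLplus α σ (ψ γ)).domain,
          0 ≤ (inner ℂ (f : L2per L) (opLplus α σ (ψ γ) f)).re) ∧
        IsSimpleEigenpair (opLplus α σ (ψ γ)) 0 (toL2 (φ γ)) ∧
        (∀ z ∈ opSpectrum (opLplus α σ (ψ γ)), z ≠ 0 →
          (∃ r : ℝ, 0 < r ∧ z = (r : ℂ)) ∧ opEigenspace (opLplus α σ (ψ γ)) z ≠ ⊥) ∧
        (∀ R : ℝ, (opSpectrum (opLplus α σ (ψ γ)) ∩ Metric.closedBall 0 R).Finite) := by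
  refine ⟨exists_isWaveBranch hα hβ hc hσ, fun γ₁ hγ₁ φ ψ h => ?_⟩
  obtain ⟨γ₂, h1, h2, h3⟩ := h.spectral_properties hα hβ hc hγ₁
  refine ⟨γ₂, h1, h2, fun γ hγ => ?_⟩
  obtain ⟨⟨h4, h5⟩, h6, h7⟩ := h3 γ hγ
  obtain ⟨h8, h9⟩ := opLplus_properties h6 h7
  exact ⟨h4, h8, h5, h9⟩
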